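/- **Setting.** Let $d\ge 1$ and $\mathcal M(v)=(2\pi)^{-d/2}e^{-|v|^2/2}$ on $\mathbb R^d$. Let $b$ be a measurable, even, nonnegative function on $[-1,1]$ with $\int_{\mathbb S^{d-1}}b(e\cdot\sigma)\,d\sigma=1$ for every unit vector $e$. Write $v'=\frac{v+v_*}2+\frac{|v-v_*|}2\sigma$, $v'_*=\frac{v+v_*}2-\frac{|v-v_*|}2\sigma$, $\cos\theta=\frac{v-v_*}{|v-v_*|}\cdot\sigma$, and for $\alpha>-d$ $$\bm L_\alpha f(v)=\int_{\mathbb R^d\times\mathbb S^{d-1}}|v-v_*|^\alpha b(\cos\theta)\big(f(v')\mathcal M(v'_*)-f(v)\mathcal M(v_*)\big)\,dv_*\,d\sigma,$$ $$\bm K_\alpha f(v)=\int_{\mathbb R^d\times\mathbb S^{d-1}}|v-v_*|^\alpha b(\cos\theta)f(v')\mathcal M(v'_*)\,dv_*\,d\sigma,$$ $$\mathscr D_\alpha(f)=-\int_{\mathbb R^d}\bm L_\alpha f\,\log\frac f{\mathcal M}\,dv,\qquad H(f|\mathcal M)=\int_{\mathbb R^d}\mathcal M\,\Phi\Big(\frac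 f{\mathcal M}\Big)dv,\quad \Phi(x)=x\log x-x+1 .$$ With $\langle v\rangle=\sqrt{1+|v|^2}$, let $L^1_s$ and $L^1_s\log L$ be the sets of measurable $f$ with $\int\langle v\rangle^s|f|\,dv<\infty$, respectively $\int\langle v\rangle^s|f|\,|\log|f||\,dv<\infty$. In $\mathscr D_\alpha(f)$ and in $\int\bm K_\mu f\log f\,dv$ we use $\log 0=-\infty$ and $0\cdot\infty=0$, and the integrals are taken in $[-\infty,\infty]$ (they are said to exist if the positive or the negative part of the integrand has a finite integral). In the products below, $0\cdot\infty=0$, and a negative power of $0$ (of $\infty$) is $\infty$ (is $0$). **Theorem.** (a) For every such $b$ there is $\lambda_0>0$, depending only on $d$ and $b$, such that, for every nonnegative $f\in L^1_0\log L\cap L^1_2$ with unit mass, $\mathscr D_0(f)$ exists and $\mathscr D_0(f)\ge\lambda_0H(f|\mathcal M)$, and such that the following holds. Let $\gamma\in(-d,0)$, $\mu>0$, and let $f\in L^1_\mu\log L\cap L^1_{\mu+2}$ be nonnegative with unit mass. Then $\mathscr D_\gamma(f),\mathscr D_0(f),\mathscr D_\mu(f)$ exist in $[0,\infty]$, $H(f|\mathcal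 M)<\infty$, and $$\mathscr D_\gamma(f)\ \ge\ \mathscr D_0(f)^{\frac{\mu-\gamma}{\mu}}\,\mathscr D_\mu(f)^{\frac\gamma\mu}\ \ge\ \lambda_0^{1-\frac\gamma\mu}\,\mathscr D_\mu(f)^{\frac\gamma\mu}\,H(f|\mathcal M)^{1-\frac\gamma\mu}.$$ (b) For every $\mu>0$ there are constants $C_1,C_2>0$, depending only on $\mu$ and $d$, such that for every such $b$ and every nonnegative $f\in L^1_\mu\log L\cap L^1_{\mu+2}$ with unit mass, the first two integrals on the right-hand side below converge absolutely, the third one exists, and $$\mathscr D_\mu(f)\ \le\ C_1\int_{\mathbb R^d}(1+|v|)^\mu f\log f\,dv+C_2\int_{\mathbb R^d}(1+|v|)^{\mu+2}f\,dv-\int_{\mathbb R^d}\bm K_\mu f\,\log f\,dv .$$ -/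

import Mathlib

open MeasureTheory Metric
open scoped ENNReal RealInnerProductSpace

noncomputable section

namespace LinBoltz

/-- The velocity space `ℝ^d` with its Euclidean structure. -/
abbrev Vel (d : ℕ) := EuclideanSpace ℝ (Fin d)

/-- The unit sphere of `ℝ^d`. -/
abbrev Sph (d : ℕ) := sphere (0 : Vel d) 1

/-- The surface measure on the unit sphere. -/
abbrev sphMeasure (d : ℕ) : Measure (Sph d) := (volume : Measure (Vel d)).toSphere

/-- The normalised Maxwellian `(2π)^{-d/2} exp (-|v|²/2)`. -/
def maxwellian {d : ℕ} (v : Vel d) : ℝ :=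
  1 / (2 * Real.pi) ^ ((d : ℝ) / 2) * Real.exp (-‖v‖ ^ 2 / 2)

/-- `b` (only its values on `[-1,1]` matter) is a nonnegative even angular kernel satisfying the
cut-off assumption, normalised by `∫_{S^{d-1}} b(e·σ) dσ = 1` for every unit vector `e`. -/
structure IsAngularKernel (d : ℕ) (b : ℝ → ℝ) : Prop where
  measurable : Measurable b
  nonneg : ∀ s ∈ Set.Icc (-1 : ℝ) 1, 0 ≤ b s
  even : ∀ s ∈ Set.Icc (-1 : ℝ) 1, b (-s) = b s
  normalised : ∀ e : Vel d, ‖e‖ = 1 →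
    ∫⁻ σ : Sph d, ENNReal.ofReal (b ⟪e, (σ : Vel d)⟫) ∂(sphMeasure d) = 1

/-- `v' = (v + v⋆)/2 + |v - v⋆| σ / 2`. -/
def vPrime {d : ℕ} (v w : Vel d) (σ : Sph d) : Vel d :=
  (1 / 2 : ℝ) • (v + w) + (‖v - w‖ / 2) • (σ : Vel d)

/-- `v⋆' = (v + v⋆)/2 - |v - v⋆| σ / 2`. -/
def wPrime {d : ℕ} (v w : Vel d) (σ : Sph d) : Vel d :=
  (1 / 2 : ℝ) • (v + w) - (‖v - w‖ / 2) • (σ : Vel d)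

/-- `cos θ = (v - v⋆)/|v - v⋆| · σ`. -/
def cosTheta {d : ℕ} (v w : Vel d) (σ : Sph d) : ℝ :=
  ⟪(‖v - w‖⁻¹) • (v - w), (σ : Vel d)⟫

/-- The interaction kernel `|v - v⋆|^α b(cos θ)`. -/
def collKernel {d : ℕ} (b : ℝ → ℝ) (α : ℝ) (v w : Vel d) (σ : Sph d) : ℝ :=
  ‖v - w‖ ^ α * b (cosTheta v w σ)

/-- The bilinear Boltzmann collision operator `Q_α(f,g)`. -/
def collisionOp {d : ℕ} (b : ℝ → ℝ) (α : ℝ) (f g : Vel d → ℝ) (v : Vel d) : ℝ :=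
  ∫ p : Vel d × Sph d,
    collKernel b α v p.1 p.2 *
      (f (vPrime v p.1 p.2) * g (wPrime v p.1 p.2) - f v * g p.1)
    ∂((volume : Measure (Vel d)).prod (sphMeasure d))

/-- The linear Boltzmann operator `L_α f = Q_α(f, M)`. -/
def linBoltzmann {d : ℕ} (b : ℝ → ℝ) (α : ℝ) (f : Vel d → ℝ) : Vel d → ℝ :=
  collisionOp b α f maxwellian

/-- The gain operator `K_α`. -/
def gainOp {d : ℕ} (b : ℝ → ℝ) (α : ℝ) (f : Vel d → ℝ) (v : Vel d) : ℝ :=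
  ∫ p : Vel d × Sph d,
    collKernel b α v p.1 p.2 * f (vPrime v p.1 p.2) * maxwellian (wPrime v p.1 p.2)
    ∂((volume : Measure (Vel d)).prod (sphMeasure d))

/-- The logarithm of a nonnegative real number as an extended real, with `log 0 = -∞`. -/
def elog (x : ℝ) : EReal := ENNReal.log (ENNReal.ofReal x)

/-- `∫ g⁺` for an extended-real function. -/
def posInt {d : ℕ} (g : Vel d → EReal) : ℝ≥0∞ := ∫⁻ v, (g v).toENNReal

/-- `∫ g⁻` for an extended-real function. -/
def negInt {d : ℕ} (g : Vel d → EReal) : ℝ≥0∞ := ∫⁻ v, (-(g v)).toENNReal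

/-- The integral of `g` makes sense in `[-∞, ∞]`: one of `∫ g⁺`, `∫ g⁻` is finite. -/
def HasExtIntegral {d : ℕ} (g : Vel d → EReal) : Prop := posInt g ≠ ⊤ ∨ negInt g ≠ ⊤

/-- The extended Lebesgue integral `∫ g = ∫ g⁺ - ∫ g⁻`, meaningful under `HasExtIntegral g`. -/
def extIntegral {d : ℕ} (g : Vel d → EReal) : EReal := (posInt g : EReal) - (negInt g : EReal)

/-- The integrand `L_α f · log (f / M)`. -/
def productionIntegrand {d : ℕ} (b : ℝ → ℝ) (α : ℝ) (f : Vel d → ℝ) (v : Vel d) : EReal :=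
  (linBoltzmann b α f v : EReal) * elog (f v / maxwellian v)

/-- The entropy production `D_α(f) = - ∫ L_α f log (f / M) dv`. -/
def entropyProduction {d : ℕ} (b : ℝ → ℝ) (α : ℝ) (f : Vel d → ℝ) : EReal :=
  -extIntegral (productionIntegrand b α f)

/-- The integrand `K_α f · log f`. -/
def gainLogIntegrand {d : ℕ} (b : ℝ → ℝ) (α : ℝ) (f : Vel d → ℝ) (v : Vel d) : EReal :=
  (gainOp b α f v : EReal) * elog (f v)

/-- The Boltzmann relative entropy `H(f|M) = ∫ M Φ(f/M) dv`, `Φ(x) = x log x - x + 1 ≥ 0`. -/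
def relEntropy {d : ℕ} (f : Vel d → ℝ) : ℝ≥0∞ :=
  ∫⁻ v, ENNReal.ofReal (maxwellian v *
    (f v / maxwellian v * Real.log (f v / maxwellian v) - f v / maxwellian v + 1))

/-- `⟨v⟩ = √(1 + |v|²)`. -/
def bracket {d : ℕ} (v : Vel d) : ℝ := Real.sqrt (1 + ‖v‖ ^ 2)

/-- The weighted space `L¹_s`. -/
def MemL1 {d : ℕ} (s : ℝ) (f : Vel d → ℝ) : Prop :=
  Measurable f ∧ ∫⁻ v, ENNReal.ofReal (bracket v ^ s * abs (f v)) < ⊤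

/-- The space `L¹_s log L`. -/
def MemL1LogL {d : ℕ} (s : ℝ) (f : Vel d → ℝ) : Prop :=
  Measurable f ∧ ∫⁻ v, ENNReal.ofReal (bracket v ^ s * abs (f v) * abs (Real.log (abs (f v)))) < ⊤

/-- A nonnegative function with unit mass. -/
def IsUnitMass {d : ℕ} (f : Vel d → ℝ) : Prop :=
  (∀ v, 0 ≤ f v) ∧ ∫ v, f v = 1

end LinBoltz

end

noncomputable section

namespace LinBoltz

/-! ### The Gaussian measure, and collisions as a symmetry of the phase-space measure. -/

section GaussianMeasure

open ProbabilityTheory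

variable {d : ℕ}

/-! Put h = f/M, so that everything becomes an average against the Gaussian probability `gauss`.
`collKer` is the law of (v⋆, σ) given v, and `collJoint` the law of a whole collision at
equilibrium. Energy, relative speed and deviation angle are the same for a collision and its
inverse, so this law does not change when (v, v⋆) and (v', v⋆') are exchanged (`map_collData_eq`).
Hence D_α(f) equals `prodTotal`, the mean of |v - v⋆|^α times the Bregman divergence of x log x
between h(v') and h(v), plus a remainder whose integral cancels by reversibility
(`entropyProduction_eq`). The decomposition is made pointwise in the extended reals, so zeros of f
and infinite productions are covered.

In this form the interpolation inequality is Hölder's inequality, 0 being a convex combination of γ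
and μ (`prodTotal_zero_le`).

The linear inequality for α = 0 holds with λ₀ = 1/2, whatever d and b. Let Kh(v) be the conditional
mean of h(v') given v (`gainK`). A mean Bregman divergence is smallest when the reference value is
the mean (`lintegral_klFun_le_bregman`), so D_0 is at least the entropy of h minus that of Kh, and
it is enough that K halves the entropy (`lintegral_klFun_gainK_le`).

That contraction comes from the Ornstein-Uhlenbeck flow P, along which entropy decays at a rate
given by the Fisher information. K commutes with P (`gainK_ouOp`, from Bobylev's Fourier
computation), so it suffices that K halves the Fisher information. To compare Kg at two nearby
points, σ is rotated along with the relative velocity (`rotPrime`). The transposed derivative T of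
v' in v under this coupling satisfies |Tx|² ≤ (1 + cos θ)|x|²/2 by a Gram determinant
(`norm_add_dRot_le`), and the cos θ term averages to zero because b is even (`coupLimit_le`). Kg is
never differentiated: the Fisher information is replaced by the finite-step quantity `ouProd`, whose
density (x - y)(log x - log y) is jointly convex, so Jensen applies to the coupling
(`ouProd_gainK_le`). The resulting one-sided slope bound is integrated along the flow
(`gEnt_gainK_le`). This is done for Lipschitz g with values in a compact subset of (0, ∞), and
extended to general h by truncation, density in L¹ and Fatou.

For the upper bound, L_μ f log(f/M) and K_μ f log f differ by the real function `gainRem`, which is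
integrable; it is estimated from log M ≤ 0, the quadratic growth of log M and Gaussian moments
(`HasMoments.gainRem_le`). -/

theorem maxwellian_pos (v : Vel d) : 0 < maxwellian v := by
  unfold maxwellian; positivity

@[fun_prop]
theorem continuous_maxwellian : Continuous (maxwellian : Vel d → ℝ) := by
  unfold maxwellian; fun_prop

@[fun_prop]
theorem measurable_maxwellian : Measurable (maxwellian : Vel d → ℝ) :=
  continuous_maxwellian.measurable

/-- The standard Gaussian probability measure, with density the Maxwellian. -/
def gauss (d : ℕ) : Measure (Vel d) :=
  volume.withDensity fun v => ENNReal.ofReal (maxwellian v)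

theorem maxwellian_eq (v : Vel d) :
    maxwellian v = ((2 * Real.pi) ^ ((d : ℝ) / 2))⁻¹ * Real.exp (-(1 / 2) * ‖v‖ ^ 2) := by
  unfold maxwellian; rw [one_div]; congr 2; ring

theorem integrable_maxwellian : Integrable (maxwellian : Vel d → ℝ) := by
  have h := GaussianFourier.integrable_cexp_neg_mul_sq_norm_add (V := Vel d)
    (b := (1 / 2 : ℂ)) (by norm_num) 0 0
  have h2 := h.norm.const_mul ((2 * Real.pi) ^ ((d : ℝ) / 2))⁻¹
  refine h2.congr (ae_of_all _ fun v => ?_)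
  simp only [maxwellian_eq, Complex.norm_exp]
  congr 2
  simp
  norm_cast

theorem integral_maxwellian : ∫ v : Vel d, maxwellian v = 1 := by
  simp_rw [maxwellian_eq]
  rw [integral_const_mul, GaussianFourier.integral_rexp_neg_mul_sq_norm (by norm_num)]
  have : Real.pi / (1 / 2) = 2 * Real.pi := by ring
  rw [this, finrank_euclideanSpace_fin]
  exact inv_mul_cancel₀ (by positivity)

instance : IsProbabilityMeasure (gauss d) where
  measure_univ := by
    rw [gauss, withDensity_apply _ MeasurableSet.univ, setLIntegral_univ,
      ← ofReal_integral_eq_lintegral_ofReal integrable_maxwellian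
        (ae_of_all _ fun v => (maxwellian_pos v).le), integral_maxwellian, ENNReal.ofReal_one]

theorem lintegral_gauss {F : Vel d → ℝ≥0∞} (hF : Measurable F) :
    ∫⁻ v, F v ∂(gauss d) = ∫⁻ v, ENNReal.ofReal (maxwellian v) * F v := by
  rw [gauss, lintegral_withDensity_eq_lintegral_mul _ (by fun_prop) hF]
  rfl

theorem gauss_ac : gauss d ≪ volume := withDensity_absolutelyContinuous _ _

theorem ac_gauss : (volume : Measure (Vel d)) ≪ gauss d :=
  withDensity_absolutelyContinuous' (by fun_prop)
    (ae_of_all _ fun v => by simpa using maxwellian_pos v)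

theorem charFun_gauss (t : Vel d) : charFun (gauss d) t = Complex.exp (-‖t‖ ^ 2 / 2) := by
  rw [charFun_apply, gauss,
    integral_withDensity_eq_integral_toReal_smul (by fun_prop) (ae_of_all _ fun v => by simp)]
  have h := GaussianFourier.integral_cexp_neg_mul_sq_norm_add (V := Vel d)
    (b := (1 / 2 : ℂ)) (by norm_num) Complex.I t
  have e : ∀ v : Vel d, (ENNReal.ofReal (maxwellian v)).toReal • Complex.exp (⟪v, t⟫ * Complex.I)
      = (((2 * Real.pi) ^ ((d : ℝ) / 2))⁻¹ : ℝ) *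
        Complex.exp (-(1 / 2 : ℂ) * ‖v‖ ^ 2 + Complex.I * ⟪t, v⟫) := by
    intro v
    rw [ENNReal.toReal_ofReal (maxwellian_pos v).le, maxwellian_eq, Complex.exp_add,
      real_inner_comm, Complex.real_smul]
    push_cast
    ring_nf
  simp_rw [e]
  rw [integral_const_mul, h, finrank_euclideanSpace_fin, ← mul_assoc]
  have : (Real.pi / (1 / 2) : ℂ) = ((2 * Real.pi : ℝ) : ℂ) := by push_cast; ring
  rw [this]
  have h2 : (((2 * Real.pi : ℝ) : ℂ) ^ ((d : ℂ) / 2)) = (((2 * Real.pi) ^ ((d : ℝ) / 2) : ℝ) : ℂ) := by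
    rw [Complex.ofReal_cpow (by positivity)]; norm_num
  rw [h2, ← Complex.ofReal_mul, inv_mul_cancel₀ (by positivity), Complex.ofReal_one, one_mul]
  congr 1
  rw [Complex.I_sq]; ring

/-- Characteristic functions determine finite measures. The identification supplies the zero mean,
the covariance and the rotation invariance used below. -/
theorem gauss_eq_stdGaussian : gauss d = stdGaussian (Vel d) := by
  apply Measure.ext_of_charFun
  ext t
  rw [charFun_gauss, charFun_stdGaussian]

instance : IsGaussian (gauss d) := gauss_eq_stdGaussian (d := d) ▸ inferInstance

/-- Identity covariance; this turns averaged squared directional derivatives into squared gradients.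
-/
theorem integral_inner_sq_gauss (x : Vel d) : ∫ z, ⟪x, z⟫ ^ 2 ∂(gauss d) = ‖x‖ ^ 2 := by
  have h := variance_dual_stdGaussian (E := Vel d) (innerSL ℝ x)
  rw [← gauss_eq_stdGaussian, variance_eq_sub] at h
  · have h0 : (gauss d)[⇑(innerSL ℝ x)] = 0 := by
      rw [gauss_eq_stdGaussian]; exact integral_strongDual_stdGaussian _
    rw [h0] at h
    simpa using h
  · exact IsGaussian.memLp_dual (gauss d) (innerSL ℝ x) 2 (by simp)

theorem memLp_id_gauss : MemLp (fun z : Vel d => z) 2 (gauss d) := IsGaussian.memLp_two_id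

theorem integrable_norm_sq_gauss : Integrable (fun z : Vel d => ‖z‖ ^ 2) (gauss d) :=
  (memLp_two_iff_integrable_sq_norm memLp_id_gauss.1).1 memLp_id_gauss

/-- The involution `(x, z) ↦ (a x + c z, c x - a z)` of `ℝ^d × ℝ^d`. -/
def swapRot (a c : ℝ) (p : Vel d × Vel d) : Vel d × Vel d :=
  (a • p.1 + c • p.2, c • p.1 - a • p.2)

/-- A rotation of the Gaussian pair followed by z ↦ -z in the second slot. The sign makes the map an
involution, so it exchanges x with a x + c z: this is the reversibility of an Ornstein-Uhlenbeck
step. -/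
theorem measurePreserving_swapRot {a c : ℝ} (h : a ^ 2 + c ^ 2 = 1) :
    MeasurePreserving (swapRot a c : Vel d × Vel d → _) ((gauss d).prod (gauss d))
      ((gauss d).prod (gauss d)) := by
  obtain ⟨θ, rfl, rfl⟩ : ∃ θ, a = Real.cos θ ∧ c = Real.sin θ := by
    refine ⟨Complex.arg ⟨a, c⟩, ?_, ?_⟩
    · have hz : ‖(⟨a, c⟩ : ℂ)‖ = 1 := by
        rw [Complex.norm_def, Complex.normSq_mk, Real.sqrt_eq_one]; nlinarith
      rw [Complex.cos_arg (by intro h0; simp [h0] at hz), hz]; simp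
    · have hz : ‖(⟨a, c⟩ : ℂ)‖ = 1 := by
        rw [Complex.norm_def, Complex.normSq_mk, Real.sqrt_eq_one]; nlinarith
      rw [Complex.sin_arg, hz]; simp
  have h1 : MeasurePreserving (ContinuousLinearMap.rotation θ : Vel d × Vel d →L[ℝ] _)
      ((gauss d).prod (gauss d)) ((gauss d).prod (gauss d)) :=
    ⟨by fun_prop, IsGaussian.map_rotation_eq_self
      (by rw [gauss_eq_stdGaussian]; exact integral_id_stdGaussian) θ⟩
  have h2 : MeasurePreserving (fun z : Vel d => -z) (gauss d) (gauss d) := by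
    refine ⟨by fun_prop, ?_⟩
    have := stdGaussian_map (LinearIsometryEquiv.neg ℝ : Vel d ≃ₗᵢ[ℝ] Vel d)
    rw [gauss_eq_stdGaussian]; exact this
  have h3 := ((MeasurePreserving.id (gauss d)).prod h2).comp h1
  have e : (swapRot (Real.cos θ) (Real.sin θ) : Vel d × Vel d → _) =
      Prod.map id (fun z => -z) ∘ (ContinuousLinearMap.rotation θ : Vel d × Vel d →L[ℝ] _) := by
    ext p : 1
    simp [swapRot, ContinuousLinearMap.rotation_apply, sub_eq_add_neg, add_comm]
  rw [e]; exact h3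

/-! ### The surface measure of the sphere -/

/-- The action of a linear isometry on the unit sphere. -/
def sphMap (L : Vel d ≃ₗᵢ[ℝ] Vel d) (σ : Sph d) : Sph d :=
  ⟨L σ, by simp⟩

@[simp]
theorem coe_sphMap (L : Vel d ≃ₗᵢ[ℝ] Vel d) (σ : Sph d) : (sphMap L σ : Vel d) = L σ := rfl

theorem measurable_sphMap (L : Vel d ≃ₗᵢ[ℝ] Vel d) : Measurable (sphMap L) :=
  (L.continuous.measurable.comp measurable_subtype_coe).subtype_mk

open scoped Pointwise in
-- The surface measure is computed from the volume of cones over subsets of the sphere, and a linear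
-- isometry preserves volume and maps cones to cones.
theorem measurePreserving_sphMap (L : Vel d ≃ₗᵢ[ℝ] Vel d) :
    MeasurePreserving (sphMap L) (sphMeasure d) (sphMeasure d) := by
  refine ⟨measurable_sphMap L, ?_⟩
  ext s hs
  rw [Measure.map_apply (measurable_sphMap L) hs,
    Measure.toSphere_apply' _ ((measurable_sphMap L) hs), Measure.toSphere_apply' _ hs]
  congr 1
  rw [← L.measurePreserving.measure_preimage_equiv (f := L.toMeasurableEquiv)
    (Set.Ioo (0 : ℝ) 1 • ((↑) '' s : Set (Vel d)))]
  congr 1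
  ext x
  simp only [Set.mem_smul, Set.mem_image, Set.mem_preimage]
  constructor
  · rintro ⟨r, hr, _, ⟨σ, hσ, rfl⟩, rfl⟩
    exact ⟨r, hr, _, ⟨_, hσ, rfl⟩, by simp⟩
  · rintro ⟨r, hr, _, ⟨σ, hσ, rfl⟩, hx⟩
    refine ⟨r, hr, _, ⟨sphMap L.symm σ, ?_, rfl⟩, ?_⟩
    · have : sphMap L (sphMap L.symm σ) = σ := by ext1; simp
      simpa [this] using hσ
    · have hx' : r • (σ : Vel d) = L x := hx
      rw [coe_sphMap, ← L.symm.map_smul, hx', L.symm_apply_apply]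

theorem lintegral_sphMap (L : Vel d ≃ₗᵢ[ℝ] Vel d) {F : Sph d → ℝ≥0∞} (hF : Measurable F) :
    ∫⁻ σ, F (sphMap L σ) ∂(sphMeasure d) = ∫⁻ σ, F σ ∂(sphMeasure d) :=
  (measurePreserving_sphMap L).lintegral_comp hF

theorem lintegral_polar (hd : 1 ≤ d) {F : Vel d → ℝ≥0∞} (hF : Measurable F) :
    ∫⁻ u, F u = ∫⁻ σ : Sph d, ∫⁻ r : Set.Ioi (0 : ℝ), F (r.1 • (σ : Vel d))
      ∂(Measure.volumeIoiPow (d - 1)) ∂(sphMeasure d) := by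
  have : Nontrivial (Vel d) := by
    have : Nonempty (Fin d) := ⟨⟨0, hd⟩⟩
    infer_instance
  have h1 := (volume : Measure (Vel d)).measurePreserving_homeomorphUnitSphereProd
  have hdim : Module.finrank ℝ (Vel d) = d := finrank_euclideanSpace_fin
  rw [hdim] at h1
  have hG : Measurable fun p : Sph d × Set.Ioi (0 : ℝ) => F (p.2.1 • (p.1 : Vel d)) := by
    fun_prop
  have h2 := h1.lintegral_comp hG
  rw [lintegral_prod _ hG.aemeasurable] at h2
  rw [← h2]
  have h3 : ∀ a : ({0}ᶜ : Set (Vel d)), F ((homeomorphUnitSphereProd (Vel d) a).2.1 •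
      ((homeomorphUnitSphereProd (Vel d) a).1 : Vel d)) = F a := by
    intro a
    congr 1
    have := (homeomorphUnitSphereProd (Vel d)).symm_apply_apply a
    conv_rhs => rw [← this]
    rfl
  simp_rw [h3]
  rw [lintegral_subtype_comap (measurableSet_singleton _).compl, restrict_compl_singleton]

/-! ### The change between pre- and post-collisional velocities -/

/-- The change to mean and relative velocity is a composition of shears, so translation invariance,
used twice, replaces a Jacobian computation. -/
theorem lintegral_center_of_mass {F : Vel d → Vel d → ℝ≥0∞}
    (hF : Measurable (Function.uncurry F)) :
    ∫⁻ v, ∫⁻ w, F v w = ∫⁻ s : Vel d, ∫⁻ u : Vel d, F (s + (1 / 2 : ℝ) • u) (s - (1 / 2 : ℝ) • u) := by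
  have h1 : ∀ v, ∫⁻ w, F v w = ∫⁻ u, F v (v - u) := fun v =>
    (lintegral_sub_left_eq_self (fun w => F v w) v).symm
  simp_rw [h1]
  rw [lintegral_lintegral_swap (by
    apply Measurable.aemeasurable
    exact hF.comp (by fun_prop : Measurable fun p : Vel d × Vel d => (p.1, p.1 - p.2)))]
  rw [lintegral_lintegral_swap (f := fun s u => F (s + (1 / 2 : ℝ) • u) (s - (1 / 2 : ℝ) • u)) (by
    apply Measurable.aemeasurable
    exact hF.comp (by fun_prop : Measurable fun p : Vel d × Vel d =>
      (p.1 + (1 / 2 : ℝ) • p.2, p.1 - (1 / 2 : ℝ) • p.2)))]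
  refine lintegral_congr fun u => ?_
  rw [← lintegral_add_right_eq_self (fun v => F v (v - u)) ((1 / 2 : ℝ) • u)]
  refine lintegral_congr fun s => ?_
  congr 1
  module

/-- `(v, v⋆, v', v⋆', cos θ)` as a function of `(v, v⋆, σ)`. -/
def collData (v w : Vel d) (σ : Sph d) : Vel d × Vel d × Vel d × Vel d × ℝ :=
  (v, w, vPrime v w σ, wPrime v w σ, cosTheta v w σ)

/-- The data `collData` of the inverse collision. -/
def collDataInv (v w : Vel d) (σ : Sph d) : Vel d × Vel d × Vel d × Vel d × ℝ :=
  (vPrime v w σ, wPrime v w σ, v, w, cosTheta v w σ)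

theorem measurable_vPrime :
    Measurable fun p : Vel d × Vel d × Sph d => vPrime p.1 p.2.1 p.2.2 := by
  unfold vPrime; fun_prop

theorem measurable_wPrime :
    Measurable fun p : Vel d × Vel d × Sph d => wPrime p.1 p.2.1 p.2.2 := by
  unfold wPrime; fun_prop

theorem measurable_cosTheta :
    Measurable fun p : Vel d × Vel d × Sph d => cosTheta p.1 p.2.1 p.2.2 := by
  unfold cosTheta; fun_prop

theorem measurable_collData :
    Measurable fun p : Vel d × Vel d × Sph d => collData p.1 p.2.1 p.2.2 := by
  unfold collData
  have := measurable_vPrime (d := d)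
  have := measurable_wPrime (d := d)
  have := measurable_cosTheta (d := d)
  fun_prop

theorem measurable_collDataInv :
    Measurable fun p : Vel d × Vel d × Sph d => collDataInv p.1 p.2.1 p.2.2 := by
  unfold collDataInv
  have := measurable_vPrime (d := d)
  have := measurable_wPrime (d := d)
  have := measurable_cosTheta (d := d)
  fun_prop

/-- Collision data in terms of the mean velocity `s`, the relative speed `r` and the directions
of the relative velocity before and after the collision. -/
def sphData (s : Vel d) (r : ℝ) (k σ : Vel d) : Vel d × Vel d × Vel d × Vel d × ℝ :=
  (s + (r / 2) • k, s - (r / 2) • k, s + (r / 2) • σ, s - (r / 2) • σ, ⟪k, σ⟫)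

theorem collData_polar (s : Vel d) {r : ℝ} (hr : 0 < r) (k σ : Sph d) :
    collData (s + (1 / 2 : ℝ) • r • (k : Vel d)) (s - (1 / 2 : ℝ) • r • (k : Vel d)) σ =
      sphData s r k σ := by
  have h1 : s + (1 / 2 : ℝ) • r • (k : Vel d) - (s - (1 / 2 : ℝ) • r • (k : Vel d)) = r • k := by
    module
  have h2 : ‖r • (k : Vel d)‖ = r := by simp [norm_smul, abs_of_pos hr]
  simp only [collData, vPrime, wPrime, cosTheta, sphData, h1, h2, Prod.mk.injEq]
  refine ⟨by module, by module, by module, by module, ?_⟩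
  rw [smul_smul, inv_mul_cancel₀ hr.ne', one_smul]

theorem collDataInv_polar (s : Vel d) {r : ℝ} (hr : 0 < r) (k σ : Sph d) :
    collDataInv (s + (1 / 2 : ℝ) • r • (k : Vel d)) (s - (1 / 2 : ℝ) • r • (k : Vel d)) σ =
      sphData s r σ k := by
  have := collData_polar s hr k σ
  simp only [collData, sphData, Prod.mk.injEq] at this
  obtain ⟨h1, h2, h3, h4, h5⟩ := this
  simp only [collDataInv, sphData, Prod.mk.injEq]
  exact ⟨h3, h4, h1, h2, by rw [h5, real_inner_comm]⟩

theorem lintegral_polar_collData (hd : 1 ≤ d) {G : Vel d → Vel d → Sph d → ℝ≥0∞}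
    (hG : Measurable fun p : Vel d × Vel d × Sph d => G p.1 p.2.1 p.2.2) :
    ∫⁻ v, ∫⁻ w, ∫⁻ σ, G v w σ ∂(sphMeasure d) =
      ∫⁻ s : Vel d, ∫⁻ r : Set.Ioi (0 : ℝ), ∫⁻ k : Sph d, ∫⁻ σ : Sph d,
        G (s + (1 / 2 : ℝ) • r.1 • (k : Vel d)) (s - (1 / 2 : ℝ) • r.1 • (k : Vel d)) σ
        ∂(sphMeasure d) ∂(sphMeasure d) ∂(Measure.volumeIoiPow (d - 1)) := by
  rw [lintegral_center_of_mass (F := fun v w => ∫⁻ σ, G v w σ ∂(sphMeasure d))]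
  · refine lintegral_congr fun s => ?_
    rw [lintegral_polar hd, lintegral_lintegral_swap]
    · apply Measurable.aemeasurable
      apply Measurable.lintegral_prod_right'
        (f := fun q : (Sph d × Set.Ioi (0 : ℝ)) × Sph d =>
          G (s + (1 / 2 : ℝ) • q.1.2.1 • (q.1.1 : Vel d)) (s - (1 / 2 : ℝ) • q.1.2.1 • (q.1.1 : Vel d)) q.2)
      exact hG.comp (by fun_prop : Measurable fun q : (Sph d × Set.Ioi (0 : ℝ)) × Sph d =>
        (s + (1 / 2 : ℝ) • q.1.2.1 • (q.1.1 : Vel d), s - (1 / 2 : ℝ) • q.1.2.1 • (q.1.1 : Vel d), q.2))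
    · apply Measurable.lintegral_prod_right'
        (f := fun q : Vel d × Sph d =>
          G (s + (1 / 2 : ℝ) • q.1) (s - (1 / 2 : ℝ) • q.1) q.2)
      exact hG.comp (by fun_prop : Measurable fun q : Vel d × Sph d =>
        (s + (1 / 2 : ℝ) • q.1, s - (1 / 2 : ℝ) • q.1, q.2))
  · apply Measurable.lintegral_prod_right'
      (f := fun q : (Vel d × Vel d) × Sph d => G q.1.1 q.1.2 q.2)
    exact hG.comp (by fun_prop : Measurable fun q : (Vel d × Vel d) × Sph d => (q.1.1, q.1.2, q.2))

/-- With mean velocity s, relative speed r and directions k, σ as coordinates, inverting a collision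
just exchanges k and σ. The measure is symmetric in these two by Tonelli, and cos θ is their inner
product. -/
theorem lintegral_collData_swap (hd : 1 ≤ d) {F : Vel d × Vel d × Vel d × Vel d × ℝ → ℝ≥0∞}
    (hF : Measurable F) :
    ∫⁻ v, ∫⁻ w, ∫⁻ σ, F (collData v w σ) ∂(sphMeasure d) =
      ∫⁻ v, ∫⁻ w, ∫⁻ σ, F (collDataInv v w σ) ∂(sphMeasure d) := by
  rw [lintegral_polar_collData hd (hF.comp measurable_collData),
    lintegral_polar_collData hd (hF.comp measurable_collDataInv)]
  refine lintegral_congr fun s => lintegral_congr fun r => ?_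
  simp_rw [collData_polar s r.2, collDataInv_polar s r.2]
  rw [lintegral_lintegral_swap]
  apply Measurable.aemeasurable
  apply hF.comp
  unfold sphData
  fun_prop

end GaussianMeasure

/-! ### The collision as a reversible Markov transition at Gaussian equilibrium. -/

section CollisionLaw

open ProbabilityTheory

variable {d : ℕ} {b : ℝ → ℝ}

/-- Both pairs have the same midpoint and half-differences of equal length; the parallelogram law
does the rest. -/
theorem norm_sq_vPrime_add (v w : Vel d) (σ : Sph d) :
    ‖vPrime v w σ‖ ^ 2 + ‖wPrime v w σ‖ ^ 2 = ‖v‖ ^ 2 + ‖w‖ ^ 2 := by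
  have hσ : ‖(σ : Vel d)‖ = 1 := by simp
  have h1 : ‖(‖v - w‖ / 2) • (σ : Vel d)‖ ^ 2 = ‖(1 / 2 : ℝ) • (v - w)‖ ^ 2 := by
    rw [norm_smul, norm_smul, hσ]; simp; ring
  have h2 := parallelogram_law_with_norm ℝ ((1 / 2 : ℝ) • (v + w)) ((‖v - w‖ / 2) • (σ : Vel d))
  have h3 := parallelogram_law_with_norm ℝ ((1 / 2 : ℝ) • (v + w)) ((1 / 2 : ℝ) • (v - w))
  have h4 : (1 / 2 : ℝ) • (v + w) + (1 / 2 : ℝ) • (v - w) = v := by module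
  have h5 : (1 / 2 : ℝ) • (v + w) - (1 / 2 : ℝ) • (v - w) = w := by module
  rw [h4, h5] at h3
  simp only [vPrime, wPrime]
  nlinarith

theorem maxwellian_vPrime_mul (v w : Vel d) (σ : Sph d) :
    maxwellian (vPrime v w σ) * maxwellian (wPrime v w σ) = maxwellian v * maxwellian w := by
  simp only [maxwellian]
  rw [mul_mul_mul_comm, ← Real.exp_add, mul_mul_mul_comm, ← Real.exp_add]
  congr 2
  linarith [norm_sq_vPrime_add v w σ]

theorem norm_sub_wPrime (v w : Vel d) (σ : Sph d) :
    ‖vPrime v w σ - wPrime v w σ‖ = ‖v - w‖ := by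
  have : vPrime v w σ - wPrime v w σ = ‖v - w‖ • (σ : Vel d) := by
    simp only [vPrime, wPrime]; module
  rw [this, norm_smul]; simp

theorem abs_cosTheta_le (v w : Vel d) (σ : Sph d) : |cosTheta v w σ| ≤ 1 := by
  refine (abs_real_inner_le_norm _ _).trans ?_
  have : ‖(σ : Vel d)‖ = 1 := by simp
  rw [this, mul_one, norm_smul, norm_inv, norm_norm]
  exact inv_mul_le_one_of_le₀ le_rfl (norm_nonneg _)

theorem cosTheta_mem (v w : Vel d) (σ : Sph d) : cosTheta v w σ ∈ Set.Icc (-1 : ℝ) 1 :=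
  abs_le.1 (abs_cosTheta_le v w σ)

/-- The angular density as an extended nonnegative function of `(v, v⋆, σ)`. -/
def angDensity (b : ℝ → ℝ) (v : Vel d) (p : Vel d × Sph d) : ℝ≥0∞ :=
  ENNReal.ofReal (b (cosTheta v p.1 p.2))

theorem measurable_angDensity (hb : Measurable b) :
    Measurable fun q : Vel d × Vel d × Sph d => angDensity b q.1 q.2 :=
  ENNReal.measurable_ofReal.comp (hb.comp measurable_cosTheta)

theorem measurable_angDensity_right (hb : Measurable b) (v : Vel d) :
    Measurable (angDensity b v) := by
  have h : Measurable fun p : Vel d × Sph d => cosTheta v p.1 p.2 := by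
    unfold cosTheta; fun_prop
  unfold angDensity
  exact ENNReal.measurable_ofReal.comp (hb.comp h)

/-- The law of `(v⋆, σ)` given the velocity `v`, for a Maxwellian background. -/
def collKer (d : ℕ) (b : ℝ → ℝ) : Kernel (Vel d) (Vel d × Sph d) :=
  (Kernel.const _ ((gauss d).prod (sphMeasure d))).withDensity (angDensity b)

theorem collKer_apply (hb : Measurable b) (v : Vel d) :
    collKer d b v = ((gauss d).prod (sphMeasure d)).withDensity (angDensity b v) := by
  rw [collKer, Kernel.withDensity_apply _ (measurable_angDensity hb), Kernel.const_apply]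

theorem lintegral_collKer (hb : Measurable b) (v : Vel d) {F : Vel d × Sph d → ℝ≥0∞}
    (hF : Measurable F) :
    ∫⁻ p, F p ∂(collKer d b v) =
      ∫⁻ w, ∫⁻ σ, angDensity b v (w, σ) * F (w, σ) ∂(sphMeasure d) ∂(gauss d) := by
  have hm := measurable_angDensity_right hb v
  rw [collKer_apply hb, lintegral_withDensity_eq_lintegral_mul _ hm hF,
    lintegral_prod _ (hm.mul hF).aemeasurable]
  rfl

theorem ae_ne_gauss (hd : 1 ≤ d) (v : Vel d) : ∀ᵐ w ∂(gauss d), v ≠ w := by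
  have : Nontrivial (Vel d) := by
    have : Nonempty (Fin d) := ⟨⟨0, hd⟩⟩
    infer_instance
  have h : ∀ᵐ w : Vel d, v ≠ w := by
    rw [ae_iff]
    simp
  exact gauss_ac.ae_le h

theorem norm_inv_smul {u : Vel d} (hu : u ≠ 0) : ‖‖u‖⁻¹ • u‖ = 1 := by
  rw [norm_smul, norm_inv, norm_norm, inv_mul_cancel₀ (norm_ne_zero_iff.2 hu)]

theorem lintegral_angDensity (hb : IsAngularKernel d b) {v w : Vel d} (h : v ≠ w) :
    ∫⁻ σ, angDensity b v (w, σ) ∂(sphMeasure d) = 1 :=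
  hb.normalised _ (norm_inv_smul (sub_ne_zero.2 h))

theorem isMarkovKernel_collKer (hd : 1 ≤ d) (hb : IsAngularKernel d b) :
    IsMarkovKernel (collKer d b) := by
  refine ⟨fun v => ⟨?_⟩⟩
  have h := lintegral_collKer hb.measurable v (F := fun _ => 1) measurable_const
  rw [lintegral_one] at h
  rw [h]
  simp only [mul_one]
  rw [lintegral_congr_ae (g := fun _ => 1), lintegral_one, measure_univ]
  filter_upwards [ae_ne_gauss hd v] with w hw
  exact lintegral_angDensity hb hw

instance : IsSFiniteKernel (collKer d b) := by
  unfold collKer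
  exact Kernel.IsSFiniteKernel.withDensity _ fun _ _ => ENNReal.ofReal_ne_top

/-- The joint law of `(v, v⋆, σ)` at equilibrium. -/
def collJoint (d : ℕ) (b : ℝ → ℝ) : Measure (Vel d × Vel d × Sph d) :=
  gauss d ⊗ₘ collKer d b

theorem isProbabilityMeasure_collJoint (hd : 1 ≤ d) (hb : IsAngularKernel d b) :
    IsProbabilityMeasure (collJoint d b) := by
  have := isMarkovKernel_collKer hd hb
  unfold collJoint
  infer_instance

theorem lintegral_collJoint (hb : Measurable b) {F : Vel d × Vel d × Sph d → ℝ≥0∞}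
    (hF : Measurable F) :
    ∫⁻ q, F q ∂(collJoint d b) = ∫⁻ v, ∫⁻ w, ∫⁻ σ,
      ENNReal.ofReal (maxwellian v * maxwellian w) * angDensity b v (w, σ) * F (v, w, σ)
        ∂(sphMeasure d) := by
  have hA : Measurable fun q : Vel d × Vel d × Sph d => angDensity b q.1 q.2 * F q :=
    (measurable_angDensity hb).mul hF
  have h1 : ∀ v w, Measurable fun σ : Sph d => angDensity b v (w, σ) * F (v, w, σ) := by
    intro v w
    have := hA.comp (by fun_prop : Measurable fun σ : Sph d => (v, w, σ))
    exact this
  have h2 : Measurable fun q : Vel d × Vel d =>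
      ∫⁻ σ, angDensity b q.1 (q.2, σ) * F (q.1, q.2, σ) ∂(sphMeasure d) := by
    have hq : Measurable fun q : (Vel d × Vel d) × Sph d => (q.1.1, q.1.2, q.2) := by fun_prop
    have hA' := hA.comp hq
    exact hA'.lintegral_prod_right'
  have h2v : ∀ v, Measurable fun w : Vel d =>
      ∫⁻ σ, angDensity b v (w, σ) * F (v, w, σ) ∂(sphMeasure d) := by
    intro v
    have := h2.comp (by fun_prop : Measurable fun w : Vel d => (v, w))
    exact this
  have hM : Measurable fun w : Vel d => ENNReal.ofReal (maxwellian w) := by fun_prop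
  rw [collJoint, Measure.lintegral_compProd hF]
  have h3 : ∀ v, ∫⁻ p, F (v, p) ∂(collKer d b v) = ∫⁻ w, ENNReal.ofReal (maxwellian w) *
      ∫⁻ σ, angDensity b v (w, σ) * F (v, w, σ) ∂(sphMeasure d) := by
    intro v
    have hFv : Measurable fun p => F (v, p) := by fun_prop
    rw [lintegral_collKer hb v hFv, lintegral_gauss (h2v v)]
  simp_rw [h3]
  have h4 : Measurable fun v : Vel d => ∫⁻ w, ENNReal.ofReal (maxwellian w) *
      ∫⁻ σ, angDensity b v (w, σ) * F (v, w, σ) ∂(sphMeasure d) := by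
    have h5 : Measurable fun q : Vel d × Vel d => ENNReal.ofReal (maxwellian q.2) *
        ∫⁻ σ, angDensity b q.1 (q.2, σ) * F (q.1, q.2, σ) ∂(sphMeasure d) :=
      (hM.comp measurable_snd).mul h2
    exact h5.lintegral_prod_right'
  rw [lintegral_gauss h4]
  refine lintegral_congr fun v => ?_
  have h6 : Measurable fun w : Vel d => ENNReal.ofReal (maxwellian w) *
      ∫⁻ σ, angDensity b v (w, σ) * F (v, w, σ) ∂(sphMeasure d) := hM.mul (h2v v)
  rw [← lintegral_const_mul _ h6]
  refine lintegral_congr fun w => ?_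
  rw [← mul_assoc, ← lintegral_const_mul _ (h1 v w)]
  refine lintegral_congr fun σ => ?_
  rw [ENNReal.ofReal_mul (maxwellian_pos v).le]
  ring

/-- The weight M(v) M(v⋆) b(cos θ) is the same for a collision and its inverse, so the symmetry of
the reference measure passes to `collJoint`. -/
theorem lintegral_collJoint_swap (hd : 1 ≤ d) (hb : Measurable b)
    {F : Vel d × Vel d × Vel d × Vel d × ℝ → ℝ≥0∞} (hF : Measurable F) :
    ∫⁻ q, F (collData q.1 q.2.1 q.2.2) ∂(collJoint d b) =
      ∫⁻ q, F (collDataInv q.1 q.2.1 q.2.2) ∂(collJoint d b) := by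
  rw [lintegral_collJoint hb (F := fun q => F (collData q.1 q.2.1 q.2.2))
      (hF.comp measurable_collData),
    lintegral_collJoint hb (F := fun q => F (collDataInv q.1 q.2.1 q.2.2))
      (hF.comp measurable_collDataInv)]
  have h := lintegral_collData_swap hd (F := fun x => ENNReal.ofReal (maxwellian x.1 *
    maxwellian x.2.1) * ENNReal.ofReal (b x.2.2.2.2) * F x) (by fun_prop)
  simp only [collData, collDataInv, maxwellian_vPrime_mul] at h
  exact h

theorem map_collData_eq (hd : 1 ≤ d) (hb : Measurable b) :
    (collJoint d b).map (fun q => collData q.1 q.2.1 q.2.2) =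
      (collJoint d b).map (fun q => collDataInv q.1 q.2.1 q.2.2) := by
  refine Measure.ext_of_lintegral _ fun F hF => ?_
  rw [lintegral_map hF measurable_collData, lintegral_map hF measurable_collDataInv,
    lintegral_collJoint_swap hd hb hF]

theorem integral_collJoint_swap (hd : 1 ≤ d) (hb : Measurable b)
    {F : Vel d × Vel d × Vel d × Vel d × ℝ → ℝ} (hF : Measurable F) :
    ∫ q, F (collData q.1 q.2.1 q.2.2) ∂(collJoint d b) =
      ∫ q, F (collDataInv q.1 q.2.1 q.2.2) ∂(collJoint d b) := by
  rw [← integral_map measurable_collData.aemeasurable hF.aestronglyMeasurable,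
    ← integral_map measurable_collDataInv.aemeasurable hF.aestronglyMeasurable,
    map_collData_eq hd hb]

/-- The velocity `v` has the Gaussian law under `collJoint`. -/
theorem map_fst_collJoint (hd : 1 ≤ d) (hb : IsAngularKernel d b) :
    (collJoint d b).map (fun q => q.1) = gauss d := by
  have := isMarkovKernel_collKer hd hb
  exact Measure.fst_compProd _ _

/-- The velocity `v'` has the Gaussian law under `collJoint`. -/
theorem map_vPrime_collJoint (hd : 1 ≤ d) (hb : IsAngularKernel d b) :
    (collJoint d b).map (fun q => vPrime q.1 q.2.1 q.2.2) = gauss d := by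
  have h := congrArg (fun μ => Measure.map (fun x : Vel d × Vel d × Vel d × Vel d × ℝ => x.1) μ)
    (map_collData_eq (d := d) hd hb.measurable)
  rw [Measure.map_map (by fun_prop) measurable_collData,
    Measure.map_map (by fun_prop) measurable_collDataInv] at h
  rw [← map_fst_collJoint hd hb]
  exact h.symm

theorem measurePreserving_vPrime (hd : 1 ≤ d) (hb : IsAngularKernel d b) :
    MeasurePreserving (fun q : Vel d × Vel d × Sph d => vPrime q.1 q.2.1 q.2.2)
      (collJoint d b) (gauss d) :=
  ⟨measurable_vPrime, map_vPrime_collJoint hd hb⟩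

theorem measurePreserving_fst_collJoint (hd : 1 ≤ d) (hb : IsAngularKernel d b) :
    MeasurePreserving (fun q : Vel d × Vel d × Sph d => q.1) (collJoint d b) (gauss d) :=
  ⟨measurable_fst, map_fst_collJoint hd hb⟩

/-- The reflection σ ↦ -σ preserves the surface measure and, b being even, the density. Only (v, v⋆,
cos θ) is recorded, because this reflection exchanges v' and v⋆'. -/
theorem lintegral_collJoint_neg (hb : IsAngularKernel d b)
    {F : Vel d × Vel d × ℝ → ℝ≥0∞} (hF : Measurable F) :
    ∫⁻ q, F (q.1, q.2.1, cosTheta q.1 q.2.1 q.2.2) ∂(collJoint d b) =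
      ∫⁻ q, F (q.1, q.2.1, -cosTheta q.1 q.2.1 q.2.2) ∂(collJoint d b) := by
  have hc := measurable_cosTheta (d := d)
  rw [lintegral_collJoint hb.measurable (F := fun q => F (q.1, q.2.1, cosTheta q.1 q.2.1 q.2.2))
      (by fun_prop),
    lintegral_collJoint hb.measurable (F := fun q => F (q.1, q.2.1, -cosTheta q.1 q.2.1 q.2.2))
      (by fun_prop)]
  refine lintegral_congr fun v => lintegral_congr fun w => ?_
  have hbm := hb.measurable
  have hc' : Measurable fun σ : Sph d => cosTheta v w σ := by
    unfold cosTheta; fun_prop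
  have hm : Measurable fun σ : Sph d => ENNReal.ofReal (maxwellian v * maxwellian w) *
      ENNReal.ofReal (b (cosTheta v w σ)) * F (v, w, cosTheta v w σ) := by fun_prop
  have h : ∀ σ, cosTheta v w (sphMap (LinearIsometryEquiv.neg ℝ) σ) = -cosTheta v w σ := by
    intro σ; simp [cosTheta]
  have := lintegral_sphMap (LinearIsometryEquiv.neg ℝ) hm
  simp only [h, hb.even _ (cosTheta_mem v w _)] at this
  exact this.symm

/-- Given `v`, the cosine of the deviation angle is centred. -/
theorem integral_mul_cosTheta (hb : IsAngularKernel d b) {ψ : Vel d → ℝ} (hψ : Measurable ψ) :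
    ∫ q, ψ q.1 * cosTheta q.1 q.2.1 q.2.2 ∂(collJoint d b) = 0 := by
  have hc := measurable_cosTheta (d := d)
  have h : (collJoint d b).map (fun q => (q.1, q.2.1, cosTheta q.1 q.2.1 q.2.2)) =
      (collJoint d b).map (fun q => (q.1, q.2.1, -cosTheta q.1 q.2.1 q.2.2)) := by
    refine Measure.ext_of_lintegral _ fun F hF => ?_
    rw [lintegral_map hF (by fun_prop), lintegral_map hF (by fun_prop),
      lintegral_collJoint_neg hb hF]
  have hm : Measurable fun x : Vel d × Vel d × ℝ => ψ x.1 * x.2.2 := by fun_prop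
  have e1 := integral_map (μ := collJoint d b)
    (φ := fun q => (q.1, q.2.1, cosTheta q.1 q.2.1 q.2.2)) (by fun_prop)
    hm.aestronglyMeasurable
  have e2 := integral_map (μ := collJoint d b)
    (φ := fun q => (q.1, q.2.1, -cosTheta q.1 q.2.1 q.2.2)) (by fun_prop)
    hm.aestronglyMeasurable
  rw [h, e2] at e1
  simp only [mul_neg, integral_neg] at e1
  linarith

/-- The gain operator acting on densities with respect to the Maxwellian. -/
def gainK (b : ℝ → ℝ) (h : Vel d → ℝ) (v : Vel d) : ℝ :=
  ∫ p, h (vPrime v p.1 p.2) ∂(collKer d b v)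

/-- The Ornstein-Uhlenbeck operator with correlation `a`. -/
def ouOp (a : ℝ) (h : Vel d → ℝ) (v : Vel d) : ℝ :=
  ∫ z, h (a • v + Real.sqrt (1 - a ^ 2) • z) ∂(gauss d)

end CollisionLaw

/-! ### The gain operator commutes with the Ornstein-Uhlenbeck operators. -/

section Commutation

open ProbabilityTheory

variable {d : ℕ} {b : ℝ → ℝ}

/-- The law of `σ` given `v` and `v⋆`. -/
def angMeasure (b : ℝ → ℝ) (v w : Vel d) : Measure (Sph d) :=
  (sphMeasure d).withDensity fun σ => angDensity b v (w, σ)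

theorem measurable_angDensity_sph (hb : Measurable b) (v w : Vel d) :
    Measurable fun σ : Sph d => angDensity b v (w, σ) := by
  have h : Measurable fun σ : Sph d => cosTheta v w σ := by
    unfold cosTheta; fun_prop
  unfold angDensity
  exact ENNReal.measurable_ofReal.comp (hb.comp h)

theorem isProbabilityMeasure_angMeasure (hb : IsAngularKernel d b) {v w : Vel d} (h : v ≠ w) :
    IsProbabilityMeasure (angMeasure b v w) where
  measure_univ := by
    rw [angMeasure, withDensity_apply _ MeasurableSet.univ, setLIntegral_univ,
      lintegral_angDensity hb h]

theorem angDensity_toReal (hb : IsAngularKernel d b) (v w : Vel d) (σ : Sph d) :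
    (angDensity b v (w, σ)).toReal = b (cosTheta v w σ) :=
  ENNReal.toReal_ofReal (hb.nonneg _ (cosTheta_mem v w σ))

theorem integral_angMeasure {E : Type*} [NormedAddCommGroup E] [NormedSpace ℝ E]
    (hb : IsAngularKernel d b) (v w : Vel d) (F : Sph d → E) :
    ∫ σ, F σ ∂(angMeasure b v w) = ∫ σ, b (cosTheta v w σ) • F σ ∂(sphMeasure d) := by
  rw [angMeasure, integral_withDensity_eq_integral_toReal_smul
    (measurable_angDensity_sph hb.measurable v w) (ae_of_all _ fun _ => ENNReal.ofReal_lt_top)]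
  simp_rw [angDensity_toReal hb]

theorem integrable_collKer_iff {E : Type*} [NormedAddCommGroup E] [NormedSpace ℝ E]
    (hb : IsAngularKernel d b) (v : Vel d) {F : Vel d × Sph d → E} :
    Integrable F (collKer d b v) ↔ Integrable (fun p => b (cosTheta v p.1 p.2) • F p)
      ((gauss d).prod (sphMeasure d)) := by
  rw [collKer_apply hb.measurable, integrable_withDensity_iff_integrable_smul'
    (measurable_angDensity_right hb.measurable v) (ae_of_all _ fun _ => ENNReal.ofReal_lt_top)]
  have : ∀ p : Vel d × Sph d, (angDensity b v p).toReal = b (cosTheta v p.1 p.2) := fun p =>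
    angDensity_toReal hb v p.1 p.2
  simp_rw [this]

theorem integral_collKer_prod {E : Type*} [NormedAddCommGroup E] [NormedSpace ℝ E]
    (hb : IsAngularKernel d b) (v : Vel d) (F : Vel d × Sph d → E) :
    ∫ p, F p ∂(collKer d b v) = ∫ p, b (cosTheta v p.1 p.2) • F p
      ∂((gauss d).prod (sphMeasure d)) := by
  rw [collKer_apply hb.measurable, integral_withDensity_eq_integral_toReal_smul
    (measurable_angDensity_right hb.measurable v) (ae_of_all _ fun _ => ENNReal.ofReal_lt_top)]
  have : ∀ p : Vel d × Sph d, (angDensity b v p).toReal = b (cosTheta v p.1 p.2) := fun p =>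
    angDensity_toReal hb v p.1 p.2
  simp_rw [this]

theorem integral_collKer {E : Type*} [NormedAddCommGroup E] [NormedSpace ℝ E]
    (hb : IsAngularKernel d b) (v : Vel d) {F : Vel d × Sph d → E}
    (hF : Integrable F (collKer d b v)) :
    ∫ p, F p ∂(collKer d b v) = ∫ w, ∫ σ, F (w, σ) ∂(angMeasure b v w) ∂(gauss d) := by
  rw [integral_collKer_prod hb, integral_prod _ ((integrable_collKer_iff hb v).1 hF)]
  simp_rw [integral_angMeasure hb]

theorem integral_sphMap {E : Type*} [NormedAddCommGroup E] [NormedSpace ℝ E]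
    (L : Vel d ≃ₗᵢ[ℝ] Vel d) {F : Sph d → E} (hF : AEStronglyMeasurable F (sphMeasure d)) :
    ∫ σ, F (sphMap L σ) ∂(sphMeasure d) = ∫ σ, F σ ∂(sphMeasure d) := by
  have h := integral_map (μ := sphMeasure d) (φ := sphMap L) (measurable_sphMap L).aemeasurable
    (f := F) (by rw [(measurePreserving_sphMap L).map_eq]; exact hF)
  rw [(measurePreserving_sphMap L).map_eq] at h
  exact h.symm

/-- Bobylev's exchange of the relative velocity with the Fourier variable. -/
theorem integral_angMeasure_swap (hb : IsAngularKernel d b) {v w ξ : Vel d} (h : v ≠ w)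
    (hξ : ξ ≠ 0) {G : ℝ → ℂ} (hG : Continuous G) :
    ∫ σ : Sph d, G (‖v - w‖ * ⟪(σ : Vel d), ξ⟫) ∂(angMeasure b v w) =
      ∫ σ : Sph d, G (‖ξ‖ * ⟪(σ : Vel d), v - w⟫) ∂(angMeasure b ξ 0) := by
  have hu : v - w ≠ 0 := sub_ne_zero.2 h
  have hu' : ‖v - w‖ ≠ 0 := norm_ne_zero_iff.2 hu
  have hξ' : ‖ξ‖ ≠ 0 := norm_ne_zero_iff.2 hξ
  set k := ‖v - w‖⁻¹ • (v - w) with hk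
  set l := ‖ξ‖⁻¹ • ξ with hl
  have hnk : ‖k‖ = ‖l‖ := by rw [hk, hl, norm_inv_smul hu, norm_inv_smul hξ]
  have eu : v - w = ‖v - w‖ • k := by rw [hk, smul_inv_smul₀ hu']
  have eξ : ξ = ‖ξ‖ • l := by rw [hl, smul_inv_smul₀ hξ']
  -- The reflection exchanging the unit vectors k and l. The integrands see σ only through inner
  -- products with them, so a change of variable by it swaps their roles.
  set L := (Submodule.span ℝ {k - l})ᗮ.reflection
  have hLk : L k = l := Submodule.reflection_sub hnk
  have hLl : L l = k := by rw [← hLk, Submodule.reflection_reflection]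
  rw [integral_angMeasure hb, integral_angMeasure hb, ← integral_sphMap L]
  · refine integral_congr_ae (ae_of_all _ fun σ => ?_)
    have h1 : ⟪k, (sphMap L σ : Vel d)⟫ = ⟪l, (σ : Vel d)⟫ := by
      rw [← hLl, coe_sphMap, L.inner_map_map]
    have h2 : ⟪(sphMap L σ : Vel d), l⟫ = ⟪(σ : Vel d), k⟫ := by
      rw [← hLk, coe_sphMap, L.inner_map_map]
    have h3 : ⟪(sphMap L σ : Vel d), ξ⟫ = ‖ξ‖ * ⟪(σ : Vel d), k⟫ := by
      conv_lhs => rw [eξ]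
      rw [real_inner_smul_right, h2]
    have h4 : ⟪(σ : Vel d), v - w⟫ = ‖v - w‖ * ⟪(σ : Vel d), k⟫ := by
      conv_lhs => rw [eu]
      rw [real_inner_smul_right]
    simp only [cosTheta, sub_zero, ← hk, ← hl, h1, h3, h4]
    congr 2
    ring
  · have hbm := hb.measurable
    have hGm := hG.measurable
    have hc : Measurable fun σ : Sph d => cosTheta v w σ := by
      unfold cosTheta; fun_prop
    exact Measurable.aestronglyMeasurable (by fun_prop)

theorem integrable_cexp_mul_I {α : Type*} [MeasurableSpace α] {μ : Measure α} [IsFiniteMeasure μ]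
    {f : α → ℝ} (hf : Measurable f) : Integrable (fun x => Complex.exp (f x * Complex.I)) μ := by
  refine Integrable.of_bound (C := 1) ?_ (ae_of_all _ fun x => ?_)
  · exact Measurable.aestronglyMeasurable (by fun_prop)
  · rw [Complex.norm_exp_ofReal_mul_I]

/-- Bobylev's formula for the gain operator acting on characters. -/
theorem integral_collKer_char (hd : 1 ≤ d) (hb : IsAngularKernel d b) (v : Vel d) {ξ : Vel d}
    (hξ : ξ ≠ 0) :
    ∫ p, Complex.exp (⟪vPrime v p.1 p.2, ξ⟫ * Complex.I) ∂(collKer d b v) =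
      ∫ σ, Complex.exp (⟪v, vPrime ξ 0 σ⟫ * Complex.I) * Complex.exp (-‖wPrime ξ 0 σ‖ ^ 2 / 2)
        ∂(angMeasure b ξ 0) := by
  have := isMarkovKernel_collKer hd hb
  have := isProbabilityMeasure_angMeasure hb hξ
  have hvm : Measurable fun p : Vel d × Sph d => vPrime v p.1 p.2 := by unfold vPrime; fun_prop
  rw [integral_collKer hb v (integrable_cexp_mul_I (by fun_prop))]
  have key : ∀ᵐ w ∂(gauss d),
      ∫ σ, Complex.exp (⟪vPrime v w σ, ξ⟫ * Complex.I) ∂(angMeasure b v w) =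
      ∫ σ, Complex.exp (⟪v, vPrime ξ 0 σ⟫ * Complex.I) * Complex.exp (⟪w, wPrime ξ 0 σ⟫ * Complex.I)
        ∂(angMeasure b ξ 0) := by
    filter_upwards [ae_ne_gauss hd v] with w hw
    -- The phase ⟪v', ξ⟫ is a part independent of σ plus half of |v - w|⟪σ, ξ⟫. After the exchange
    -- it regroups as ⟪v, ξ'⟫ + ⟪w, ξ⋆'⟫, where (ξ', ξ⋆') is the outcome of a collision of ξ with 0.
    have h1 := integral_angMeasure_swap hb hw hξ
      (G := fun t => Complex.exp ((1 / 2 * ⟪v + w, ξ⟫ + 1 / 2 * t : ℝ) * Complex.I)) (by fun_prop)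
    convert! h1 using 1
    · refine integral_congr_ae (ae_of_all _ fun σ => ?_)
      simp only [vPrime, inner_add_left, real_inner_smul_left]
      congr 3
      ring
    · refine integral_congr_ae (ae_of_all _ fun σ => ?_)
      beta_reduce
      rw [← Complex.exp_add, ← add_mul, ← Complex.ofReal_add]
      simp only [vPrime, wPrime, inner_add_left, inner_add_right, inner_sub_right,
        real_inner_smul_right, sub_zero, add_zero]
      congr 3
      rw [real_inner_comm ξ v, real_inner_comm ξ w, real_inner_comm v (σ : Vel d),
        real_inner_comm w (σ : Vel d)]
      ring
  rw [integral_congr_ae key]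
  have hm1 : Measurable fun q : Vel d × Sph d => ⟪v, vPrime ξ 0 q.2⟫ := by
    unfold vPrime; fun_prop
  have hm2 : Measurable fun q : Vel d × Sph d => ⟪q.1, wPrime ξ 0 q.2⟫ := by
    unfold wPrime; fun_prop
  rw [integral_integral_swap]
  · refine integral_congr_ae (ae_of_all _ fun σ => ?_)
    simp only
    rw [integral_const_mul, ← charFun_apply, charFun_gauss]
  · have h := integrable_cexp_mul_I (μ := (gauss d).prod (angMeasure b ξ 0)) (hm1.add hm2)
    refine h.congr (ae_of_all _ fun q => ?_)
    simp only [Function.uncurry, Pi.add_apply]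
    rw [← Complex.exp_add, ← add_mul, Complex.ofReal_add]

theorem vPrime_smul_zero {a : ℝ} (ha : 0 < a) (ξ : Vel d) (σ : Sph d) :
    vPrime (a • ξ) 0 σ = a • vPrime ξ 0 σ := by
  simp only [vPrime, sub_zero, add_zero, norm_smul, Real.norm_eq_abs, abs_of_pos ha]
  module

theorem wPrime_smul_zero {a : ℝ} (ha : 0 < a) (ξ : Vel d) (σ : Sph d) :
    wPrime (a • ξ) 0 σ = a • wPrime ξ 0 σ := by
  simp only [wPrime, sub_zero, add_zero, norm_smul, Real.norm_eq_abs, abs_of_pos ha]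
  module

theorem angMeasure_smul_zero {a : ℝ} (ha : 0 < a) (ξ : Vel d) :
    angMeasure b (a • ξ) 0 = angMeasure b ξ 0 := by
  have h : (‖a • ξ‖⁻¹) • a • ξ = ‖ξ‖⁻¹ • ξ := by
    rw [norm_smul, Real.norm_eq_abs, abs_of_pos ha, smul_smul]
    congr 1
    field_simp
  unfold angMeasure angDensity cosTheta
  simp only [sub_zero, h]

/-- The laws of the Ornstein-Uhlenbeck step after and before a collision agree. -/
theorem map_collKer_prod_gauss (hd : 1 ≤ d) (hb : IsAngularKernel d b) (v : Vel d) {a c : ℝ}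
    (ha : 0 < a) (h : a ^ 2 + c ^ 2 = 1) :
    ((collKer d b v).prod (gauss d)).map (fun q => a • vPrime v q.1.1 q.1.2 + c • q.2) =
      ((gauss d) ⊗ₘ ((collKer d b).comap (fun z => a • v + c • z) (by fun_prop))).map
        (fun q => vPrime (a • v + c • q.1) q.2.1 q.2.2) := by
  have := isMarkovKernel_collKer hd hb
  have hm1 : Measurable fun q : (Vel d × Sph d) × Vel d => a • vPrime v q.1.1 q.1.2 + c • q.2 := by
    unfold vPrime; fun_prop
  have hm2 : Measurable fun q : Vel d × Vel d × Sph d => vPrime (a • v + c • q.1) q.2.1 q.2.2 := by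
    unfold vPrime; fun_prop
  have := Measure.isProbabilityMeasure_map (μ := (collKer d b v).prod (gauss d)) hm1.aemeasurable
  have := Measure.isProbabilityMeasure_map (μ := (gauss d) ⊗ₘ ((collKer d b).comap
    (fun z => a • v + c • z) (by fun_prop))) hm2.aemeasurable
  refine Measure.ext_of_charFun ?_
  ext ξ
  rcases eq_or_ne ξ 0 with rfl | hξ
  · simp [charFun_apply]
  have := isProbabilityMeasure_angMeasure hb hξ
  have haξ : a • ξ ≠ 0 := smul_ne_zero ha.ne' hξ
  rw [charFun_apply, charFun_apply,
    integral_map hm1.aemeasurable (Measurable.aestronglyMeasurable (by fun_prop)),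
    integral_map hm2.aemeasurable (Measurable.aestronglyMeasurable (by fun_prop)),
    integral_prod _ (integrable_cexp_mul_I (by fun_prop)),
    Measure.integral_compProd (integrable_cexp_mul_I (by fun_prop))]
  have e1 : ∀ p : Vel d × Sph d,
      ∫ z, Complex.exp (⟪a • vPrime v p.1 p.2 + c • z, ξ⟫ * Complex.I) ∂(gauss d) =
      Complex.exp (⟪vPrime v p.1 p.2, a • ξ⟫ * Complex.I) * Complex.exp (-‖c • ξ‖ ^ 2 / 2) := by
    intro p
    rw [← charFun_gauss, charFun_apply, ← integral_const_mul]
    refine integral_congr_ae (ae_of_all _ fun z => ?_)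
    simp only
    rw [← Complex.exp_add, ← add_mul, ← Complex.ofReal_add, inner_add_left, real_inner_smul_left,
      real_inner_smul_left, real_inner_smul_right, real_inner_smul_right]
  have e2 : ∀ z : Vel d, ∫ p, Complex.exp (⟪vPrime (a • v + c • z) p.1 p.2, ξ⟫ * Complex.I)
        ∂((collKer d b).comap (fun z => a • v + c • z) (by fun_prop) z) =
      ∫ σ, Complex.exp (⟪v, a • vPrime ξ 0 σ⟫ * Complex.I) *
        Complex.exp (⟪z, c • vPrime ξ 0 σ⟫ * Complex.I) * Complex.exp (-‖wPrime ξ 0 σ‖ ^ 2 / 2)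
        ∂(angMeasure b ξ 0) := by
    intro z
    rw [Kernel.comap_apply, integral_collKer_char hd hb _ hξ]
    refine integral_congr_ae (ae_of_all _ fun σ => ?_)
    beta_reduce
    congr 1
    rw [← Complex.exp_add, ← add_mul, ← Complex.ofReal_add, inner_add_left, real_inner_smul_left,
      real_inner_smul_left, real_inner_smul_right, real_inner_smul_right]
  simp only [e1, e2]
  rw [integral_mul_const, integral_collKer_char hd hb _ haξ, angMeasure_smul_zero ha,
    integral_integral_swap, ← integral_mul_const]
  · refine integral_congr_ae (ae_of_all _ fun σ => ?_)
    simp only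
    rw [integral_mul_const, integral_const_mul, ← charFun_apply, charFun_gauss,
      vPrime_smul_zero ha, wPrime_smul_zero ha, mul_assoc, mul_assoc]
    congr 1
    rw [← Complex.exp_add, ← Complex.exp_add]
    congr 1
    -- Energy conservation |ξ'|² + |ξ⋆'|² = |ξ|² together with a² + c² = 1 gives c²|ξ|² + a²|ξ⋆'|² =
    -- c²|ξ'|² + |ξ⋆'|², which is the equality of the two Gaussian factors.
    have h1 := norm_sq_vPrime_add ξ 0 σ
    simp only [norm_zero, ne_eq, OfNat.ofNat_ne_zero, not_false_eq_true, zero_pow, add_zero] at h1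
    norm_cast
    simp only [norm_smul, Real.norm_eq_abs, mul_pow, sq_abs, ← h1]
    have : c ^ 2 = 1 - a ^ 2 := by linarith
    rw [this]; ring
  · have hm3 : Measurable fun q : Vel d × Sph d => ⟪v, a • vPrime ξ 0 q.2⟫ := by
      unfold vPrime; fun_prop
    have hm4 : Measurable fun q : Vel d × Sph d => ⟪q.1, c • vPrime ξ 0 q.2⟫ := by
      unfold vPrime; fun_prop
    have hm5 : Measurable fun q : Vel d × Sph d => wPrime ξ 0 q.2 := by
      unfold wPrime; fun_prop
    refine Integrable.of_bound (C := 1) (Measurable.aestronglyMeasurable ?_) (ae_of_all _ fun q => ?_)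
    · simp only [Function.uncurry_def]
      fun_prop
    · simp only [Function.uncurry, norm_mul, Complex.norm_exp_ofReal_mul_I, one_mul]
      rw [Complex.norm_exp, Real.exp_le_one_iff]
      norm_cast
      have := sq_nonneg ‖wPrime ξ 0 q.2‖
      linarith

/-- Each side is the integral of h against one of the two laws identified in
`map_collKer_prod_gauss`. -/
theorem gainK_ouOp (hd : 1 ≤ d) (hb : IsAngularKernel d b) {a : ℝ} (ha : 0 < a) (ha1 : a ≤ 1)
    {h : Vel d → ℝ} (hm : Measurable h) {C : ℝ} (hC : ∀ v, |h v| ≤ C) (v : Vel d) :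
    gainK b (ouOp a h) v = ouOp a (gainK b h) v := by
  have := isMarkovKernel_collKer hd hb
  set c := Real.sqrt (1 - a ^ 2) with hc
  have hac : a ^ 2 + c ^ 2 = 1 := by
    rw [hc, Real.sq_sqrt (by nlinarith)]; ring
  have hvm : Measurable fun p : Vel d × Sph d => vPrime v p.1 p.2 := by unfold vPrime; fun_prop
  have hm1 : Measurable fun q : (Vel d × Sph d) × Vel d => a • vPrime v q.1.1 q.1.2 + c • q.2 := by
    unfold vPrime; fun_prop
  have hm2 : Measurable fun q : Vel d × Vel d × Sph d => vPrime (a • v + c • q.1) q.2.1 q.2.2 := by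
    unfold vPrime; fun_prop
  have key := map_collKer_prod_gauss hd hb v ha hac
  have e1 : gainK b (ouOp a h) v = ∫ x, h x ∂(((collKer d b v).prod (gauss d)).map
      (fun q => a • vPrime v q.1.1 q.1.2 + c • q.2)) := by
    rw [integral_map hm1.aemeasurable hm.aestronglyMeasurable, integral_prod]
    · rfl
    · exact Integrable.of_bound (hm.comp hm1).aestronglyMeasurable C (ae_of_all _ fun q => hC _)
  have e2 : ouOp a (gainK b h) v = ∫ x, h x ∂(((gauss d) ⊗ₘ ((collKer d b).comap
      (fun z => a • v + c • z) (by fun_prop))).map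
        (fun q => vPrime (a • v + c • q.1) q.2.1 q.2.2)) := by
    rw [integral_map hm2.aemeasurable hm.aestronglyMeasurable, Measure.integral_compProd]
    · rfl
    · exact Integrable.of_bound (hm.comp hm2).aestronglyMeasurable C (ae_of_all _ fun q => hC _)
  rw [e1, e2, key]

end Commutation

/-! ### Pinched functions, entropy inequalities and the Ornstein-Uhlenbeck semigroup. -/

section OrnsteinUhlenbeck

open ProbabilityTheory Filter Topology

variable {d : ℕ} {b : ℝ → ℝ}

theorem sq_add_sqrt_sq {a : ℝ} (ha : a ∈ Set.Icc (0 : ℝ) 1) :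
    a ^ 2 + Real.sqrt (1 - a ^ 2) ^ 2 = 1 := by
  rw [Real.sq_sqrt (by nlinarith [ha.1, ha.2])]; ring

/-- Measurable functions with values in `[δ, N]`, `δ > 0`. -/
structure IsPinched (δ N : ℝ) (h : Vel d → ℝ) : Prop where
  measurable : Measurable h
  pos : 0 < δ
  ge : ∀ v, δ ≤ h v
  le : ∀ v, h v ≤ N

namespace IsPinched

variable {δ N : ℝ} {h : Vel d → ℝ}

theorem abs_le (H : IsPinched δ N h) (v : Vel d) : |h v| ≤ N := by
  rw [abs_of_pos (H.pos.trans_le (H.ge v))]; exact H.le v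

theorem integrable {α : Type*} [MeasurableSpace α] {μ : Measure α} [IsFiniteMeasure μ]
    (H : IsPinched δ N h) {X : α → Vel d} (hX : Measurable X) :
    Integrable (fun x => h (X x)) μ :=
  Integrable.of_bound (H.measurable.comp hX).aestronglyMeasurable N
    (ae_of_all _ fun _ => H.abs_le _)

theorem le_integral {α : Type*} [MeasurableSpace α] {μ : Measure α} [IsProbabilityMeasure μ]
    (H : IsPinched δ N h) {X : α → Vel d} (hX : Measurable X) : δ ≤ ∫ x, h (X x) ∂μ := by
  have := integral_mono (μ := μ) (integrable_const δ) (H.integrable hX) fun x => H.ge (X x)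
  simpa using this

theorem integral_le {α : Type*} [MeasurableSpace α] {μ : Measure α} [IsProbabilityMeasure μ]
    (H : IsPinched δ N h) {X : α → Vel d} (hX : Measurable X) : ∫ x, h (X x) ∂μ ≤ N := by
  have := integral_mono (μ := μ) (H.integrable hX) (integrable_const N) fun x => H.le (X x)
  simpa using this

theorem ouOp (H : IsPinched δ N h) (a : ℝ) : IsPinched δ N (ouOp a h) where
  measurable := by
    have hm := H.measurable
    have : Measurable fun q : Vel d × Vel d => h (a • q.1 + Real.sqrt (1 - a ^ 2) • q.2) := by
      fun_prop
    exact this.stronglyMeasurable.integral_prod_right'.measurable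
  pos := H.pos
  ge v := H.le_integral (by fun_prop)
  le v := H.integral_le (by fun_prop)

theorem gainK (H : IsPinched δ N h) (hd : 1 ≤ d) (hb : IsAngularKernel d b) :
    IsPinched δ N (gainK b h) := by
  have := isMarkovKernel_collKer hd hb
  have hvm : ∀ v : Vel d, Measurable fun p : Vel d × Sph d => vPrime v p.1 p.2 := by
    intro v; unfold vPrime; fun_prop
  refine ⟨?_, H.pos, fun v => H.le_integral (hvm v), fun v => H.integral_le (hvm v)⟩
  have h1 : StronglyMeasurable fun q : Vel d × Vel d × Sph d => h (vPrime q.1 q.2.1 q.2.2) :=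
    (H.measurable.comp measurable_vPrime).stronglyMeasurable
  exact h1.integral_kernel_prod_right'.measurable

end IsPinched

/-- The entropy `∫ h log h` with respect to the Gaussian measure. -/
def gEnt (h : Vel d → ℝ) : ℝ := ∫ v, h v * Real.log (h v) ∂(gauss d)

/-- The symmetric entropy production density `(x - y) (log x - log y)`. -/
def prodDens (x y : ℝ) : ℝ := (x - y) * (Real.log x - Real.log y)

theorem log_le_of_pinch {δ N x : ℝ} (hδ : 0 < δ) (h1 : δ ≤ x) (h2 : x ≤ N) :
    |Real.log x| ≤ |Real.log δ| + |Real.log N| := by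
  have a1 := Real.log_le_log hδ h1
  have a2 := Real.log_le_log (hδ.trans_le h1) h2
  rw [abs_le]
  constructor
  · linarith [neg_abs_le (Real.log δ), abs_nonneg (Real.log N)]
  · linarith [le_abs_self (Real.log N), abs_nonneg (Real.log δ)]

theorem abs_log_sub_log_le {δ x y : ℝ} (hδ : 0 < δ) (hx : δ ≤ x) (hy : δ ≤ y) :
    |Real.log x - Real.log y| ≤ δ⁻¹ * |x - y| := by
  wlog h : y ≤ x generalizing x y
  · rw [abs_sub_comm, abs_sub_comm x]; exact this hy hx (le_of_not_ge h)
  have hy0 := hδ.trans_le hy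
  have hx0 := hδ.trans_le hx
  rw [abs_of_nonneg (sub_nonneg.2 (Real.log_le_log hy0 h)), abs_of_nonneg (sub_nonneg.2 h),
    ← Real.log_div hx0.ne' hy0.ne']
  calc Real.log (x / y) ≤ x / y - 1 := Real.log_le_sub_one_of_pos (by positivity)
    _ = y⁻¹ * (x - y) := by field_simp
    _ ≤ δ⁻¹ * (x - y) := by gcongr

theorem prodDens_le {δ x y : ℝ} (hδ : 0 < δ) (hx : δ ≤ x) (hy : δ ≤ y) :
    |prodDens x y| ≤ δ⁻¹ * (x - y) ^ 2 := by
  rw [prodDens, abs_mul, ← sq_abs]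
  have := abs_log_sub_log_le hδ hx hy
  nlinarith [abs_nonneg (x - y)]

/-- The supporting plane of the convex, `1`-homogeneous function `prodDens`. -/
theorem prodDens_ge {x y x₀ y₀ : ℝ} (hx : 0 < x) (hy : 0 < y) (hx₀ : 0 < x₀) (hy₀ : 0 < y₀) :
    (Real.log x₀ - Real.log y₀ + 1 - y₀ / x₀) * x + (Real.log y₀ - Real.log x₀ + 1 - x₀ / y₀) * y ≤
      prodDens x y := by
  -- The ratio of x/y to x₀/y₀. By homogeneity the supporting plane reduces to 1 - 1/t ≤ log t ≤ t -
  -- 1, weighted by x and y respectively.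
  set t := x * y₀ / (y * x₀) with ht
  have ht0 : 0 < t := by positivity
  have hlog : Real.log t = Real.log x + Real.log y₀ - Real.log y - Real.log x₀ := by
    rw [ht, Real.log_div (by positivity) (by positivity), Real.log_mul hx.ne' hy₀.ne',
      Real.log_mul hy.ne' hx₀.ne']
    ring
  have h1 : Real.log t ≤ t - 1 := Real.log_le_sub_one_of_pos ht0
  have h2 : 1 - t⁻¹ ≤ Real.log t := Real.one_sub_inv_le_log_of_pos ht0
  have h3 : x * (1 - t⁻¹) ≤ x * Real.log t := by gcongr
  have h4 : y * Real.log t ≤ y * (t - 1) := by gcongr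
  have h5 : x * t⁻¹ = y * (x₀ / y₀) := by rw [ht]; field_simp
  have h6 : y * t = x * (y₀ / x₀) := by rw [ht]; field_simp
  rw [prodDens]
  have e : (x - y) * (Real.log x - Real.log y) = (x - y) * (Real.log x₀ - Real.log y₀) +
      x * Real.log t - y * Real.log t := by rw [hlog]; ring
  rw [e]
  nlinarith

/-- The tangent at x to the convex function t log t lies below its graph. -/
theorem mul_log_sub_le {x y : ℝ} (hx : 0 < x) (hy : 0 < y) :
    x * Real.log x - y * Real.log y ≤ (Real.log x + 1) * (x - y) := by
  have h := Real.log_le_sub_one_of_pos (show 0 < x / y by positivity)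
  rw [Real.log_div hx.ne' hy.ne'] at h
  have h2 : y * (Real.log x - Real.log y) ≤ y * (x / y - 1) := by gcongr
  have h3 : y * (x / y) = x := by field_simp
  nlinarith

theorem integral_ouOp {a : ℝ} (ha : a ∈ Set.Icc (0 : ℝ) 1) {δ N : ℝ} {h : Vel d → ℝ}
    (H : IsPinched δ N h) : ∫ v, ouOp a h v ∂(gauss d) = ∫ v, h v ∂(gauss d) := by
  have hm := H.measurable
  have hp := measurePreserving_swapRot (d := d) (sq_add_sqrt_sq ha)
  have h1 : ((gauss d).prod (gauss d)).map (fun q => a • q.1 + Real.sqrt (1 - a ^ 2) • q.2) =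
      gauss d := by
    have e : (fun q : Vel d × Vel d => a • q.1 + Real.sqrt (1 - a ^ 2) • q.2) =
      Prod.fst ∘ swapRot a (Real.sqrt (1 - a ^ 2)) := rfl
    rw [e, ← Measure.map_map measurable_fst hp.measurable, hp.map_eq]
    simp
  have h2 : ∫ v, h v ∂(gauss d) = ∫ q, h (a • q.1 + Real.sqrt (1 - a ^ 2) • q.2)
      ∂((gauss d).prod (gauss d)) := by
    conv_lhs => rw [← h1]
    rw [integral_map (by fun_prop) hm.aestronglyMeasurable]
  rw [h2, integral_prod]
  · rfl
  · exact H.integrable (by fun_prop)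

theorem integral_swapRot {a c : ℝ} (h : a ^ 2 + c ^ 2 = 1) {F : Vel d × Vel d → ℝ}
    (hF : Measurable F) :
    ∫ q, F (swapRot a c q) ∂((gauss d).prod (gauss d)) = ∫ q, F q ∂((gauss d).prod (gauss d)) := by
  have hp := measurePreserving_swapRot (d := d) h
  have := integral_map (μ := (gauss d).prod (gauss d)) hp.measurable.aemeasurable
    (f := F) hF.aestronglyMeasurable
  rw [hp.map_eq] at this
  exact this.symm

theorem swapRot_swapRot {a c : ℝ} (h : a ^ 2 + c ^ 2 = 1) (q : Vel d × Vel d) :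
    swapRot a c (swapRot a c q) = q := by
  have h2 : c ^ 2 = 1 - a ^ 2 := by linarith
  ext1
  · simp only [swapRot, smul_add, smul_sub, smul_smul]
    have : a • c • q.2 = c • a • q.2 := smul_comm _ _ _
    calc _ = (a ^ 2 + c ^ 2) • q.1 := by module
      _ = _ := by rw [h, one_smul]
  · simp only [swapRot, smul_add, smul_sub, smul_smul]
    calc _ = (a ^ 2 + c ^ 2) • q.2 := by module
      _ = _ := by rw [h, one_smul]

/-- Gaussian semigroup law. -/
theorem ouOp_ouOp {a a' : ℝ} (ha : a ∈ Set.Icc (0 : ℝ) 1) (ha' : a' ∈ Set.Icc (0 : ℝ) 1)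
    {δ N : ℝ} {h : Vel d → ℝ} (H : IsPinched δ N h) (v : Vel d) :
    ouOp a (ouOp a' h) v = ouOp (a * a') h v := by
  have hm := H.measurable
  set c := Real.sqrt (1 - a ^ 2)
  set c' := Real.sqrt (1 - a' ^ 2)
  set e := Real.sqrt (1 - (a * a') ^ 2) with he
  have hc : a ^ 2 + c ^ 2 = 1 := sq_add_sqrt_sq ha
  have hc' : a' ^ 2 + c' ^ 2 = 1 := sq_add_sqrt_sq ha'
  have haa : a * a' ∈ Set.Icc (0 : ℝ) 1 :=
    ⟨mul_nonneg ha.1 ha'.1, mul_le_one₀ ha.2 ha'.1 ha'.2⟩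
  have hee : (a * a') ^ 2 + e ^ 2 = 1 := sq_add_sqrt_sq haa
  have hsum : (a' * c) ^ 2 + c' ^ 2 = e ^ 2 := by nlinarith
  have h1 : ouOp a (ouOp a' h) v = ∫ q, h ((a * a') • v + ((a' * c) • q.1 + c' • q.2))
      ∂((gauss d).prod (gauss d)) := by
    rw [integral_prod]
    · refine integral_congr_ae (ae_of_all _ fun z => integral_congr_ae (ae_of_all _ fun z' => ?_))
      beta_reduce
      congr 1
      module
    · exact H.integrable (by fun_prop)
  have h2 : ouOp (a * a') h v = ∫ q : Vel d × Vel d, h ((a * a') • v + e • q.1)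
      ∂((gauss d).prod (gauss d)) := by
    rw [integral_prod]
    · simp [ouOp, he]
    · exact H.integrable (by fun_prop)
  rw [h1, h2]
  rcases eq_or_ne e 0 with h0 | h0
  · rw [h0] at hsum ⊢
    have e1 : a' * c = 0 := by nlinarith [sq_nonneg (a' * c), sq_nonneg c']
    have e2 : c' = 0 := by nlinarith [sq_nonneg (a' * c), sq_nonneg c']
    simp [e1, e2]
  -- Rotating the pair of Gaussians aligns their combined displacement with the first one, of size
  -- e. The normalisation divides by e, which is why e = 0 was treated apart.
  · rw [← integral_swapRot (a := a' * c / e) (c := c' / e) (by field_simp; linarith) (by fun_prop)]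
    refine integral_congr_ae (ae_of_all _ fun q => ?_)
    beta_reduce
    congr 2
    simp only [swapRot]
    calc _ = (((a' * c) ^ 2 + c' ^ 2) / e) • q.1 := by module
      _ = e • q.1 := by rw [hsum]; congr 1; field_simp

/-! ### Entropy lost in one Ornstein-Uhlenbeck step. -/

section EntropyDrop

variable {δ N : ℝ} {h : Vel d → ℝ}

theorem IsPinched.integrable_mul_log {α : Type*} [MeasurableSpace α] {μ : Measure α}
    [IsFiniteMeasure μ] (H : IsPinched δ N h) {k : Vel d → ℝ} (K : IsPinched δ N k)
    {X Y : α → Vel d} (hX : Measurable X) (hY : Measurable Y) :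
    Integrable (fun x => h (X x) * Real.log (k (Y x))) μ := by
  have hm := H.measurable
  have km := K.measurable
  refine Integrable.of_bound (C := N * (|Real.log δ| + |Real.log N|))
    (Measurable.aestronglyMeasurable (by fun_prop)) (ae_of_all _ fun x => ?_)
  rw [Real.norm_eq_abs, abs_mul]
  exact mul_le_mul (H.abs_le _) (log_le_of_pinch H.pos (K.ge _) (K.le _)) (abs_nonneg _)
    ((abs_nonneg _).trans (H.abs_le (X x)))

/-- The entropy production of a step of the Ornstein-Uhlenbeck flow. -/
def ouProd (a : ℝ) (h : Vel d → ℝ) : ℝ :=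
  ∫ q : Vel d × Vel d, prodDens (h q.1) (h (a • q.1 + Real.sqrt (1 - a ^ 2) • q.2))
    ∂((gauss d).prod (gauss d))

/-- Symmetrisation: by `measurePreserving_swapRot` the pair (x, a x + c z) is exchangeable, so the
four terms of the expanded production agree in pairs. -/
theorem integral_sub_ouOp_mul_log {a : ℝ} (ha : a ∈ Set.Icc (0 : ℝ) 1) (H : IsPinched δ N h) :
    ∫ v, (h v - ouOp a h v) * Real.log (h v) ∂(gauss d) = 1 / 2 * ouProd a h := by
  have hm := H.measurable
  have hc := sq_add_sqrt_sq ha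
  set c := Real.sqrt (1 - a ^ 2) with hcdef
  have m2 : Measurable fun q : Vel d × Vel d => a • q.1 + c • q.2 := by fun_prop
  have i1 := H.integrable_mul_log (μ := (gauss d).prod (gauss d)) H measurable_fst measurable_fst
  have i2 := H.integrable_mul_log (μ := (gauss d).prod (gauss d)) H m2 m2
  have i3 := H.integrable_mul_log (μ := (gauss d).prod (gauss d)) H m2 measurable_fst
  have i4 := H.integrable_mul_log (μ := (gauss d).prod (gauss d)) H measurable_fst m2
  have e1 : ∫ q : Vel d × Vel d, h q.1 * Real.log (h q.1) ∂((gauss d).prod (gauss d)) =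
      ∫ v, h v * Real.log (h v) ∂(gauss d) := by
    rw [integral_prod _ i1]; simp
  have e2 : ∫ q : Vel d × Vel d, h (a • q.1 + c • q.2) * Real.log (h (a • q.1 + c • q.2))
      ∂((gauss d).prod (gauss d)) = ∫ v, h v * Real.log (h v) ∂(gauss d) := by
    rw [← e1, ← integral_swapRot hc (F := fun q => h q.1 * Real.log (h q.1)) (by fun_prop)]
    rfl
  have e3 : ∫ q : Vel d × Vel d, h (a • q.1 + c • q.2) * Real.log (h q.1)
      ∂((gauss d).prod (gauss d)) = ∫ v, ouOp a h v * Real.log (h v) ∂(gauss d) := by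
    rw [integral_prod _ i3]
    refine integral_congr_ae (ae_of_all _ fun v => ?_)
    exact integral_mul_const (Real.log (h v)) _
  have e4 : ∫ q : Vel d × Vel d, h q.1 * Real.log (h (a • q.1 + c • q.2))
      ∂((gauss d).prod (gauss d)) = ∫ v, ouOp a h v * Real.log (h v) ∂(gauss d) := by
    rw [← e3, ← integral_swapRot hc (F := fun q => h (a • q.1 + c • q.2) * Real.log (h q.1))
      (by fun_prop)]
    refine integral_congr_ae (ae_of_all _ fun q => ?_)
    have := congrArg Prod.fst (swapRot_swapRot hc q)
    simp only [swapRot] at this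
    simp only [swapRot, this]
  have e5 : ouProd a h = ∫ q : Vel d × Vel d, (h q.1 * Real.log (h q.1) +
      h (a • q.1 + c • q.2) * Real.log (h (a • q.1 + c • q.2))) -
      (h (a • q.1 + c • q.2) * Real.log (h q.1) + h q.1 * Real.log (h (a • q.1 + c • q.2)))
      ∂((gauss d).prod (gauss d)) := by
    refine integral_congr_ae (ae_of_all _ fun q => ?_)
    simp only [prodDens, ← hcdef]
    ring
  rw [e5, integral_sub (by exact i1.add i2) (by exact i3.add i4), integral_add i1 i2,
    integral_add i3 i4, e1, e2, e3, e4]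
  simp_rw [sub_mul]
  rw [integral_sub]
  · ring
  · exact H.integrable_mul_log H measurable_id measurable_id
  · exact (H.ouOp a).integrable_mul_log H measurable_id measurable_id

/-- Tangent inequality at h v; the linear term drops out because the step preserves the mean. -/
theorem gEnt_sub_le {a : ℝ} (ha : a ∈ Set.Icc (0 : ℝ) 1) (H : IsPinched δ N h) :
    gEnt h - gEnt (ouOp a h) ≤ 1 / 2 * ouProd a h := by
  have P := H.ouOp a
  have i1 := H.integrable_mul_log (μ := gauss d) H measurable_id measurable_id
  have i2 := P.integrable_mul_log (μ := gauss d) P measurable_id measurable_id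
  have i3 := P.integrable_mul_log (μ := gauss d) H measurable_id measurable_id
  have i4 := H.integrable (μ := gauss d) measurable_id
  have i5 := P.integrable (μ := gauss d) measurable_id
  simp only [id] at i1 i2 i3 i4 i5
  have e : ∫ v, (h v - ouOp a h v) * Real.log (h v) + (h v - ouOp a h v) ∂(gauss d) =
      1 / 2 * ouProd a h := by
    rw [integral_add, integral_sub_ouOp_mul_log ha H, integral_sub i4 i5, integral_ouOp ha H]
    · ring
    · simp_rw [sub_mul]; exact i1.sub i3
    · exact i4.sub i5
  rw [← e, gEnt, gEnt, ← integral_sub i1 i2]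
  refine integral_mono (i1.sub i2) ?_ fun v => ?_
  · simp_rw [sub_mul]; exact (i1.sub i3).add (i4.sub i5)
  · have := mul_log_sub_le (H.pos.trans_le (H.ge v)) (P.pos.trans_le (P.ge v))
    beta_reduce
    linarith

/-- Tangent inequality at the other point. Replacing log of `ouOp a h` by log of h costs a quadratic
error, since log is Lipschitz with constant 1/δ above δ; by `tendsto_sq_sub_ouOp` this error is
negligible for small steps. -/
theorem le_gEnt_sub {a : ℝ} (ha : a ∈ Set.Icc (0 : ℝ) 1) (H : IsPinched δ N h) :
    1 / 2 * ouProd a h - δ⁻¹ * ∫ v, (h v - ouOp a h v) ^ 2 ∂(gauss d) ≤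
      gEnt h - gEnt (ouOp a h) := by
  have P := H.ouOp a
  have hm := H.measurable
  have pm := P.measurable
  have i1 := H.integrable_mul_log (μ := gauss d) H measurable_id measurable_id
  have i2 := P.integrable_mul_log (μ := gauss d) P measurable_id measurable_id
  have i3 := P.integrable_mul_log (μ := gauss d) H measurable_id measurable_id
  have i4 := H.integrable (μ := gauss d) measurable_id
  have i5 := P.integrable (μ := gauss d) measurable_id
  simp only [id] at i1 i2 i3 i4 i5
  have i6 : Integrable (fun v => (h v - ouOp a h v) ^ 2) (gauss d) := by
    refine Integrable.of_bound (C := (N + N) ^ 2) (Measurable.aestronglyMeasurable (by fun_prop))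
      (ae_of_all _ fun x => ?_)
    rw [Real.norm_eq_abs, abs_pow]
    gcongr
    exact (abs_sub _ _).trans (add_le_add (H.abs_le x) (P.abs_le x))
  have i7 : Integrable (fun v => (h v - ouOp a h v) * Real.log (h v)) (gauss d) := by
    simp_rw [sub_mul]; exact i1.sub i3
  have e : ∫ v, (h v - ouOp a h v) * Real.log (h v) + (h v - ouOp a h v) -
      δ⁻¹ * (h v - ouOp a h v) ^ 2 ∂(gauss d) =
      1 / 2 * ouProd a h - δ⁻¹ * ∫ v, (h v - ouOp a h v) ^ 2 ∂(gauss d) := by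
    rw [integral_sub (by exact i7.add (i4.sub i5)) (i6.const_mul _),
      integral_add i7 (by exact i4.sub i5),
      integral_sub_ouOp_mul_log ha H, integral_sub i4 i5, integral_ouOp ha H, integral_const_mul]
    ring
  rw [← e, gEnt, gEnt, ← integral_sub i1 i2]
  refine integral_mono ((i7.add (i4.sub i5)).sub (i6.const_mul _)) (i1.sub i2) fun v => ?_
  have h1 := mul_log_sub_le (P.pos.trans_le (P.ge v)) (H.pos.trans_le (H.ge v))
  have h2 := prodDens_le H.pos (H.ge v) (P.ge v)
  have h3 := (le_abs_self _).trans h2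
  rw [prodDens] at h3
  beta_reduce
  nlinarith

end EntropyDrop

end OrnsteinUhlenbeck

/-! ### Coupling collisions from two velocities by a planar rotation. -/

section Coupling

open ProbabilityTheory Filter Topology

variable {d : ℕ} {b : ℝ → ℝ}

/-- The direction of the relative velocity. -/
def relDir (v w : Vel d) : Vel d := ‖v - w‖⁻¹ • (v - w)

theorem norm_relDir {v w : Vel d} (h : v ≠ w) : ‖relDir v w‖ = 1 :=
  norm_inv_smul (sub_ne_zero.2 h)

theorem norm_smul_relDir (v w : Vel d) : ‖v - w‖ • relDir v w = v - w := by
  rcases eq_or_ne v w with rfl | h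
  · simp [relDir]
  · rw [relDir, smul_inv_smul₀ (norm_ne_zero_iff.2 (sub_ne_zero.2 h))]

/-- The rotation in the plane of the unit vectors `k`, `l` that maps `k` to `l`. -/
def rotTo (k l : Vel d) : Vel d ≃ₗᵢ[ℝ] Vel d :=
  (Submodule.span ℝ {k}).reflection.trans (Submodule.span ℝ {k + l}).reflection

theorem reflection_span_apply (u x : Vel d) :
    (Submodule.span ℝ {u}).reflection x = (2 * (⟪u, x⟫ / ‖u‖ ^ 2)) • u - x := by
  rw [Submodule.reflection_singleton_apply]
  simp [two_smul, two_mul, add_smul]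

theorem rotTo_apply (k l x : Vel d) :
    rotTo k l x = (2 * (⟪k + l, (2 * (⟪k, x⟫ / ‖k‖ ^ 2)) • k - x⟫ / ‖k + l‖ ^ 2)) • (k + l) -
      ((2 * (⟪k, x⟫ / ‖k‖ ^ 2)) • k - x) := by
  rw [rotTo, LinearIsometryEquiv.trans_apply, reflection_span_apply k x, reflection_span_apply]

theorem rotTo_self {k l : Vel d} (hk : ‖k‖ = 1) (hl : ‖l‖ = 1) : rotTo k l k = l := by
  have hkk : ⟪k, k⟫ = 1 := by rw [real_inner_self_eq_norm_sq, hk]; norm_num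
  have h1 : (2 * (⟪k, k⟫ / ‖k‖ ^ 2)) • k - k = k := by
    rw [hkk, hk]; norm_num; rw [two_smul, add_sub_cancel_right]
  rw [rotTo_apply, h1]
  -- For antipodal k and l the second span is trivial and its reflection is minus the identity,
  -- which still sends k to l.
  rcases eq_or_ne (k + l) 0 with h0 | h0
  · rw [h0]; simp [eq_neg_of_add_eq_zero_right h0]
  · have h2 : ‖k + l‖ ^ 2 = 2 * ⟪k + l, k⟫ := by
      rw [norm_add_sq_real, hk, hl, inner_add_left, hkk, real_inner_comm]; ring
    have h3 : ⟪k + l, k⟫ ≠ 0 := by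
      intro h; rw [h, mul_zero] at h2
      exact h0 (norm_eq_zero.1 (pow_eq_zero_iff (two_ne_zero) |>.1 h2))
    rw [h2]
    have : 2 * (⟪k + l, k⟫ / (2 * ⟪k + l, k⟫)) = 1 := by field_simp
    rw [this, one_smul, add_sub_cancel_left]

/-- If |l - k| ≥ 1 the diameter 2 of the sphere suffices. Otherwise the normalised bisector m of k
and l is within 2|l - k| of k, and a product of the reflections along k and m moves unit vectors by
at most 4|m - k|. -/
theorem norm_rotTo_sub_le {k l : Vel d} (hk : ‖k‖ = 1) {x : Vel d}
    (hx : ‖x‖ = 1) : ‖rotTo k l x - x‖ ≤ 8 * ‖l - k‖ := by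
  rcases le_or_gt 1 ‖l - k‖ with h | h
  · calc ‖rotTo k l x - x‖ ≤ ‖rotTo k l x‖ + ‖x‖ := norm_sub_le _ _
      _ = 2 := by rw [LinearIsometryEquiv.norm_map, hx]; norm_num
      _ ≤ _ := by linarith
  set y := (Submodule.span ℝ {k}).reflection x with hy
  have hyn : ‖y‖ = 1 := by rw [hy, LinearIsometryEquiv.norm_map, hx]
  have hxy : x = (Submodule.span ℝ {k}).reflection y := by
    rw [hy, Submodule.reflection_reflection]
  set n := k + l with hn
  have hn2 : ‖n - (2 : ℝ) • k‖ = ‖l - k‖ := by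
    congr 1; rw [hn]; module
  have h2k : ‖(2 : ℝ) • k‖ = 2 := by rw [norm_smul, hk]; norm_num
  have hn1 : 1 ≤ ‖n‖ := by
    have := norm_sub_norm_le ((2 : ℝ) • k) n
    rw [norm_sub_rev, hn2, h2k] at this
    linarith
  have hn0 : ‖n‖ ≠ 0 := by linarith
  set m := ‖n‖⁻¹ • n with hm
  have hm1 : ‖m‖ = 1 := by rw [hm, norm_inv_smul (norm_ne_zero_iff.1 hn0)]
  have hnm : n = ‖n‖ • m := by rw [hm, smul_inv_smul₀ hn0]
  have hmk : ‖m - k‖ ≤ 2 * ‖l - k‖ := by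
    have e : ‖n‖ • (m - k) = (n - (2 : ℝ) • k) + (2 - ‖n‖) • k := by
      rw [smul_sub, ← hnm]; module
    have h3 : ‖‖n‖ • (m - k)‖ ≤ ‖l - k‖ + |2 - ‖n‖| := by
      rw [e]
      refine (norm_add_le _ _).trans ?_
      rw [hn2, norm_smul, hk, mul_one, Real.norm_eq_abs]
    have h4 : |2 - ‖n‖| ≤ ‖l - k‖ := by
      have := abs_norm_sub_norm_le ((2 : ℝ) • k) n
      rwa [norm_sub_rev, hn2, h2k] at this
    rw [norm_smul, norm_norm] at h3
    nlinarith [norm_nonneg (m - k)]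
  have e1 : rotTo k l x - x = (2 * ⟪m - k, y⟫) • m + (2 * ⟪k, y⟫) • (m - k) := by
    have e2 : rotTo k l x = (Submodule.span ℝ {n}).reflection y := rfl
    rw [e2, hxy, reflection_span_apply, reflection_span_apply, hk]
    have e3 : (2 * (⟪n, y⟫ / ‖n‖ ^ 2)) • n = (2 * ⟪m, y⟫) • m := by
      rw [hm, real_inner_smul_left, smul_smul]
      congr 1
      field_simp
    rw [e3, inner_sub_left]
    module
  rw [e1]
  refine (norm_add_le _ _).trans ?_
  rw [norm_smul _ m, norm_smul _ (m - k), hm1, Real.norm_eq_abs, Real.norm_eq_abs, abs_mul,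
    abs_mul, abs_two]
  have h5 := abs_real_inner_le_norm (m - k) y
  have h6 := abs_real_inner_le_norm k y
  rw [hyn, mul_one] at h5 h6
  rw [hk] at h6
  nlinarith [norm_nonneg (m - k)]

/-- The post-collisional velocity of `(v₂, w)`, coupled with the collision `(v, w, σ)`. -/
def rotPrime (v v₂ w σ : Vel d) : Vel d :=
  (1 / 2 : ℝ) • (v₂ + w) + (‖v₂ - w‖ / 2) • rotTo (relDir v w) (relDir v₂ w) σ

theorem measurable_rotPrime : Measurable fun q : Vel d × Vel d × Vel d × Vel d =>
    rotPrime q.1 q.2.1 q.2.2.1 q.2.2.2 := by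
  simp only [rotPrime, rotTo_apply, relDir]
  fun_prop

/-- The direction of v - w is singular at v = w, but it is multiplied by |v - w|, so the coupled
velocity is Lipschitz in v₂ uniformly in w and σ. The three contributions are 1/2, 1/2 and 16/2;
only integrability of the bound matters, and 10 is a convenient excess. -/
theorem norm_rotPrime_sub_le (v v₂ w : Vel d) (σ : Sph d) :
    ‖rotPrime v v₂ w σ - vPrime v w σ‖ ≤ 10 * ‖v₂ - v‖ := by
  have hσ : ‖(σ : Vel d)‖ = 1 := by simp
  set O := rotTo (relDir v w) (relDir v₂ w) with hO
  have hOσ : ‖O σ‖ = 1 := by rw [LinearIsometryEquiv.norm_map, hσ]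
  have hu : ‖(v₂ - w) - (v - w)‖ = ‖v₂ - v‖ := by congr 1; abel
  have hd := abs_norm_sub_norm_le (v₂ - w) (v - w)
  rw [hu] at hd
  have e : rotPrime v v₂ w σ - vPrime v w σ = (1 / 2 : ℝ) • (v₂ - v) +
      ((‖v₂ - w‖ - ‖v - w‖) / 2) • O σ + (‖v - w‖ / 2) • (O σ - σ) := by
    simp only [rotPrime, vPrime, ← hO]; module
  have key : ‖v - w‖ * ‖O σ - σ‖ ≤ 16 * ‖v₂ - v‖ := by
    rcases eq_or_ne v w with rfl | h
    · simp
    rcases eq_or_ne v₂ w with rfl | h2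
    · have : ‖O σ - σ‖ ≤ 2 := by
        refine (norm_sub_le _ _).trans ?_; rw [hOσ, hσ]; norm_num
      rw [norm_sub_rev v₂ v]
      nlinarith [norm_nonneg (v - v₂)]
    have h3 := norm_rotTo_sub_le (l := relDir v₂ w) (norm_relDir h) hσ
    have h4 : ‖v - w‖ * ‖relDir v₂ w - relDir v w‖ ≤ 2 * ‖v₂ - v‖ := by
      have e2 : ‖v - w‖ • (relDir v₂ w - relDir v w) =
          ((v₂ - w) - (v - w)) + (‖v - w‖ - ‖v₂ - w‖) • relDir v₂ w := by
        rw [smul_sub, norm_smul_relDir, sub_smul, norm_smul_relDir]; abel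
      have h5 := norm_smul (‖v - w‖) (relDir v₂ w - relDir v w)
      rw [norm_norm, e2] at h5
      rw [← h5]
      refine (norm_add_le _ _).trans ?_
      rw [hu, norm_smul, norm_relDir h2, Real.norm_eq_abs, abs_sub_comm]
      linarith
    nlinarith [norm_nonneg (v - w)]
  rw [e]
  refine (norm_add₃_le).trans ?_
  have e3 : |(‖v₂ - w‖ - ‖v - w‖) / 2| = |‖v₂ - w‖ - ‖v - w‖| / 2 := by rw [abs_div, abs_two]
  rw [norm_smul, norm_smul, norm_smul, hOσ, Real.norm_eq_abs, Real.norm_eq_abs,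
    Real.norm_eq_abs, abs_of_nonneg (by positivity : 0 ≤ ‖v - w‖ / 2), e3]
  norm_num
  linarith [norm_nonneg (v₂ - v)]

/-- The rotation taking the old relative direction to the new one preserves the surface measure and
the deviation angle. Thus under the law of collisions from v, `rotPrime` has the law of the outgoing
velocity from v₂: one probability space serves both points. -/
theorem gainK_eq_integral_rotPrime (hd : 1 ≤ d) (hb : IsAngularKernel d b) {δ N : ℝ}
    {h : Vel d → ℝ} (H : IsPinched δ N h) (v v₂ : Vel d) :
    gainK b h v₂ = ∫ p, h (rotPrime v v₂ p.1 p.2) ∂(collKer d b v) := by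
  have := isMarkovKernel_collKer hd hb
  have hm := H.measurable
  have hvm : Measurable fun p : Vel d × Sph d => vPrime v₂ p.1 p.2 := by unfold vPrime; fun_prop
  have hr := measurable_rotPrime (d := d)
  have hrm : Measurable fun p : Vel d × Sph d => rotPrime v v₂ p.1 p.2 := by
    have := hr.comp (by fun_prop : Measurable fun p : Vel d × Sph d => (v, v₂, p.1, (p.2 : Vel d)))
    exact this
  rw [gainK, integral_collKer hb v₂ (H.integrable hvm), integral_collKer hb v (H.integrable hrm)]
  refine integral_congr_ae ?_
  filter_upwards [ae_ne_gauss hd v, ae_ne_gauss hd v₂] with w h1 h2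
  rw [integral_angMeasure hb, integral_angMeasure hb,
    ← integral_sphMap (rotTo (relDir v w) (relDir v₂ w))]
  · refine integral_congr_ae (ae_of_all _ fun σ => ?_)
    have e : cosTheta v₂ w (sphMap (rotTo (relDir v w) (relDir v₂ w)) σ) = cosTheta v w σ := by
      have : cosTheta v w σ = ⟪relDir v w, (σ : Vel d)⟫ := rfl
      rw [this, ← (rotTo (relDir v w) (relDir v₂ w)).inner_map_map,
        rotTo_self (norm_relDir h1) (norm_relDir h2)]
      rfl
    simp only [e]
    rfl
  · have hbm := hb.measurable
    have hc : Measurable fun σ : Sph d => cosTheta v₂ w σ := by unfold cosTheta; fun_prop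
    have hv : Measurable fun σ : Sph d => vPrime v₂ w σ := by unfold vPrime; fun_prop
    exact Measurable.aestronglyMeasurable (by fun_prop)

/-- The adjoint of the derivative of the coupling `rotPrime` in the relative velocity. -/
def dRot (k σ z : Vel d) : Vel d := ⟪k, σ⟫ • z - ⟪z, σ⟫ • k + ⟪k, z⟫ • σ

/-- To first order v moves by z, the square root contributing nothing. The relative speed changes by
⟪k, z⟫ and its direction by τ, whose factor 1/|v - w| is cancelled by the radius |v - w|/2. -/
theorem hasDerivAt_rotPrime {v w : Vel d} (h : v ≠ w) (z : Vel d) (σ : Vel d) :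
    HasDerivAt (fun η : ℝ => rotPrime v (Real.sqrt (1 - η ^ 2) • v + η • z) w σ)
      ((1 / 2 : ℝ) • (z + dRot (relDir v w) σ z)) 0 := by
  set k := relDir v w with hk
  have hk1 : ‖k‖ = 1 := norm_relDir h
  have hkk : ⟪k, k⟫ = 1 := by rw [real_inner_self_eq_norm_sq, hk1]; norm_num
  have hu0 : v - w ≠ 0 := sub_ne_zero.2 h
  have hun : ‖v - w‖ ≠ 0 := norm_ne_zero_iff.2 hu0
  have huk : v - w = ‖v - w‖ • k := (norm_smul_relDir v w).symm
  set V : ℝ → Vel d := fun η => Real.sqrt (1 - η ^ 2) • v + η • z with hV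
  have hs : HasDerivAt (fun η : ℝ => Real.sqrt (1 - η ^ 2)) 0 0 := by
    have h1 : HasDerivAt (fun η : ℝ => 1 - η ^ 2) 0 0 := by
      simpa using ((hasDerivAt_id (0 : ℝ)).pow 2).const_sub 1
    have := h1.sqrt (by norm_num)
    simpa using this
  have hVd : HasDerivAt V z 0 := by
    have h1 := hs.smul_const v
    have h2 := (hasDerivAt_id (0 : ℝ)).smul_const z
    convert! h1.add h2 using 1
    simp
  have hV0 : V 0 = v := by simp [hV]
  have hU : HasDerivAt (fun η => V η - w) z 0 := hVd.sub_const w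
  have hN : HasDerivAt (fun η => ‖V η - w‖) ⟪k, z⟫ 0 := by
    have h1 := hU.norm_sq
    have h2 := h1.sqrt (by rw [hV0]; positivity)
    rw [hV0, Real.sqrt_sq (norm_nonneg _)] at h2
    simp only [Real.sqrt_sq (norm_nonneg _)] at h2
    convert! h2 using 1
    rw [hk, relDir, real_inner_smul_left]
    field_simp
  set τ := ‖v - w‖⁻¹ • (z - ⟪k, z⟫ • k) with hτ
  have hkτ : ⟪k, τ⟫ = 0 := by
    rw [hτ, real_inner_smul_right, inner_sub_right, real_inner_smul_right, hkk]; ring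
  have hK : HasDerivAt (fun η => relDir (V η) w) τ 0 := by
    have h1 := (hN.inv (by rw [hV0]; exact hun)).smul hU
    convert! h1 using 1
    have e : (-⟪k, z⟫ / ‖V 0 - w‖ ^ 2) • (V 0 - w) = (-⟪k, z⟫ / ‖v - w‖) • k := by
      rw [hV0, hk, relDir, smul_smul]; congr 1; field_simp
    rw [e, hτ]
    simp only [Pi.inv_apply, hV0]
    module
  have hK0 : relDir (V 0) w = k := by rw [hV0]
  have hn : HasDerivAt (fun η => k + relDir (V η) w) τ 0 := hK.const_add k
  have hn2 : HasDerivAt (fun η => ‖k + relDir (V η) w‖ ^ 2) 0 0 := by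
    have := hn.norm_sq
    rw [hK0, ← two_smul ℝ k, real_inner_smul_left, hkτ] at this
    simpa using this
  have hkk4 : ‖k + relDir (V 0) w‖ ^ 2 = 4 := by
    rw [hK0, ← two_smul ℝ k, norm_smul, hk1]; norm_num
  set y := (2 * (⟪k, σ⟫ / ‖k‖ ^ 2)) • k - σ with hy
  have hin : HasDerivAt (fun η => ⟪k + relDir (V η) w, y⟫) ⟪τ, y⟫ 0 := by
    have := hn.inner ℝ (hasDerivAt_const (0 : ℝ) y)
    simpa using this
  have hq := ((hin.div hn2 (by rw [hkk4]; norm_num)).const_mul 2).smul hn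
  have hR := hq.sub_const y
  have hfin := (hVd.add_const w).const_smul (1 / 2 : ℝ) |>.add ((hN.div_const 2).smul hR)
  have hfun : (fun η => rotPrime v (V η) w σ) = fun η => (1 / 2 : ℝ) • (V η + w) +
      (‖V η - w‖ / 2) • ((2 * (⟪k + relDir (V η) w, y⟫ / ‖k + relDir (V η) w‖ ^ 2)) •
        (k + relDir (V η) w) - y) := by
    funext η
    rw [rotPrime, rotTo_apply]
  rw [hfun]
  convert! hfin using 1
  simp only [Pi.div_apply, Pi.smul_apply']
  rw [hkk4, hK0, hV0]
  have i1 : ⟪k, y⟫ = ⟪k, σ⟫ := by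
    rw [hy, inner_sub_right, real_inner_smul_right, hkk, hk1]; ring
  have i2 : ⟪τ, y⟫ = ‖v - w‖⁻¹ * (⟪k, z⟫ * ⟪k, σ⟫ - ⟪z, σ⟫) := by
    have hτk : ⟪τ, k⟫ = 0 := by rw [real_inner_comm]; exact hkτ
    rw [hy, inner_sub_right, real_inner_smul_right, hτk, hτ, real_inner_smul_left,
      inner_sub_left, real_inner_smul_left]
    ring
  rw [i2, ← two_smul ℝ k, real_inner_smul_left, i1, dRot, hy, hk1, hτ]
  match_scalars <;> field_simp <;> ring

/-- With c = ⟪k, σ⟫, expansion gives (1 + c)²|x|² plus the quadratic form p² + q² - 2cpq of p = ⟪k,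
x⟫ and q = ⟪σ, x⟫. Nonnegativity of the Gram determinant of k, σ, x bounds that form by (1 -
c²)|x|², and (1 + c)² + 1 - c² = 2(1 + c). -/
theorem norm_add_dRot_le {k σ : Vel d} (hk : ‖k‖ = 1) (hσ : ‖σ‖ = 1) (x : Vel d) :
    ‖x + (⟪k, σ⟫ • x - ⟪k, x⟫ • σ + ⟪σ, x⟫ • k)‖ ^ 2 ≤ 2 * (1 + ⟪k, σ⟫) * ‖x‖ ^ 2 := by
  set c := ⟪k, σ⟫ with hc
  set p := ⟪k, x⟫ with hp
  set q := ⟪σ, x⟫ with hq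
  have hkk : ⟪k, k⟫ = 1 := by rw [real_inner_self_eq_norm_sq, hk]; norm_num
  have hss : ⟪σ, σ⟫ = 1 := by rw [real_inner_self_eq_norm_sq, hσ]; norm_num
  have hsk : ⟪σ, k⟫ = c := by rw [real_inner_comm]
  have hxk : ⟪x, k⟫ = p := by rw [real_inner_comm]
  have hxs : ⟪x, σ⟫ = q := by rw [real_inner_comm]
  have hc1 : |c| ≤ 1 := by
    have := abs_real_inner_le_norm k σ
    rwa [hk, hσ, mul_one] at this
  have hcc : c ^ 2 ≤ 1 := (sq_le_one_iff_abs_le_one c).2 hc1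
  have hpp : p ^ 2 ≤ ‖x‖ ^ 2 := by
    have := abs_real_inner_le_norm k x
    rw [hk, one_mul] at this
    exact sq_le_sq.2 (by rwa [abs_norm])
  have gram : p ^ 2 + q ^ 2 - 2 * c * p * q ≤ (1 - c ^ 2) * ‖x‖ ^ 2 := by
    have h0 : ⟪σ - c • k, x - p • k⟫ ^ 2 ≤ ‖σ - c • k‖ ^ 2 * ‖x - p • k‖ ^ 2 := by
      rw [← mul_pow]
      exact sq_le_sq.2 ((abs_real_inner_le_norm _ _).trans (le_abs_self _))
    have h1 : ⟪σ - c • k, x - p • k⟫ = q - c * p := by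
      simp only [inner_sub_left, inner_sub_right, real_inner_smul_left, real_inner_smul_right, hkk,
        hsk, ← hp, ← hq]
      ring
    have h2 : ‖σ - c • k‖ ^ 2 = 1 - c ^ 2 := by
      rw [← real_inner_self_eq_norm_sq]
      simp only [inner_sub_left, inner_sub_right, real_inner_smul_left, real_inner_smul_right, hkk,
        hsk, hss, ← hc]
      ring
    have h3 : ‖x - p • k‖ ^ 2 = ‖x‖ ^ 2 - p ^ 2 := by
      rw [← real_inner_self_eq_norm_sq, ← real_inner_self_eq_norm_sq]
      simp only [inner_sub_left, inner_sub_right, real_inner_smul_left, real_inner_smul_right, hkk,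
        hxk, ← hp]
      ring
    rw [h1, h2, h3] at h0
    nlinarith
  have e : ‖x + (c • x - p • σ + q • k)‖ ^ 2 =
      (1 + c) ^ 2 * ‖x‖ ^ 2 + p ^ 2 + q ^ 2 - 2 * c * p * q := by
    rw [← real_inner_self_eq_norm_sq, ← real_inner_self_eq_norm_sq x]
    simp only [inner_add_left, inner_add_right, inner_sub_left, inner_sub_right,
      real_inner_smul_left, real_inner_smul_right, hkk, hss, hsk, hxk, hxs, ← hc, ← hp, ← hq]
    ring
  rw [e]
  nlinarith

theorem inner_add_dRot (x k σ z : Vel d) :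
    ⟪x, z + dRot k σ z⟫ = ⟪x + (⟪k, σ⟫ • x - ⟪k, x⟫ • σ + ⟪σ, x⟫ • k), z⟫ := by
  simp only [dRot, inner_add_left, inner_add_right, inner_sub_left, inner_sub_right,
      real_inner_smul_left, real_inner_smul_right]
  rw [real_inner_comm z σ, real_inner_comm x σ, real_inner_comm x k]
  ring

end Coupling

/-! ### Small-step limits and the Fisher information. -/

section SmallSteps

open ProbabilityTheory Filter Topology

variable {d : ℕ} {b : ℝ → ℝ}

theorem one_sub_sqrt_le {η : ℝ} (hη : η ∈ Set.Icc (0 : ℝ) 1) :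
    |Real.sqrt (1 - η ^ 2) - 1| ≤ η := by
  have h1 : Real.sqrt (1 - η ^ 2) ≤ 1 := Real.sqrt_le_one.2 (by nlinarith [hη.1])
  have h2 : 1 - η ≤ Real.sqrt (1 - η ^ 2) :=
    Real.le_sqrt_of_sq_le (by nlinarith [hη.1, hη.2])
  rw [abs_sub_comm, abs_of_nonneg (by linarith)]
  linarith

theorem sqrt_one_sub_mem (η : ℝ) : Real.sqrt (1 - η ^ 2) ∈ Set.Icc (0 : ℝ) 1 :=
  ⟨Real.sqrt_nonneg _, Real.sqrt_le_one.2 (by nlinarith [sq_nonneg η])⟩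

theorem sqrt_one_sub_sqrt {η : ℝ} (hη : η ∈ Set.Icc (0 : ℝ) 1) :
    Real.sqrt (1 - Real.sqrt (1 - η ^ 2) ^ 2) = η := by
  rw [Real.sq_sqrt (by nlinarith [hη.1, hη.2]), sub_sub_cancel, Real.sqrt_sq hη.1]

theorem norm_ouStep_sub_le {η : ℝ} (hη : η ∈ Set.Icc (0 : ℝ) 1) (x z : Vel d) :
    ‖Real.sqrt (1 - η ^ 2) • x + η • z - x‖ ≤ η * (‖x‖ + ‖z‖) := by
  have e : Real.sqrt (1 - η ^ 2) • x + η • z - x = (Real.sqrt (1 - η ^ 2) - 1) • x + η • z := by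
    module
  rw [e]
  refine (norm_add_le _ _).trans ?_
  rw [norm_smul, norm_smul, Real.norm_eq_abs, Real.norm_eq_abs, abs_of_nonneg hη.1, mul_add]
  gcongr
  exact one_sub_sqrt_le hη

theorem hasDerivAt_ouStep (x z : Vel d) :
    HasDerivAt (fun η : ℝ => Real.sqrt (1 - η ^ 2) • x + η • z) z 0 := by
  have hs : HasDerivAt (fun η : ℝ => Real.sqrt (1 - η ^ 2)) 0 0 := by
    have h1 : HasDerivAt (fun η : ℝ => 1 - η ^ 2) 0 0 := by
      simpa using ((hasDerivAt_id (0 : ℝ)).pow 2).const_sub 1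
    have := h1.sqrt (by norm_num)
    simpa using this
  have h1 := hs.smul_const x
  have h2 := (hasDerivAt_id (0 : ℝ)).smul_const z
  convert! h1.add h2 using 1
  simp

theorem inner_gradient (g : Vel d → ℝ) (x z : Vel d) : ⟪gradient g x, z⟫ = fderiv ℝ g x z :=
  InnerProductSpace.toDual_symm_apply

theorem measurable_gradient (g : Vel d → ℝ) : Measurable (gradient g) :=
  (InnerProductSpace.toDual ℝ (Vel d)).symm.continuous.measurable.comp (measurable_fderiv ℝ g)

theorem norm_gradient_le {L : NNReal} {g : Vel d → ℝ} (hL : LipschitzWith L g) (x : Vel d) :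
    ‖gradient g x‖ ≤ L := by
  rw [gradient, LinearIsometryEquiv.norm_map]
  exact norm_fderiv_le_of_lipschitz ℝ hL

theorem ae_differentiableAt_gauss {L : NNReal} {g : Vel d → ℝ} (hL : LipschitzWith L g) :
    ∀ᵐ x ∂(gauss d), DifferentiableAt ℝ g x :=
  gauss_ac.ae_le (hL.ae_differentiableAt (μ := volume))

section Limit

variable {Ω : Type*} [MeasurableSpace Ω] {μ : Measure Ω}
  {Γ : ℝ → Ω → Vel d} {X Y : Ω → Vel d} {W : Ω → ℝ} {δ N : ℝ} {L : NNReal} {g : Vel d → ℝ}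

/-- Second order expansion of the entropy production along curves. -/
theorem tendsto_integral_prodDens (H : IsPinched δ N g) (hL : LipschitzWith L g)
    (hΓ : ∀ η, Measurable (Γ η)) (hΓ0 : ∀ ω, Γ 0 ω = X ω)
    (hder : ∀ᵐ ω ∂μ, HasDerivAt (fun η => Γ η ω) (Y ω) 0)
    (hdiff : ∀ᵐ ω ∂μ, DifferentiableAt ℝ g (X ω))
    (hW : ∀ η ∈ Set.Icc (0 : ℝ) 1, ∀ ω, ‖Γ η ω - X ω‖ ≤ η * W ω)
    (hW2 : Integrable (fun ω => W ω ^ 2) μ) :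
    Tendsto (fun η => (∫ ω, prodDens (g (X ω)) (g (Γ η ω)) ∂μ) / η ^ 2) (𝓝[>] 0)
      (𝓝 (∫ ω, ⟪gradient g (X ω), Y ω⟫ ^ 2 / g (X ω) ∂μ)) := by
  have hX : Measurable X := by
    have : X = Γ 0 := funext fun ω => (hΓ0 ω).symm
    rw [this]; exact hΓ 0
  have hm := H.measurable
  simp_rw [← integral_div]
  refine tendsto_integral_filter_of_dominated_convergence
    (fun ω => δ⁻¹ * (L : ℝ) ^ 2 * W ω ^ 2) ?_ ?_ (hW2.const_mul _) ?_
  · refine Eventually.of_forall fun η => Measurable.aestronglyMeasurable ?_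
    have := hΓ η
    unfold prodDens
    fun_prop
  · have : ∀ᶠ η : ℝ in 𝓝[>] 0, η ∈ Set.Ioo (0 : ℝ) 1 := Ioo_mem_nhdsGT one_pos
    filter_upwards [this] with η hη
    refine ae_of_all _ fun ω => ?_
    have h1 := prodDens_le H.pos (H.ge (X ω)) (H.ge (Γ η ω))
    have h2 := hW η ⟨hη.1.le, hη.2.le⟩ ω
    have h3 : |g (X ω) - g (Γ η ω)| ≤ L * (η * W ω) := by
      have := hL.dist_le_mul (Γ η ω) (X ω)
      rw [dist_eq_norm, dist_eq_norm, norm_sub_rev, Real.norm_eq_abs] at this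
      exact this.trans (by gcongr)
    have hη2 : 0 < η ^ 2 := pow_pos hη.1 2
    rw [Real.norm_eq_abs, abs_div, abs_of_pos hη2, div_le_iff₀ hη2]
    refine h1.trans ?_
    rw [← sq_abs]
    calc δ⁻¹ * |g (X ω) - g (Γ η ω)| ^ 2 ≤ δ⁻¹ * (L * (η * W ω)) ^ 2 := by
          have := H.pos
          gcongr
      _ = _ := by ring
  · filter_upwards [hder, hdiff] with ω h1 h2
    have h0 := hΓ0 ω
    rw [← h0] at h2
    have hu : HasDerivAt (fun η => g (Γ η ω)) (fderiv ℝ g (Γ 0 ω) (Y ω)) 0 :=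
      h2.hasFDerivAt.comp_hasDerivAt 0 h1
    have hl := hu.log (H.pos.trans_le (H.ge _)).ne'
    rw [hasDerivAt_iff_tendsto_slope] at hu hl
    -- Divided by η², the production density is the product of the slopes of g and log g along the
    -- curve.
    have := (hu.mul hl).mono_left (nhdsWithin_mono 0 (s := Set.Ioi 0) (t := {0}ᶜ) (fun x hx => ne_of_gt hx))
    rw [inner_gradient]
    rw [h0] at this
    have e : fderiv ℝ g (X ω) (Y ω) * (fderiv ℝ g (X ω) (Y ω) / g (X ω)) =
        (fderiv ℝ g (X ω) (Y ω)) ^ 2 / g (X ω) := by ring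
    rw [e] at this
    refine this.congr fun η => ?_
    simp only [slope_def_field, prodDens, h0]
    rw [sub_zero, ← h0]
    ring

end Limit

/-- The Fisher information with respect to the Gaussian measure. -/
def fisher (g : Vel d → ℝ) : ℝ := ∫ v, ‖gradient g v‖ ^ 2 / g v ∂(gauss d)

section Slope

variable {δ N : ℝ} {L : NNReal} {g : Vel d → ℝ}

theorem integrable_sq_add_norm {α : Type*} [MeasurableSpace α] {μ : Measure α}
    [IsProbabilityMeasure μ] {X : α → Vel d} (hX : MeasurePreserving X μ (gauss d)) :
    Integrable (fun q : α × Vel d => (‖X q.1‖ + ‖q.2‖) ^ 2) (μ.prod (gauss d)) := by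
  have h1 : Integrable (fun x => ‖X x‖ ^ 2) μ :=
    hX.integrable_comp_of_integrable integrable_norm_sq_gauss
  have h2 : Integrable (fun q : α × Vel d => 2 * ‖X q.1‖ ^ 2 + 2 * ‖q.2‖ ^ 2) (μ.prod (gauss d)) :=
    ((h1.comp_fst _).const_mul 2).add ((integrable_norm_sq_gauss.comp_snd _).const_mul 2)
  have hm := hX.measurable
  refine h2.mono' (Measurable.aestronglyMeasurable (by fun_prop)) (ae_of_all _ fun q => ?_)
  rw [Real.norm_eq_abs, abs_of_nonneg (by positivity)]
  nlinarith [sq_nonneg (‖X q.1‖ - ‖q.2‖)]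

theorem integrable_inner_sq {α : Type*} [MeasurableSpace α] {μ : Measure α}
    [IsProbabilityMeasure μ] {ζ : α → Vel d} (hζ : Measurable ζ) {C : ℝ} (hC : ∀ᵐ x ∂μ, ‖ζ x‖ ≤ C) :
    Integrable (fun q : α × Vel d => ⟪ζ q.1, q.2⟫ ^ 2) (μ.prod (gauss d)) := by
  refine ((integrable_norm_sq_gauss.comp_snd μ).const_mul (C ^ 2)).mono'
    (Measurable.aestronglyMeasurable (by fun_prop)) ?_
  have : ∀ᵐ q ∂(μ.prod (gauss d)), ‖ζ q.1‖ ≤ C :=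
    Measure.quasiMeasurePreserving_fst.ae hC
  filter_upwards [this] with q hq
  rw [Real.norm_eq_abs, abs_pow, ← mul_pow]
  gcongr
  exact (abs_real_inner_le_norm _ _).trans (by gcongr)

theorem tendsto_ouProd (H : IsPinched δ N g) (hL : LipschitzWith L g) :
    Tendsto (fun η => ouProd (Real.sqrt (1 - η ^ 2)) g / η ^ 2) (𝓝[>] 0) (𝓝 (fisher g)) := by
  have hdiff : ∀ᵐ q : Vel d × Vel d ∂((gauss d).prod (gauss d)), DifferentiableAt ℝ g q.1 :=
    Measure.quasiMeasurePreserving_fst.ae (ae_differentiableAt_gauss hL)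
  have hW2 : Integrable (fun q : Vel d × Vel d => (‖q.1‖ + ‖q.2‖) ^ 2)
      ((gauss d).prod (gauss d)) :=
    integrable_sq_add_norm (X := fun x => x) (MeasurePreserving.id _)
  have hΓ : ∀ η : ℝ, Measurable fun q : Vel d × Vel d =>
      Real.sqrt (1 - η ^ 2) • q.1 + η • q.2 := fun η => by fun_prop
  have hΓ0 : ∀ q : Vel d × Vel d, Real.sqrt (1 - (0 : ℝ) ^ 2) • q.1 + (0 : ℝ) • q.2 = q.1 :=
    fun q => by simp
  have hder : ∀ q : Vel d × Vel d, HasDerivAt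
      (fun η : ℝ => Real.sqrt (1 - η ^ 2) • q.1 + η • q.2) q.2 0 :=
    fun q => hasDerivAt_ouStep q.1 q.2
  have hWb : ∀ η ∈ Set.Icc (0 : ℝ) 1, ∀ q : Vel d × Vel d,
      ‖Real.sqrt (1 - η ^ 2) • q.1 + η • q.2 - q.1‖ ≤ η * (‖q.1‖ + ‖q.2‖) :=
    fun η hη q => norm_ouStep_sub_le hη q.1 q.2
  have h := tendsto_integral_prodDens (μ := (gauss d).prod (gauss d))
    (Γ := fun η q => Real.sqrt (1 - η ^ 2) • q.1 + η • q.2) (X := fun q => q.1) (Y := fun q => q.2)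
    (W := fun q => ‖q.1‖ + ‖q.2‖) H hL hΓ hΓ0 (ae_of_all _ hder) hdiff hWb hW2
  have e : ∫ q : Vel d × Vel d, ⟪gradient g q.1, q.2⟫ ^ 2 / g q.1 ∂((gauss d).prod (gauss d)) =
      fisher g := by
    have hm := H.measurable
    have hgm := measurable_gradient g
    rw [integral_prod]
    · refine integral_congr_ae (ae_of_all _ fun x => ?_)
      change ∫ z, ⟪gradient g x, z⟫ ^ 2 / g x ∂(gauss d) = _
      rw [integral_div, integral_inner_sq_gauss]
    · have h1 := integrable_inner_sq (μ := gauss d) hgm (ae_of_all _ (norm_gradient_le hL))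
      refine (h1.const_mul δ⁻¹).mono' (Measurable.aestronglyMeasurable (by fun_prop))
        (ae_of_all _ fun q => ?_)
      have h2 := H.ge q.1
      have h3 := H.pos
      rw [Real.norm_eq_abs, abs_of_nonneg (div_nonneg (sq_nonneg _) (h3.le.trans h2)), div_eq_inv_mul]
      gcongr
  rw [e] at h
  refine h.congr' ?_
  have : ∀ᶠ η : ℝ in 𝓝[>] 0, η ∈ Set.Ioo (0 : ℝ) 1 := Ioo_mem_nhdsGT one_pos
  filter_upwards [this] with η hη
  rw [ouProd, sqrt_one_sub_sqrt ⟨hη.1.le, hη.2.le⟩]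

/-- The first-order increment of g is linear in the centred Gaussian variable z and averages to
zero, so g - P g is o(η) in L², whereas g itself varies by order η along a step. -/
theorem tendsto_sq_sub_ouOp (H : IsPinched δ N g) (hL : LipschitzWith L g) :
    Tendsto (fun η => (∫ v, (g v - ouOp (Real.sqrt (1 - η ^ 2)) g v) ^ 2 ∂(gauss d)) / η ^ 2)
      (𝓝[>] 0) (𝓝 0) := by
  have hev : ∀ᶠ η : ℝ in 𝓝[>] 0, η ∈ Set.Ioo (0 : ℝ) 1 := Ioo_mem_nhdsGT one_pos
  have hm := H.measurable
  have hn : Integrable (fun z : Vel d => ‖z‖) (gauss d) :=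
    (memLp_id_gauss.integrable (by norm_num)).norm
  set C := ∫ z : Vel d, ‖z‖ ∂(gauss d) with hC
  have hb1 : ∀ η ∈ Set.Ioo (0 : ℝ) 1, ∀ v z : Vel d,
      |(g (Real.sqrt (1 - η ^ 2) • v + η • z) - g v) / η| ≤ L * (‖v‖ + ‖z‖) := by
    intro η hη v z
    rw [abs_div, abs_of_pos hη.1, div_le_iff₀ hη.1]
    have := hL.dist_le_mul (Real.sqrt (1 - η ^ 2) • v + η • z) v
    rw [dist_eq_norm, dist_eq_norm, Real.norm_eq_abs] at this
    refine this.trans ?_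
    have := norm_ouStep_sub_le (d := d) ⟨hη.1.le, hη.2.le⟩ v z
    calc (L : ℝ) * _ ≤ L * (η * (‖v‖ + ‖z‖)) := by gcongr
      _ = _ := by ring
  have hdom : ∀ v : Vel d, Integrable (fun z : Vel d => (L : ℝ) * (‖v‖ + ‖z‖)) (gauss d) :=
    fun v => ((integrable_const _).add hn).const_mul _
  have hform : ∀ η ∈ Set.Ioo (0 : ℝ) 1, ∀ v : Vel d,
      ∫ z, (g (Real.sqrt (1 - η ^ 2) • v + η • z) - g v) / η ∂(gauss d) =
        (ouOp (Real.sqrt (1 - η ^ 2)) g v - g v) / η := by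
    intro η hη v
    rw [integral_div, integral_sub (H.integrable (by fun_prop)) (integrable_const _), ouOp,
      sqrt_one_sub_sqrt ⟨hη.1.le, hη.2.le⟩]
    simp
  have hb2 : ∀ η ∈ Set.Ioo (0 : ℝ) 1, ∀ v : Vel d,
      |(ouOp (Real.sqrt (1 - η ^ 2)) g v - g v) / η| ≤ L * (‖v‖ + C) := by
    intro η hη v
    rw [← hform η hη v, ← Real.norm_eq_abs]
    refine (norm_integral_le_of_norm_le (hdom v) (ae_of_all _ fun z => hb1 η hη v z)).trans ?_
    rw [integral_const_mul, integral_add (integrable_const _) hn]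
    simp [hC]
  have hpt : ∀ᵐ v ∂(gauss d), Tendsto
      (fun η => (ouOp (Real.sqrt (1 - η ^ 2)) g v - g v) / η) (𝓝[>] 0) (𝓝 0) := by
    filter_upwards [ae_differentiableAt_gauss hL] with v hv
    have h1 : Tendsto (fun η => ∫ z, (g (Real.sqrt (1 - η ^ 2) • v + η • z) - g v) / η ∂(gauss d))
        (𝓝[>] 0) (𝓝 (∫ z, fderiv ℝ g v z ∂(gauss d))) := by
      refine tendsto_integral_filter_of_dominated_convergence _
        (Eventually.of_forall fun η => Measurable.aestronglyMeasurable (by fun_prop)) ?_ (hdom v) ?_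
      · filter_upwards [hev] with η hη
        exact ae_of_all _ fun z => hb1 η hη v z
      · refine ae_of_all _ fun z => ?_
        have hx : Real.sqrt (1 - (0 : ℝ) ^ 2) • v + (0 : ℝ) • z = v := by simp
        have hu : HasDerivAt (fun η : ℝ => g (Real.sqrt (1 - η ^ 2) • v + η • z))
            (fderiv ℝ g v z) 0 := by
          have hv' : HasFDerivAt g (fderiv ℝ g v)
            (Real.sqrt (1 - (0 : ℝ) ^ 2) • v + (0 : ℝ) • z) := by rw [hx]; exact hv.hasFDerivAt
          exact hv'.comp_hasDerivAt 0 (hasDerivAt_ouStep v z)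
        rw [hasDerivAt_iff_tendsto_slope] at hu
        refine (hu.mono_left (nhdsWithin_mono 0 (s := Set.Ioi 0) (t := {0}ᶜ)
          (fun x hx => ne_of_gt hx))).congr fun η => ?_
        rw [slope_def_field, hx, sub_zero]
    have h2 : ∫ z, fderiv ℝ g v z ∂(gauss d) = 0 := by
      rw [gauss_eq_stdGaussian]; exact integral_strongDual_stdGaussian _
    rw [h2] at h1
    refine h1.congr' ?_
    filter_upwards [hev] with η hη
    exact hform η hη v
  have hfin : Tendsto (fun η => ∫ v, ((ouOp (Real.sqrt (1 - η ^ 2)) g v - g v) / η) ^ 2 ∂(gauss d))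
      (𝓝[>] 0) (𝓝 (∫ v : Vel d, (0 : ℝ) ∂(gauss d))) := by
    refine tendsto_integral_filter_of_dominated_convergence (fun v => ((L : ℝ) * (‖v‖ + C)) ^ 2)
      (Eventually.of_forall fun η => Measurable.aestronglyMeasurable ?_) ?_ ?_ ?_
    · have := (H.ouOp (Real.sqrt (1 - η ^ 2))).measurable
      fun_prop
    · filter_upwards [hev] with η hη
      refine ae_of_all _ fun v => ?_
      rw [Real.norm_eq_abs, abs_pow]
      gcongr
      exact hb2 η hη v
    · have : Integrable (fun v : Vel d => (L : ℝ) ^ 2 * (‖v‖ ^ 2 + 2 * C * ‖v‖ + C ^ 2)) (gauss d) :=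
        ((integrable_norm_sq_gauss.add (hn.const_mul _)).add (integrable_const _)).const_mul _
      refine this.congr (ae_of_all _ fun v => ?_)
      ring
    · filter_upwards [hpt] with v hv
      simpa using hv.pow 2
  rw [integral_zero] at hfin
  refine hfin.congr' ?_
  filter_upwards [hev] with η hη
  rw [← integral_div]
  refine integral_congr_ae (ae_of_all _ fun v => ?_)
  beta_reduce
  rw [div_pow, sub_sq_comm]

/-- The entropy production along the coupled collisions. -/
def coupProd (b : ℝ → ℝ) (η : ℝ) (g : Vel d → ℝ) : ℝ :=
  ∫ q : (Vel d × Vel d × Sph d) × Vel d, prodDens (g (vPrime q.1.1 q.1.2.1 q.1.2.2))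
    (g (rotPrime q.1.1 (Real.sqrt (1 - η ^ 2) • q.1.1 + η • q.2) q.1.2.1 q.1.2.2))
    ∂((collJoint d b).prod (gauss d))

theorem measurable_rotStep (η : ℝ) : Measurable fun q : (Vel d × Vel d × Sph d) × Vel d =>
    rotPrime q.1.1 (Real.sqrt (1 - η ^ 2) • q.1.1 + η • q.2) q.1.2.1 q.1.2.2 := by
  have := measurable_rotPrime.comp (by fun_prop :
    Measurable fun q : (Vel d × Vel d × Sph d) × Vel d =>
      (q.1.1, Real.sqrt (1 - η ^ 2) • q.1.1 + η • q.2, q.1.2.1, (q.1.2.2 : Vel d)))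
  exact this

theorem measurable_prodDens : Measurable (Function.uncurry prodDens) := by
  unfold prodDens Function.uncurry; fun_prop

theorem prodDens_bound {x y : ℝ} (H : IsPinched δ N g) (hx : ∃ v, g v = x) (hy : ∃ v, g v = y) :
    |prodDens x y| ≤ δ⁻¹ * (2 * N) ^ 2 := by
  obtain ⟨v, rfl⟩ := hx
  obtain ⟨w, rfl⟩ := hy
  refine (prodDens_le H.pos (H.ge v) (H.ge w)).trans ?_
  have := H.pos
  rw [← sq_abs]
  gcongr
  have h1 := H.abs_le v
  have h2 := H.abs_le w
  calc |g v - g w| ≤ |g v| + |g w| := abs_sub _ _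
    _ ≤ _ := by linarith

/-- Jensen's inequality for the jointly convex `prodDens`, applied on the coupled space: the
supporting plane of `prodDens_ge` at the two means is integrated. -/
theorem prodDens_gainK_le (hd : 1 ≤ d) (hb : IsAngularKernel d b) (H : IsPinched δ N g)
    (x y : Vel d) :
    prodDens (gainK b g x) (gainK b g y) ≤
      ∫ p, prodDens (g (vPrime x p.1 p.2)) (g (rotPrime x y p.1 p.2)) ∂(collKer d b x) := by
  have := isMarkovKernel_collKer hd hb
  have hm := H.measurable
  have hvm : Measurable fun p : Vel d × Sph d => vPrime x p.1 p.2 := by unfold vPrime; fun_prop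
  have hrm : Measurable fun p : Vel d × Sph d => rotPrime x y p.1 p.2 := by
    have := measurable_rotPrime.comp
      (by fun_prop : Measurable fun p : Vel d × Sph d => (x, y, p.1, (p.2 : Vel d)))
    exact this
  have hpm := measurable_prodDens
  set x₀ := gainK b g x with hx₀
  set y₀ := gainK b g y with hy₀
  have hxp : 0 < x₀ := (H.gainK hd hb).pos.trans_le ((H.gainK hd hb).ge x)
  have hyp : 0 < y₀ := (H.gainK hd hb).pos.trans_le ((H.gainK hd hb).ge y)
  set A := Real.log x₀ - Real.log y₀ + 1 - y₀ / x₀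
  set B := Real.log y₀ - Real.log x₀ + 1 - x₀ / y₀
  have i1 := H.integrable (μ := collKer d b x) hvm
  have i2 := H.integrable (μ := collKer d b x) hrm
  have e : ∫ p, (A * g (vPrime x p.1 p.2) + B * g (rotPrime x y p.1 p.2)) ∂(collKer d b x) =
      prodDens x₀ y₀ := by
    rw [integral_add (i1.const_mul _) (i2.const_mul _), integral_const_mul, integral_const_mul,
      ← gainK_eq_integral_rotPrime hd hb H]
    change A * x₀ + B * y₀ = _
    simp only [A, B, prodDens]
    field_simp
    ring
  rw [← e]
  refine integral_mono ((i1.const_mul _).add (i2.const_mul _)) ?_ fun p => ?_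
  · refine Integrable.of_bound (C := δ⁻¹ * (2 * N) ^ 2) (Measurable.aestronglyMeasurable ?_)
      (ae_of_all _ fun p => prodDens_bound H ⟨_, rfl⟩ ⟨_, rfl⟩)
    exact hpm.comp ((hm.comp hvm).prodMk (hm.comp hrm))
  · exact prodDens_ge (H.pos.trans_le (H.ge _)) (H.pos.trans_le (H.ge _)) hxp hyp

theorem ouProd_gainK_le (hd : 1 ≤ d) (hb : IsAngularKernel d b) (H : IsPinched δ N g) {η : ℝ}
    (hη : η ∈ Set.Icc (0 : ℝ) 1) :
    ouProd (Real.sqrt (1 - η ^ 2)) (gainK b g) ≤ coupProd b η g := by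
  have := isMarkovKernel_collKer hd hb
  have := isProbabilityMeasure_collJoint hd hb
  have hm := H.measurable
  have hpm := measurable_prodDens
  have K := H.gainK hd hb
  have hKm := K.measurable
  set a := Real.sqrt (1 - η ^ 2) with ha
  have hF : Measurable fun q : (Vel d × Vel d × Sph d) × Vel d =>
      prodDens (g (vPrime q.1.1 q.1.2.1 q.1.2.2))
        (g (rotPrime q.1.1 (a • q.1.1 + η • q.2) q.1.2.1 q.1.2.2)) :=
    hpm.comp ((hm.comp (measurable_vPrime.comp measurable_fst)).prodMk
      (hm.comp (measurable_rotStep η)))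
  have hFi : Integrable (fun q : (Vel d × Vel d × Sph d) × Vel d =>
      prodDens (g (vPrime q.1.1 q.1.2.1 q.1.2.2))
        (g (rotPrime q.1.1 (a • q.1.1 + η • q.2) q.1.2.1 q.1.2.2)))
      ((collJoint d b).prod (gauss d)) :=
    Integrable.of_bound (C := δ⁻¹ * (2 * N) ^ 2) hF.aestronglyMeasurable
      (ae_of_all _ fun p => prodDens_bound H ⟨_, rfl⟩ ⟨_, rfl⟩)
  have e : coupProd b η g = ∫ x, ∫ z, ∫ p, prodDens (g (vPrime x p.1 p.2))
      (g (rotPrime x (a • x + η • z) p.1 p.2)) ∂(collKer d b x) ∂(gauss d) ∂(gauss d) := by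
    rw [coupProd, integral_prod _ hFi, collJoint, Measure.integral_compProd]
    · refine integral_congr_ae (ae_of_all _ fun x => ?_)
      beta_reduce
      rw [integral_integral_swap]
      refine Integrable.of_bound (C := δ⁻¹ * (2 * N) ^ 2) (Measurable.aestronglyMeasurable ?_)
        (ae_of_all _ fun p => prodDens_bound H ⟨_, rfl⟩ ⟨_, rfl⟩)
      have := hF.comp (by fun_prop : Measurable fun q : (Vel d × Sph d) × Vel d => ((x, q.1), q.2))
      exact this
    · exact hFi.integral_prod_left
  have hF2 : Measurable fun q : (Vel d × Vel d) × (Vel d × Sph d) =>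
      prodDens (g (vPrime q.1.1 q.2.1 q.2.2))
        (g (rotPrime q.1.1 (a • q.1.1 + η • q.1.2) q.2.1 q.2.2)) := by
    have := hF.comp (by fun_prop : Measurable fun q : (Vel d × Vel d) × (Vel d × Sph d) =>
      ((q.1.1, q.2), q.1.2))
    exact this
  have hF3 : StronglyMeasurable fun q : Vel d × Vel d =>
      ∫ p, prodDens (g (vPrime q.1 p.1 p.2)) (g (rotPrime q.1 (a • q.1 + η • q.2) p.1 p.2))
        ∂(collKer d b q.1) := by
    have := hF2.stronglyMeasurable.integral_kernel_prod_right'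
      (κ := (collKer d b).comap (Prod.fst : Vel d × Vel d → Vel d) measurable_fst)
    exact this
  have hbd : ∀ q : Vel d × Vel d, ‖∫ p, prodDens (g (vPrime q.1 p.1 p.2))
      (g (rotPrime q.1 (a • q.1 + η • q.2) p.1 p.2)) ∂(collKer d b q.1)‖ ≤ δ⁻¹ * (2 * N) ^ 2 := by
    intro q
    have := norm_integral_le_of_norm_le_const (μ := collKer d b q.1)
      (f := fun p : Vel d × Sph d => prodDens (g (vPrime q.1 p.1 p.2))
      (g (rotPrime q.1 (a • q.1 + η • q.2) p.1 p.2)))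
      (ae_of_all _ fun p => prodDens_bound H ⟨_, rfl⟩ ⟨_, rfl⟩)
    simpa using this
  have hGi := Integrable.of_bound (μ := (gauss d).prod (gauss d)) hF3.aestronglyMeasurable
    (C := δ⁻¹ * (2 * N) ^ 2) (ae_of_all _ hbd)
  rw [e, ← integral_prod (f := fun q : Vel d × Vel d => ∫ p, prodDens (g (vPrime q.1 p.1 p.2))
      (g (rotPrime q.1 (a • q.1 + η • q.2) p.1 p.2)) ∂(collKer d b q.1)) hGi, ouProd,
    sqrt_one_sub_sqrt hη]
  refine integral_mono ?_ hGi fun q => prodDens_gainK_le hd hb H _ _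
  refine Integrable.of_bound (C := δ⁻¹ * (2 * N) ^ 2) (Measurable.aestronglyMeasurable ?_)
        (ae_of_all _ fun p => prodDens_bound K ⟨_, rfl⟩ ⟨_, rfl⟩)
  have := hpm.comp (by fun_prop : Measurable fun q : Vel d × Vel d =>
    (gainK b g q.1, gainK b g (a • q.1 + η • q.2)))
  exact this

end Slope

end SmallSteps

/-! ### Contraction of Fisher information and of entropy for regular densities. -/

section EntropyContraction

open ProbabilityTheory Filter Topology

variable {d : ℕ} {b : ℝ → ℝ} {δ N : ℝ} {L : NNReal} {g : Vel d → ℝ}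

theorem ae_ne_collJoint (hd : 1 ≤ d) (hb : IsAngularKernel d b) :
    ∀ᵐ q ∂(collJoint d b), q.1 ≠ q.2.1 := by
  have := isMarkovKernel_collKer hd hb
  have hs : MeasurableSet {q : Vel d × Vel d × Sph d | q.1 ≠ q.2.1} :=
    (measurableSet_eq_fun (by fun_prop) (by fun_prop)).compl
  rw [collJoint, Measure.ae_compProd_iff hs]
  refine ae_of_all _ fun v => ?_
  rw [collKer_apply hb.measurable]
  have h1 : ∀ᵐ p ∂((gauss d).prod (sphMeasure d)), v ≠ p.1 :=
    Measure.quasiMeasurePreserving_fst.ae (ae_ne_gauss hd v)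
  exact (withDensity_absolutelyContinuous _ _).ae_le h1

/-- The limit of the coupled entropy production at small steps. -/
def coupLimit (b : ℝ → ℝ) (g : Vel d → ℝ) : ℝ :=
  ∫ q : (Vel d × Vel d × Sph d) × Vel d, ⟪gradient g (vPrime q.1.1 q.1.2.1 q.1.2.2),
    (1 / 2 : ℝ) • (q.2 + dRot (relDir q.1.1 q.1.2.1) q.1.2.2 q.2)⟫ ^ 2 /
      g (vPrime q.1.1 q.1.2.1 q.1.2.2) ∂((collJoint d b).prod (gauss d))

theorem ae_comp_fst {α : Type*} [MeasurableSpace α] {μ : Measure α} {p : α → Prop}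
    (h : ∀ᵐ x ∂μ, p x) : ∀ᵐ q : α × Vel d ∂(μ.prod (gauss d)), p q.1 :=
  Measure.quasiMeasurePreserving_fst.ae h

/-- Rademacher's theorem, transported by the fact that v' has the Gaussian law, hence avoids null
sets almost surely. -/
theorem ae_differentiableAt_vPrime (hd : 1 ≤ d) (hb : IsAngularKernel d b)
    (hL : LipschitzWith L g) :
    ∀ᵐ q ∂(collJoint d b), DifferentiableAt ℝ g (vPrime q.1 q.2.1 q.2.2) :=
  (measurePreserving_vPrime hd hb).quasiMeasurePreserving.ae (ae_differentiableAt_gauss hL)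

theorem rotPrime_self (v w : Vel d) (σ : Sph d) : rotPrime v v w σ = vPrime v w σ := by
  have h := norm_rotPrime_sub_le v v w σ
  rw [sub_self, norm_zero, mul_zero] at h
  exact sub_eq_zero.1 (norm_le_zero_iff.1 h)

theorem ae_hasDerivAt_rotStep (hd : 1 ≤ d) (hb : IsAngularKernel d b) :
    ∀ᵐ q : (Vel d × Vel d × Sph d) × Vel d ∂((collJoint d b).prod (gauss d)),
      HasDerivAt (fun η : ℝ =>
        rotPrime q.1.1 (Real.sqrt (1 - η ^ 2) • q.1.1 + η • q.2) q.1.2.1 q.1.2.2)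
        ((1 / 2 : ℝ) • (q.2 + dRot (relDir q.1.1 q.1.2.1) q.1.2.2 q.2)) 0 := by
  have h := ae_comp_fst (d := d) (ae_ne_collJoint hd hb)
  filter_upwards [h] with q hq
  exact hasDerivAt_rotPrime hq q.2 (q.1.2.2 : Vel d)

theorem norm_rotStep_sub_le {η : ℝ} (hη : η ∈ Set.Icc (0 : ℝ) 1) (v z w : Vel d) (σ : Sph d) :
    ‖rotPrime v (Real.sqrt (1 - η ^ 2) • v + η • z) w σ - vPrime v w σ‖ ≤
      η * (10 * (‖v‖ + ‖z‖)) := by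
  refine (norm_rotPrime_sub_le _ _ _ _).trans ?_
  have := norm_ouStep_sub_le hη v z
  linarith

theorem integrable_rotStep_bound (hd : 1 ≤ d) (hb : IsAngularKernel d b) :
    Integrable (fun q : (Vel d × Vel d × Sph d) × Vel d => (10 * (‖q.1.1‖ + ‖q.2‖)) ^ 2)
      ((collJoint d b).prod (gauss d)) := by
  have := isProbabilityMeasure_collJoint hd hb
  have h := integrable_sq_add_norm (measurePreserving_fst_collJoint hd hb)
  refine (h.const_mul (10 ^ 2)).congr (ae_of_all _ fun q => ?_)
  exact (mul_pow _ _ _).symm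

theorem tendsto_coupProd (hd : 1 ≤ d) (hb : IsAngularKernel d b) (H : IsPinched δ N g)
    (hL : LipschitzWith L g) :
    Tendsto (fun η => coupProd b η g / η ^ 2) (𝓝[>] 0) (𝓝 (coupLimit b g)) := by
  have := isProbabilityMeasure_collJoint hd hb
  have hdiff := ae_comp_fst (d := d) (ae_differentiableAt_vPrime hd hb hL)
  have hΓ0 : ∀ q : (Vel d × Vel d × Sph d) × Vel d,
      rotPrime q.1.1 (Real.sqrt (1 - (0 : ℝ) ^ 2) • q.1.1 + (0 : ℝ) • q.2) q.1.2.1 q.1.2.2 =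
        vPrime q.1.1 q.1.2.1 q.1.2.2 := by
    intro q
    have e : Real.sqrt (1 - (0 : ℝ) ^ 2) • q.1.1 + (0 : ℝ) • q.2 = q.1.1 := by simp
    rw [e, rotPrime_self]
  unfold coupProd coupLimit
  exact tendsto_integral_prodDens H hL measurable_rotStep hΓ0 (ae_hasDerivAt_rotStep hd hb) hdiff
    (fun η hη q => norm_rotStep_sub_le hη q.1.1 q.2 q.1.2.1 q.1.2.2)
    (integrable_rotStep_bound hd hb)

theorem inner_half_add_dRot (x k σ z : Vel d) :
    ⟪x, (1 / 2 : ℝ) • (z + dRot k σ z)⟫ =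
      ⟪(1 / 2 : ℝ) • (x + (⟪k, σ⟫ • x - ⟪k, x⟫ • σ + ⟪σ, x⟫ • k)), z⟫ := by
  rw [real_inner_smul_right, real_inner_smul_left, inner_add_dRot]

/-- Integrating out the Gaussian direction leaves the squared norm of the transposed derivative
applied to ∇g(v'), at most (1 + cos θ)/2 times |∇g(v')|² by `norm_add_dRot_le`. -/
theorem coupLimit_le (hd : 1 ≤ d) (hb : IsAngularKernel d b) (H : IsPinched δ N g)
    (hL : LipschitzWith L g) : coupLimit b g ≤ 1 / 2 * fisher g := by
  have := isProbabilityMeasure_collJoint hd hb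
  have hm := H.measurable
  have hgm := measurable_gradient g
  have hvm := measurable_vPrime (d := d)
  have hc := measurable_cosTheta (d := d)
  set ζ : Vel d × Vel d × Sph d → Vel d := fun q =>
    (1 / 2 : ℝ) • (gradient g (vPrime q.1 q.2.1 q.2.2) +
      (⟪relDir q.1 q.2.1, (q.2.2 : Vel d)⟫ • gradient g (vPrime q.1 q.2.1 q.2.2) -
      ⟪relDir q.1 q.2.1, gradient g (vPrime q.1 q.2.1 q.2.2)⟫ • (q.2.2 : Vel d) +
      ⟪(q.2.2 : Vel d), gradient g (vPrime q.1 q.2.1 q.2.2)⟫ • relDir q.1 q.2.1)) with hζ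
  have hgv : Measurable fun q : Vel d × Vel d × Sph d => gradient g (vPrime q.1 q.2.1 q.2.2) :=
    hgm.comp hvm
  have hmv : Measurable fun q : Vel d × Vel d × Sph d => g (vPrime q.1 q.2.1 q.2.2) :=
    hm.comp hvm
  have hrm : Measurable fun q : Vel d × Vel d × Sph d => relDir q.1 q.2.1 := by
    unfold relDir; fun_prop
  have hsm : Measurable fun q : Vel d × Vel d × Sph d => (q.2.2 : Vel d) := by fun_prop
  have hζm : Measurable ζ := by
    have h1 := hrm.inner (𝕜 := ℝ) hsm
    have h2 := hrm.inner (𝕜 := ℝ) hgv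
    have h3 := hsm.inner (𝕜 := ℝ) hgv
    exact (hgv.add (((h1.smul hgv).sub (h2.smul hsm)).add (h3.smul hrm))).const_smul (1 / 2 : ℝ)
  set ψ : Vel d → ℝ := fun v => ‖gradient g v‖ ^ 2 / g v with hψ
  have hψm : Measurable ψ := by fun_prop
  have hψ0 : ∀ v, 0 ≤ ψ v := fun v => div_nonneg (sq_nonneg _) (H.pos.le.trans (H.ge v))
  have hψb : ∀ v, ψ v ≤ δ⁻¹ * (L : ℝ) ^ 2 := by
    intro v
    have h1 := H.ge v
    have h2 := H.pos
    have h3 := norm_gradient_le hL v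
    simp only [hψ]
    rw [div_eq_inv_mul]
    gcongr
  have hζb : ∀ᵐ q ∂(collJoint d b), ‖ζ q‖ ^ 2 / g (vPrime q.1 q.2.1 q.2.2) ≤
      1 / 2 * (ψ (vPrime q.1 q.2.1 q.2.2) +
        ψ (vPrime q.1 q.2.1 q.2.2) * cosTheta q.1 q.2.1 q.2.2) := by
    filter_upwards [ae_ne_collJoint hd hb] with q hq
    have h := norm_add_dRot_le (norm_relDir hq) (σ := (q.2.2 : Vel d)) (by simp)
      (gradient g (vPrime q.1 q.2.1 q.2.2))
    have e : cosTheta q.1 q.2.1 q.2.2 = ⟪relDir q.1 q.2.1, (q.2.2 : Vel d)⟫ := rfl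
    have hp := H.pos.trans_le (H.ge (vPrime q.1 q.2.1 q.2.2))
    simp only [hψ, hζ]
    rw [e, div_le_iff₀ hp, norm_smul, mul_pow]
    have e2 : ∀ G c n : ℝ, 0 < n → 1 / 2 * (G / n + G / n * c) * n = 1 / 4 * (2 * (1 + c) * G) := by
      intro G c n hn
      field_simp
      ring
    rw [e2 _ _ _ hp]
    have e3 : ‖(1 / 2 : ℝ)‖ ^ 2 = 1 / 4 := by norm_num
    rw [e3]
    gcongr
  have hζC : ∀ᵐ q ∂(collJoint d b), ‖ζ q‖ ≤ Real.sqrt (N * (δ⁻¹ * (L : ℝ) ^ 2)) := by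
    filter_upwards [hζb] with q hq
    refine Real.le_sqrt_of_sq_le ?_
    have hp := H.pos.trans_le (H.ge (vPrime q.1 q.2.1 q.2.2))
    rw [div_le_iff₀ hp] at hq
    have h1 := hψb (vPrime q.1 q.2.1 q.2.2)
    have h2 := hψ0 (vPrime q.1 q.2.1 q.2.2)
    have h3 := (cosTheta_mem q.1 q.2.1 q.2.2).2
    have h4 := H.le (vPrime q.1 q.2.1 q.2.2)
    refine hq.trans ?_
    rw [mul_comm]
    refine mul_le_mul h4 ?_ ?_ (hp.le.trans h4)
    · nlinarith
    · nlinarith [(cosTheta_mem q.1 q.2.1 q.2.2).1]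
  have hint : Integrable (fun q : (Vel d × Vel d × Sph d) × Vel d =>
      ⟪ζ q.1, q.2⟫ ^ 2 / g (vPrime q.1.1 q.1.2.1 q.1.2.2)) ((collJoint d b).prod (gauss d)) := by
    have h1 := integrable_inner_sq hζm hζC
    refine (h1.const_mul δ⁻¹).mono' (Measurable.aestronglyMeasurable ?_) (ae_of_all _ fun q => ?_)
    · have a1 := (hζm.comp measurable_fst).inner (𝕜 := ℝ)
        (measurable_snd (α := Vel d × Vel d × Sph d) (β := Vel d))
      exact (a1.pow_const 2).div (hmv.comp measurable_fst)
    · have h2 := H.ge (vPrime q.1.1 q.1.2.1 q.1.2.2)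
      have h3 := H.pos
      rw [Real.norm_eq_abs, abs_of_nonneg (div_nonneg (sq_nonneg _) (h3.le.trans h2)),
        div_eq_inv_mul]
      gcongr
  have e1 : coupLimit b g = ∫ q, ‖ζ q‖ ^ 2 / g (vPrime q.1 q.2.1 q.2.2) ∂(collJoint d b) := by
    have : coupLimit b g = ∫ q : (Vel d × Vel d × Sph d) × Vel d,
        ⟪ζ q.1, q.2⟫ ^ 2 / g (vPrime q.1.1 q.1.2.1 q.1.2.2) ∂((collJoint d b).prod (gauss d)) := by
      unfold coupLimit
      refine integral_congr_ae (ae_of_all _ fun q => ?_)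
      beta_reduce
      rw [inner_half_add_dRot]
    rw [this, integral_prod _ hint]
    refine integral_congr_ae (ae_of_all _ fun q => ?_)
    change ∫ z, ⟪ζ q, z⟫ ^ 2 / g (vPrime q.1 q.2.1 q.2.2) ∂(gauss d) = _
    rw [integral_div, integral_inner_sq_gauss]
  have i1 : Integrable (fun q : Vel d × Vel d × Sph d => ψ (vPrime q.1 q.2.1 q.2.2))
      (collJoint d b) :=
    Integrable.of_bound (hψm.comp hvm).aestronglyMeasurable (δ⁻¹ * (L : ℝ) ^ 2)
      (ae_of_all _ fun q => by rw [Real.norm_eq_abs, abs_of_nonneg (hψ0 _)]; exact hψb _)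
  have i2 : Integrable (fun q : Vel d × Vel d × Sph d => ψ (vPrime q.1 q.2.1 q.2.2) *
      cosTheta q.1 q.2.1 q.2.2) (collJoint d b) := by
    refine i1.mono ((hψm.comp hvm).mul hc).aestronglyMeasurable (ae_of_all _ fun q => ?_)
    rw [norm_mul]
    exact mul_le_of_le_one_right (norm_nonneg _) (abs_cosTheta_le _ _ _)
  have e2 : ∫ q, ψ (vPrime q.1 q.2.1 q.2.2) ∂(collJoint d b) = fisher g := by
    have := (measurePreserving_vPrime hd hb).map_eq
    rw [fisher, ← this, integral_map hvm.aemeasurable]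
    rw [this]
    exact hψm.aestronglyMeasurable
  -- Reversibility moves the weight from v' to v without changing cos θ; given v, the cosine is
  -- centred.
  have e3 : ∫ q, ψ (vPrime q.1 q.2.1 q.2.2) * cosTheta q.1 q.2.1 q.2.2 ∂(collJoint d b) = 0 := by
    rw [← integral_mul_cosTheta hb hψm]
    have hF : Measurable fun x : Vel d × Vel d × Vel d × Vel d × ℝ => ψ x.1 * x.2.2.2.2 := by
      fun_prop
    exact (integral_collJoint_swap hd hb.measurable hF).symm
  rw [e1]
  calc _ ≤ ∫ q, 1 / 2 * (ψ (vPrime q.1 q.2.1 q.2.2) +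
        ψ (vPrime q.1 q.2.1 q.2.2) * cosTheta q.1 q.2.1 q.2.2) ∂(collJoint d b) := by
        refine integral_mono_of_nonneg (ae_of_all _ fun q => ?_) ((i1.add i2).const_mul _) hζb
        exact div_nonneg (sq_nonneg _) (H.pos.le.trans (H.ge _))
    _ = _ := by
        rw [integral_const_mul, integral_add i1 i2, e2, e3, add_zero]

/-- The infinitesimal form of the contraction: at order η² the left side is at most half of
`coupLimit` minus a quarter of `fisher`, which is nonpositive by `coupLimit_le`. -/
theorem eventually_gEnt_gainK_sub_le (hd : 1 ≤ d) (hb : IsAngularKernel d b)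
    (H : IsPinched δ N g) (hL : LipschitzWith L g) {r : ℝ} (hr : 0 < r) :
    ∀ᶠ η in 𝓝[>] (0 : ℝ), gEnt (gainK b g) - gEnt (ouOp (Real.sqrt (1 - η ^ 2)) (gainK b g)) -
      1 / 2 * (gEnt g - gEnt (ouOp (Real.sqrt (1 - η ^ 2)) g)) < r * η ^ 2 := by
  have h1 := ((tendsto_coupProd hd hb H hL).const_mul (1 / 2)).sub
    ((tendsto_ouProd H hL).const_mul (1 / 4))
  have h2 := h1.add ((tendsto_sq_sub_ouOp H hL).const_mul (1 / 2 * δ⁻¹))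
  have h3 := coupLimit_le hd hb H hL
  have h4 : 1 / 2 * coupLimit b g - 1 / 4 * fisher g + 1 / 2 * δ⁻¹ * 0 < r := by linarith
  have hev : ∀ᶠ η : ℝ in 𝓝[>] 0, η ∈ Set.Ioo (0 : ℝ) 1 := Ioo_mem_nhdsGT one_pos
  filter_upwards [h2.eventually_lt_const h4, hev] with η hη hη1
  have hη2 : 0 < η ^ 2 := pow_pos hη1.1 2
  have a1 := gEnt_sub_le (sqrt_one_sub_mem η) (H.gainK hd hb)
  have a2 := ouProd_gainK_le hd hb H ⟨hη1.1.le, hη1.2.le⟩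
  have a3 := le_gEnt_sub (sqrt_one_sub_mem η) H
  have e : (1 / 2 * (coupProd b η g / η ^ 2) - 1 / 4 * (ouProd (Real.sqrt (1 - η ^ 2)) g / η ^ 2) +
    1 / 2 * δ⁻¹ * ((∫ v, (g v - ouOp (Real.sqrt (1 - η ^ 2)) g v) ^ 2 ∂(gauss d)) / η ^ 2)) =
    (1 / 2 * coupProd b η g - 1 / 4 * ouProd (Real.sqrt (1 - η ^ 2)) g +
    1 / 2 * δ⁻¹ * ∫ v, (g v - ouOp (Real.sqrt (1 - η ^ 2)) g v) ^ 2 ∂(gauss d)) / η ^ 2 := by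
    ring
  rw [e, div_lt_iff₀ hη2] at hη
  linarith

/-- Keeps the small-step estimate available at every time of the flow. -/
theorem lipschitzWith_ouOp (H : IsPinched δ N g) (hL : LipschitzWith L g) {a : ℝ}
    (ha : a ∈ Set.Icc (0 : ℝ) 1) : LipschitzWith L (ouOp a g) := by
  refine LipschitzWith.of_dist_le_mul fun v w => ?_
  have i : ∀ v : Vel d, Integrable (fun z => g (a • v + Real.sqrt (1 - a ^ 2) • z)) (gauss d) :=
    fun v => H.integrable (by fun_prop)
  rw [Real.dist_eq, ouOp, ouOp, ← integral_sub (i v) (i w), ← Real.norm_eq_abs]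
  refine (norm_integral_le_of_norm_le_const (C := L * dist v w) (ae_of_all _ fun z => ?_)).trans
    (by simp)
  refine (hL.dist_le_mul _ _).trans ?_
  gcongr
  rw [dist_add_right, dist_smul₀, Real.norm_eq_abs, abs_of_nonneg ha.1]
  exact mul_le_of_le_one_left dist_nonneg ha.2

theorem continuous_ouOp_left (H : IsPinched δ N g) (hg : Continuous g) (v : Vel d) :
    Continuous fun a => ouOp a g v := by
  refine continuous_of_dominated (bound := fun _ => N)
    (fun a => (H.measurable.comp (by fun_prop)).aestronglyMeasurable)
    (fun a => ae_of_all _ fun z => H.abs_le _) (integrable_const _) (ae_of_all _ fun z => ?_)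
  fun_prop

theorem continuous_gEnt {h : ℝ → Vel d → ℝ} (H : ∀ a, IsPinched δ N (h a))
    (hc : ∀ v, Continuous fun a => h a v) : Continuous fun a => gEnt (h a) := by
  have hδ := (H 0).pos
  refine continuous_of_dominated (bound := fun _ => N * (|Real.log δ| + |Real.log N|))
    (fun a => ?_) (fun a => ae_of_all _ fun v => ?_) (integrable_const _)
    (ae_of_all _ fun v => ?_)
  · have := (H a).measurable
    exact Measurable.aestronglyMeasurable (by fun_prop)
  · rw [norm_mul]
    have h1 := (H a).abs_le v
    have h2 := log_le_of_pinch hδ ((H a).ge v) ((H a).le v)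
    exact mul_le_mul h1 h2 (norm_nonneg _) ((abs_nonneg _).trans h1)
  · exact (hc v).mul ((hc v).log fun a => (hδ.trans_le ((H a).ge v)).ne')

theorem continuous_gainK_ouOp (hd : 1 ≤ d) (hb : IsAngularKernel d b) (H : IsPinched δ N g)
    (hg : Continuous g) (v : Vel d) : Continuous fun a => gainK b (ouOp a g) v := by
  have := isMarkovKernel_collKer hd hb
  refine continuous_of_dominated (bound := fun _ => N)
    (fun a => ?_)
    (fun a => ae_of_all _ fun z => (H.ouOp a).abs_le _) (integrable_const _)
    (ae_of_all _ fun z => continuous_ouOp_left H hg _)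
  have hvm : Measurable fun p : Vel d × Sph d => vPrime v p.1 p.2 := by unfold vPrime; fun_prop
  exact ((H.ouOp a).measurable.comp hvm).aestronglyMeasurable

theorem gEnt_gainK_le (hd : 1 ≤ d) (hb : IsAngularKernel d b) (H : IsPinched δ N g)
    (hL : LipschitzWith L g) :
    gEnt (gainK b g) ≤ 1 / 2 * gEnt g +
      1 / 2 * ((∫ v, g v ∂(gauss d)) * Real.log (∫ v, g v ∂(gauss d))) := by
  have := isMarkovKernel_collKer hd hb
  set Φ : ℝ → ℝ := fun a => 1 / 2 * gEnt (ouOp a g) - gEnt (gainK b (ouOp a g)) with hΦ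
  have hΦc : Continuous Φ :=
    ((continuous_gEnt (fun a => H.ouOp a) (continuous_ouOp_left H hL.continuous)).const_mul _).sub
      (continuous_gEnt (fun a => (H.ouOp a).gainK hd hb)
        (continuous_gainK_ouOp hd hb H hL.continuous))
  have hexp : ∀ t : ℝ, 0 ≤ t → Real.exp (-t) ∈ Set.Icc (0 : ℝ) 1 := fun t ht =>
    ⟨(Real.exp_pos _).le, Real.exp_le_one_iff.2 (by linarith)⟩
  have hmono : ∀ T : ℝ, 0 ≤ T → Φ (Real.exp (-T)) ≤ Φ 1 := by
    intro T hT
    -- A continuous function with nonpositive lower right slopes stays below its initial value;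
    -- differentiability of the entropies along the flow is not needed.
    have key := image_le_of_liminf_slope_right_le_deriv_boundary (f := fun t => Φ (Real.exp (-t)))
      (a := 0) (b := T) (B := fun _ => Φ 1) (B' := fun _ => 0)
      (by fun_prop) (by simp) continuousOn_const
      (fun x _ => hasDerivWithinAt_const _ _ _) ?_
    · exact key ⟨hT, le_rfl⟩
    intro t ht r hr
    have G := H.ouOp (Real.exp (-t))
    have hGL := lipschitzWith_ouOp H hL (hexp t ht.1)
    -- Half of r, because the step from t to z has η² = 1 - exp(-2(z - t)) ≤ 2(z - t).
    have hev := eventually_gEnt_gainK_sub_le hd hb G hGL (r := r / 2) (by linarith)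
    have htend : Tendsto (fun z : ℝ => Real.sqrt (1 - Real.exp (-(z - t)) ^ 2)) (𝓝[>] t)
        (𝓝[>] 0) := by
      refine tendsto_nhdsWithin_iff.2 ⟨?_, ?_⟩
      · have : Continuous fun z : ℝ => Real.sqrt (1 - Real.exp (-(z - t)) ^ 2) := by fun_prop
        have h := this.tendsto t
        simp only [sub_self, neg_zero, Real.exp_zero, one_pow, Real.sqrt_zero] at h
        exact h.mono_left nhdsWithin_le_nhds
      · filter_upwards [self_mem_nhdsWithin] with z hz
        refine Real.sqrt_pos.2 ?_
        have h1 : Real.exp (-(z - t)) < 1 := Real.exp_lt_one_iff.2 (by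
          have : t < z := hz
          linarith)
        have h2 := Real.exp_pos (-(z - t))
        nlinarith
    refine Eventually.frequently ?_
    filter_upwards [htend.eventually hev, self_mem_nhdsWithin] with z hz hzt
    have hzt' : 0 < z - t := sub_pos.2 hzt
    have hs := hexp (z - t) hzt'.le
    have hs1 : 0 ≤ 1 - Real.exp (-(z - t)) ^ 2 := by nlinarith [hs.1, hs.2]
    rw [Real.sq_sqrt hs1, sub_sub_cancel, Real.sqrt_sq hs.1] at hz
    have e1 : ouOp (Real.exp (-(z - t))) (ouOp (Real.exp (-t)) g) = ouOp (Real.exp (-z)) g := by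
      funext v
      rw [ouOp_ouOp hs (hexp t ht.1) H, ← Real.exp_add]
      congr 2
      ring
    have e2 : ouOp (Real.exp (-(z - t))) (gainK b (ouOp (Real.exp (-t)) g)) =
        gainK b (ouOp (Real.exp (-z)) g) := by
      funext v
      rw [← gainK_ouOp hd hb (Real.exp_pos _) hs.2 G.measurable G.abs_le, e1]
    rw [e1, e2] at hz
    rw [slope_def_field, div_lt_iff₀ hzt']
    have h5 : 1 - Real.exp (-(z - t)) ^ 2 ≤ 2 * (z - t) := by
      have := Real.add_one_le_exp (-(2 * (z - t)))
      have e : Real.exp (-(z - t)) ^ 2 = Real.exp (-(2 * (z - t))) := by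
        rw [← Real.exp_nat_mul]; congr 1; push_cast; ring
      rw [e]; linarith
    have h6 : r / 2 * (1 - Real.exp (-(z - t)) ^ 2) ≤ r / 2 * (2 * (z - t)) := by
      have hr' : (0 : ℝ) < r := hr
      gcongr
    simp only [hΦ]
    linarith
  -- Let time tend to infinity: at correlation 0 the flow has replaced g by its mean, a constant
  -- fixed by K.
  have hlim : Φ 0 ≤ Φ 1 := by
    have h0 : Tendsto (fun T => Φ (Real.exp (-T))) atTop (𝓝 (Φ 0)) :=
      (hΦc.tendsto 0).comp (Real.tendsto_exp_neg_atTop_nhds_zero)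
    exact le_of_tendsto h0 (eventually_atTop.2 ⟨0, fun T hT => hmono T hT⟩)
  have e1 : ouOp 1 g = g := by funext v; simp [ouOp]
  have e0 : ouOp 0 g = fun _ => ∫ v, g v ∂(gauss d) := by funext v; simp [ouOp]
  have k0 : ∀ c : ℝ, gainK b (fun _ : Vel d => c) = fun _ => c := by
    intro c; funext v; simp [gainK]
  have n0 : ∀ c : ℝ, gEnt (fun _ : Vel d => c) = c * Real.log c := by
    intro c; simp [gEnt]
  simp only [hΦ, e1, e0, k0, n0] at hlim
  linarith

end EntropyContraction

/-! ### Removing the regularity assumptions on the density. -/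

section Approximation

open ProbabilityTheory Filter Topology InformationTheory

variable {d : ℕ} {b : ℝ → ℝ} {δ N : ℝ} {L : NNReal} {g h : Vel d → ℝ}

theorem klFun_sub_le {x y : ℝ} (hx : 0 < x) (hy : 0 ≤ y) :
    klFun x - klFun y ≤ Real.log x * (x - y) := by
  rcases hy.eq_or_lt with rfl | hy
  · have := Real.add_one_le_exp (Real.log x)
    simp only [klFun_apply, Real.log_zero]
    linarith
  · have := mul_log_sub_le hx hy
    simp only [klFun_apply]
    linarith

theorem abs_klFun_sub_le {x y : ℝ} (hδ : 0 < δ) (hx : x ∈ Set.Icc δ N) (hy : y ∈ Set.Icc δ N) :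
    |klFun x - klFun y| ≤ (|Real.log δ| + |Real.log N|) * |x - y| := by
  have hx0 := hδ.trans_le hx.1
  have hy0 := hδ.trans_le hy.1
  have key : ∀ {x y : ℝ}, x ∈ Set.Icc δ N → y ∈ Set.Icc δ N →
      klFun x - klFun y ≤ (|Real.log δ| + |Real.log N|) * |x - y| := by
    intro x y hx hy
    refine (klFun_sub_le (hδ.trans_le hx.1) (hδ.le.trans hy.1)).trans ?_
    refine (le_abs_self _).trans ?_
    rw [abs_mul]
    gcongr
    exact log_le_of_pinch hδ hx.1 hx.2
  refine abs_sub_le_iff.2 ⟨key hx hy, ?_⟩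
  rw [abs_sub_comm]
  exact key hy hx

/-- Truncation to `[δ, N]`. -/
def clamp (δ N x : ℝ) : ℝ := max δ (min x N)

@[fun_prop]
theorem measurable_clamp (δ N : ℝ) : Measurable (clamp δ N) := by
  unfold clamp; fun_prop

theorem clamp_mem (h : δ ≤ N) (x : ℝ) : clamp δ N x ∈ Set.Icc δ N :=
  ⟨le_max_left _ _, max_le h (min_le_right _ _)⟩

theorem lipschitzWith_clamp (δ N : ℝ) : LipschitzWith 1 (clamp δ N) :=
  (LipschitzWith.id.min_const N).const_max δ

theorem abs_clamp_sub_le (δ N x y : ℝ) : |clamp δ N x - clamp δ N y| ≤ |x - y| := by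
  have := (lipschitzWith_clamp δ N).dist_le_mul x y
  simpa [Real.dist_eq] using this

theorem clamp_of_mem {x : ℝ} (h : x ∈ Set.Icc δ N) : clamp δ N x = x := by
  rw [clamp, min_eq_left h.2, max_eq_right h.1]

/-- Since δ ≤ 1 ≤ N, clamping only moves values towards 1, the minimum of the convex `klFun`. -/
theorem klFun_clamp_le {x : ℝ} (hδ : 0 < δ) (h1 : δ ≤ 1) (h2 : 1 ≤ N) (hx : 0 ≤ x) :
    klFun (clamp δ N x) ≤ klFun x := by
  have hm := clamp_mem (h1.trans h2) x
  have hc := klFun_sub_le (hδ.trans_le hm.1) hx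
  suffices Real.log (clamp δ N x) * (clamp δ N x - x) ≤ 0 by linarith
  rcases lt_or_ge x δ with h | h
  · have : clamp δ N x = δ := by
      rw [clamp, max_eq_left]; exact (min_le_left _ _).trans h.le
    rw [this]
    exact mul_nonpos_of_nonpos_of_nonneg (Real.log_nonpos hδ.le h1) (by linarith)
  rcases le_or_gt x N with h' | h'
  · rw [clamp_of_mem ⟨h, h'⟩]; simp
  · have : clamp δ N x = N := by
      rw [clamp, min_eq_right h'.le, max_eq_right (h1.trans h2)]
    rw [this]
    exact mul_nonpos_of_nonneg_of_nonpos (Real.log_nonneg h2) (by linarith)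

theorem isPinched_clamp (hδ : 0 < δ) (h1 : δ ≤ 1) (h2 : 1 ≤ N) (hh : Measurable h) :
    IsPinched δ N fun v => clamp δ N (h v) :=
  ⟨by fun_prop, hδ, fun v => (clamp_mem (h1.trans h2) _).1, fun v => (clamp_mem (h1.trans h2) _).2⟩

theorem IsPinched.integrable_klFun (H : IsPinched δ N g) :
    Integrable (fun v => klFun (g v)) (gauss d) := by
  have h1 := H.integrable_mul_log (μ := gauss d) H measurable_id measurable_id
  have h2 := H.integrable (μ := gauss d) measurable_id
  exact (h1.add (integrable_const 1)).sub h2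

theorem IsPinched.integral_klFun (H : IsPinched δ N g) :
    ∫ v, klFun (g v) ∂(gauss d) = gEnt g + 1 - ∫ v, g v ∂(gauss d) := by
  have h1 := H.integrable_mul_log (μ := gauss d) H measurable_id measurable_id
  have h2 := H.integrable (μ := gauss d) measurable_id
  have h3 := integral_sub (h1.add (integrable_const 1)) h2
  have h4 := integral_add h1 (integrable_const (μ := gauss d) (1 : ℝ))
  simp only [Pi.add_apply, id] at h3 h4
  simp only [klFun_apply]
  rw [h3, h4]
  simp [gEnt]

/-- The truncations `clamp (1/(n+1)) (n+1) ∘ h` converge to `h` in `L¹`. -/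
theorem tendsto_integral_clamp_sub (hm : Measurable h) (h0 : ∀ v, 0 ≤ h v)
    (hi : Integrable h (gauss d)) :
    Tendsto (fun n : ℕ => ∫ v, |clamp ((n : ℝ) + 1)⁻¹ (n + 1) (h v) - h v| ∂(gauss d)) atTop
      (𝓝 0) := by
  have hz : (0 : ℝ) = ∫ v : Vel d, (0 : ℝ) ∂(gauss d) := by simp
  rw [hz]
  refine tendsto_integral_of_dominated_convergence (fun v => 1 + h v)
    (fun n => Measurable.aestronglyMeasurable (by fun_prop)) ((integrable_const 1).add hi)
    (fun n => ae_of_all _ fun v => ?_) (ae_of_all _ fun v => ?_)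
  · have hn : (0 : ℝ) < n + 1 := by positivity
    have hn1 : ((n : ℝ) + 1)⁻¹ ≤ 1 := inv_le_one_of_one_le₀ (by linarith [(n.cast_nonneg : (0 : ℝ) ≤ n)])
    have hn0 : 0 ≤ ((n : ℝ) + 1)⁻¹ := by positivity
    have := h0 v
    rw [Real.norm_eq_abs, abs_abs, abs_le, clamp]
    constructor
    · have := le_max_left ((n : ℝ) + 1)⁻¹ (min (h v) (n + 1)); linarith
    · have : max ((n : ℝ) + 1)⁻¹ (min (h v) (n + 1)) ≤ 1 + h v :=
        max_le (by linarith) ((min_le_left _ _).trans (by linarith))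
      linarith
  · have hb : Tendsto (fun n : ℕ => (n : ℝ) + 1) atTop atTop :=
      tendsto_atTop_add_const_right _ _ tendsto_natCast_atTop_atTop
    have ha : Tendsto (fun n : ℕ => ((n : ℝ) + 1)⁻¹) atTop (𝓝 0) := tendsto_inv_atTop_zero.comp hb
    have h1 : ∀ᶠ n : ℕ in atTop, min (h v) ((n : ℝ) + 1) = h v := by
      filter_upwards [hb.eventually_ge_atTop (h v)] with n hn
      exact min_eq_left hn
    have h2 : Tendsto (fun n : ℕ => clamp ((n : ℝ) + 1)⁻¹ (n + 1) (h v)) atTop (𝓝 (h v)) := by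
      have h3 : Tendsto (fun n : ℕ => max ((n : ℝ) + 1)⁻¹ (h v)) atTop (𝓝 (max 0 (h v))) :=
        ha.max tendsto_const_nhds
      rw [max_eq_right (h0 v)] at h3
      refine h3.congr' ?_
      filter_upwards [h1] with n hn
      rw [clamp, hn]
    have h4 := (h2.sub_const (h v)).abs
    simpa using h4

/-- Truncate, approximate in L¹ by a smooth compactly supported function, truncate again. Truncation
lowers the entropy, and on [δ, N] the integrand is Lipschitz, so the L¹ error controls the rest. -/
theorem exists_lipschitz_approx (hm : Measurable h) (h0 : ∀ v, 0 ≤ h v)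
    (hi : Integrable h (gauss d)) (hk : Integrable (fun v => klFun (h v)) (gauss d)) {ε : ℝ}
    (hε : 0 < ε) :
    ∃ (δ N : ℝ) (L : NNReal) (g : Vel d → ℝ), IsPinched δ N g ∧ LipschitzWith L g ∧
      ∫ v, |g v - h v| ∂(gauss d) ≤ ε ∧
      ∫ v, klFun (g v) ∂(gauss d) ≤ ∫ v, klFun (h v) ∂(gauss d) + ε := by
  obtain ⟨n, hn⟩ := ((tendsto_integral_clamp_sub hm h0 hi).eventually_lt_const
    (half_pos hε)).exists
  set N : ℝ := n + 1 with hN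
  set δ : ℝ := N⁻¹ with hδ
  have hN1 : 1 ≤ N := by linarith [(n.cast_nonneg : (0 : ℝ) ≤ n)]
  have hδ0 : 0 < δ := by positivity
  have hδ1 : δ ≤ 1 := inv_le_one_of_one_le₀ hN1
  have Hc := isPinched_clamp hδ0 hδ1 hN1 hm
  set hc := fun v => clamp δ N (h v) with hhc
  set c := |Real.log δ| + |Real.log N| with hcdef
  have hc0 : 0 ≤ c := by positivity
  -- The first bound serves the L¹ distance, the second the entropy, c being a Lipschitz constant of
  -- `klFun` on [δ, N].
  have hη : 0 < min (ε / 2) (ε / (c + 1)) := lt_min (half_pos hε) (by positivity)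
  have hmem : MemLp hc 1 (gauss d) := memLp_one_iff_integrable.2 (Hc.integrable measurable_id)
  obtain ⟨u, hus, huc, hu⟩ := hmem.exist_eLpNorm_sub_le ENNReal.one_ne_top le_rfl hη
  obtain ⟨L, hL⟩ := huc.lipschitzWith_of_hasCompactSupport (𝕂 := ℝ) hus (by simp)
  have hum : Measurable u := huc.continuous.measurable
  have Hg := isPinched_clamp hδ0 hδ1 hN1 hum
  have iu : Integrable (fun v => |hc v - u v|) (gauss d) :=
    ((Hc.integrable measurable_id).sub
      (huc.continuous.integrable_of_hasCompactSupport hus)).abs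
  have hu1 : ∫ v, |hc v - u v| ∂(gauss d) ≤ min (ε / 2) (ε / (c + 1)) := by
    rw [eLpNorm_one_eq_lintegral_enorm] at hu
    have e : ∫ v, |hc v - u v| ∂(gauss d) = (∫⁻ v, ‖(hc - u) v‖ₑ ∂(gauss d)).toReal := by
      rw [← integral_norm_eq_lintegral_enorm (Hc.measurable.sub hum).aestronglyMeasurable]
      rfl
    rw [e]
    exact ENNReal.toReal_le_of_le_ofReal hη.le hu
  have ig : Integrable (fun v => |clamp δ N (u v) - hc v|) (gauss d) :=
    ((Hg.integrable measurable_id).sub (Hc.integrable measurable_id)).abs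
  have hg1 : ∫ v, |clamp δ N (u v) - hc v| ∂(gauss d) ≤ min (ε / 2) (ε / (c + 1)) := by
    refine (integral_mono ig iu fun v => ?_).trans hu1
    beta_reduce
    -- The target is fixed by the clamp, so clamping the approximation, a 1-Lipschitz operation,
    -- cannot increase the distance.
    have e : hc v = clamp δ N (hc v) := (clamp_of_mem (clamp_mem (hδ1.trans hN1) _)).symm
    rw [e, abs_sub_comm]
    refine (abs_clamp_sub_le _ _ _ _).trans ?_
    rw [← e]
  refine ⟨δ, N, 1 * L, fun v => clamp δ N (u v), Hg, (lipschitzWith_clamp δ N).comp hL, ?_, ?_⟩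
  · have ih : Integrable (fun v => |hc v - h v|) (gauss d) :=
      ((Hc.integrable measurable_id).sub hi).abs
    have i3 : Integrable (fun v => |clamp δ N (u v) - h v|) (gauss d) :=
      ((Hg.integrable measurable_id).sub hi).abs
    have h1 := integral_mono i3 (ig.add ih) fun v => abs_sub_le _ (hc v) _
    have h2 := integral_add ig ih
    simp only [Pi.add_apply] at h1
    have h3 := min_le_left (ε / 2) (ε / (c + 1))
    have h4 : ∫ v, |hc v - h v| ∂(gauss d) < ε / 2 := hn
    linarith
  · have h1 : ∫ v, klFun (hc v) ∂(gauss d) ≤ ∫ v, klFun (h v) ∂(gauss d) :=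
      integral_mono Hc.integrable_klFun hk fun v => klFun_clamp_le hδ0 hδ1 hN1 (h0 v)
    have h2 := integral_mono Hg.integrable_klFun (Hc.integrable_klFun.add (ig.const_mul c))
      fun v => by
        have := (le_abs_self _).trans (abs_klFun_sub_le hδ0 (clamp_mem (hδ1.trans hN1) (u v))
          (clamp_mem (hδ1.trans hN1) (h v)))
        simp only [Pi.add_apply]
        simp only [hhc]
        linarith
    have h3 := integral_add Hc.integrable_klFun (ig.const_mul c)
    simp only [Pi.add_apply] at h2
    rw [integral_const_mul] at h3
    have h4 : c * ∫ v, |clamp δ N (u v) - hc v| ∂(gauss d) ≤ c * (ε / (c + 1)) := by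
      gcongr
      exact hg1.trans (min_le_right _ _)
    have h5 : c * (ε / (c + 1)) ≤ ε := by
      rw [mul_div_assoc', div_le_iff₀ (by positivity)]
      nlinarith
    linarith

theorem measurable_gainK (hm : Measurable h) : Measurable (gainK b h) := by
  have h1 : StronglyMeasurable fun q : Vel d × Vel d × Sph d => h (vPrime q.1 q.2.1 q.2.2) :=
    (hm.comp measurable_vPrime).stronglyMeasurable
  have h2 := h1.integral_kernel_prod_right' (κ := collKer d b)
  exact h2.measurable

theorem ae_integrable_collKer (hd : 1 ≤ d) (hb : IsAngularKernel d b)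
    (hi : Integrable h (gauss d)) :
    ∀ᵐ v ∂(gauss d), Integrable (fun p : Vel d × Sph d => h (vPrime v p.1 p.2))
      (collKer d b v) := by
  have h1 : Integrable (fun q : Vel d × Vel d × Sph d => h (vPrime q.1 q.2.1 q.2.2))
      (gauss d ⊗ₘ collKer d b) :=
    (measurePreserving_vPrime hd hb).integrable_comp_of_integrable hi
  exact ((Measure.integrable_compProd_iff h1.1).1 h1).1

theorem integral_gainK (hd : 1 ≤ d) (hb : IsAngularKernel d b) (hm : Measurable h)
    (hi : Integrable h (gauss d)) : ∫ v, gainK b h v ∂(gauss d) = ∫ v, h v ∂(gauss d) := by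
  have h1 : Integrable (fun q : Vel d × Vel d × Sph d => h (vPrime q.1 q.2.1 q.2.2))
      (gauss d ⊗ₘ collKer d b) :=
    (measurePreserving_vPrime hd hb).integrable_comp_of_integrable hi
  have h2 := Measure.integral_compProd h1
  have h3 := (measurePreserving_vPrime hd hb).map_eq
  have h4 := integral_map (μ := collJoint d b) measurable_vPrime.aemeasurable (f := h)
    hm.aestronglyMeasurable
  rw [h3] at h4
  rw [h4]
  exact h2.symm

/-- K is an average over v', and v' has the Gaussian law, so K contracts L¹. -/
theorem lintegral_enorm_gainK_sub_le (hd : 1 ≤ d) (hb : IsAngularKernel d b)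
    (gm : Measurable g) (hm : Measurable h) (gi : Integrable g (gauss d))
    (hi : Integrable h (gauss d)) :
    ∫⁻ v, ‖gainK b g v - gainK b h v‖ₑ ∂(gauss d) ≤ ∫⁻ v, ‖g v - h v‖ₑ ∂(gauss d) := by
  have := isMarkovKernel_collKer hd hb
  have hm2 : Measurable fun v => ‖g v - h v‖ₑ := by fun_prop
  have e : ∫⁻ v, ‖g v - h v‖ₑ ∂(gauss d) = ∫⁻ v, ∫⁻ p, ‖g (vPrime v p.1 p.2) -
      h (vPrime v p.1 p.2)‖ₑ ∂(collKer d b v) ∂(gauss d) := by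
    rw [← (measurePreserving_vPrime hd hb).lintegral_comp hm2]
    exact Measure.lintegral_compProd (hm2.comp measurable_vPrime)
  rw [e]
  refine lintegral_mono_ae ?_
  filter_upwards [ae_integrable_collKer hd hb gi, ae_integrable_collKer hd hb hi] with v h1 h2
  rw [gainK, gainK, ← integral_sub h1 h2]
  exact enorm_integral_le_lintegral_enorm _

theorem integral_klFun_gainK_le (hd : 1 ≤ d) (hb : IsAngularKernel d b) (H : IsPinched δ N g)
    (hL : LipschitzWith L g) :
    ∫ v, klFun (gainK b g v) ∂(gauss d) ≤ 1 / 2 * ∫ v, klFun (g v) ∂(gauss d) +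
      1 / 2 * klFun (∫ v, g v ∂(gauss d)) := by
  have h1 := gEnt_gainK_le hd hb H hL
  rw [(H.gainK hd hb).integral_klFun, H.integral_klFun,
    integral_gainK hd hb H.measurable (H.integrable measurable_id), klFun_apply]
  linarith

/-- The gain operator contracts the relative entropy by the factor `1/2`. -/
theorem lintegral_klFun_gainK_le (hd : 1 ≤ d) (hb : IsAngularKernel d b)
    (hm : Measurable h) (h0 : ∀ v, 0 ≤ h v) (hi : Integrable h (gauss d))
    (h1 : ∫ v, h v ∂(gauss d) = 1) (hk : Integrable (fun v => klFun (h v)) (gauss d)) :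
    ∫⁻ v, ENNReal.ofReal (klFun (gainK b h v)) ∂(gauss d) ≤
      ENNReal.ofReal (1 / 2 * ∫ v, klFun (h v) ∂(gauss d)) := by
  have hε : ∀ n : ℕ, (0 : ℝ) < 1 / ((n : ℝ) + 1) := fun n => by positivity
  choose δ N L g Hg hL hg1 hg2 using fun n => exists_lipschitz_approx hm h0 hi hk (hε n)
  have hlim : Tendsto (fun n : ℕ => 1 / ((n : ℝ) + 1)) atTop (𝓝 0) :=
    tendsto_one_div_add_atTop_nhds_zero_nat
  have gi : ∀ n, Integrable (g n) (gauss d) := fun n => (Hg n).integrable measurable_id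
  have hL1 : Tendsto (fun n => eLpNorm (gainK b (g n) - gainK b h) 1 (gauss d)) atTop (𝓝 0) := by
    have h2 : Tendsto (fun n : ℕ => ENNReal.ofReal (1 / ((n : ℝ) + 1))) atTop (𝓝 0) := by
      simpa using ENNReal.tendsto_ofReal hlim
    refine tendsto_of_tendsto_of_tendsto_of_le_of_le tendsto_const_nhds h2
      (fun n => zero_le) fun n => ?_
    beta_reduce
    rw [eLpNorm_one_eq_lintegral_enorm]
    refine (lintegral_enorm_gainK_sub_le hd hb (Hg n).measurable hm (gi n) hi).trans ?_
    have e := ofReal_integral_norm_eq_lintegral_enorm ((gi n).sub hi)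
    simp only [Pi.sub_apply] at e
    rw [← e]
    exact ENNReal.ofReal_le_ofReal (hg1 n)
  obtain ⟨ns, hns, hae⟩ := (tendstoInMeasure_of_tendsto_eLpNorm one_ne_zero
    (fun n => (measurable_gainK (Hg n).measurable).aestronglyMeasurable)
    (measurable_gainK hm).aestronglyMeasurable hL1).exists_seq_tendsto_ae
  -- The approximants need not have unit mass; their means tend to 1, where the extra `klFun` term
  -- vanishes.
  have hmass : Tendsto (fun n => ∫ v, g n v ∂(gauss d)) atTop (𝓝 1) := by
    rw [← h1]
    refine tendsto_iff_norm_sub_tendsto_zero.2 ?_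
    refine squeeze_zero (fun n => norm_nonneg _) (fun n => ?_) hlim
    rw [← integral_sub (gi n) hi]
    exact (norm_integral_le_integral_norm _).trans (hg1 n)
  set I := ∫ v, klFun (h v) ∂(gauss d) with hI
  have hbd : Tendsto (fun n : ℕ => 1 / 2 * (I + 1 / ((n : ℝ) + 1)) +
      1 / 2 * klFun (∫ v, g n v ∂(gauss d))) atTop (𝓝 (1 / 2 * I)) := by
    have h2 := (continuous_klFun.tendsto 1).comp hmass
    rw [klFun_one] at h2
    have h3 := ((hlim.const_add I).const_mul (1 / 2)).add (h2.const_mul (1 / 2))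
    simpa using h3
  have hbd' := (ENNReal.tendsto_ofReal hbd).comp hns.tendsto_atTop
  -- Lower semicontinuity of the entropy along the almost everywhere convergent subsequence.
  have hfat := lintegral_liminf_le' (μ := gauss d) (u := atTop)
    (f := fun i v => ENNReal.ofReal (klFun (gainK b (g (ns i)) v))) fun i =>
      (ENNReal.measurable_ofReal.comp (measurable_klFun.comp
        (measurable_gainK (Hg (ns i)).measurable))).aemeasurable
  calc _ = ∫⁻ v, liminf (fun i => ENNReal.ofReal (klFun (gainK b (g (ns i)) v))) atTop
        ∂(gauss d) := by
        refine lintegral_congr_ae ?_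
        filter_upwards [hae] with v hv
        have := (ENNReal.continuous_ofReal.comp continuous_klFun).tendsto (gainK b h v)
        exact (this.comp hv).liminf_eq.symm
    _ ≤ _ := hfat
    _ ≤ liminf (fun i => ENNReal.ofReal (1 / 2 * (I + 1 / ((ns i : ℝ) + 1)) +
          1 / 2 * klFun (∫ v, g (ns i) v ∂(gauss d)))) atTop := by
        refine liminf_le_liminf (Eventually.of_forall fun i => ?_)
        have K := (Hg (ns i)).gainK hd hb
        rw [← ofReal_integral_eq_lintegral_ofReal K.integrable_klFun (ae_of_all _ fun v =>
          klFun_nonneg (K.pos.le.trans (K.ge v)))]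
        refine ENNReal.ofReal_le_ofReal ?_
        refine (integral_klFun_gainK_le hd hb (Hg (ns i)) (hL (ns i))).trans ?_
        have := hg2 (ns i)
        linarith
    _ = _ := hbd'.liminf_eq

end Approximation

/-! ### The entropy production as a symmetric Bregman integral. -/

section EntropyProduction

open ProbabilityTheory Filter Topology InformationTheory

variable {d : ℕ} {b : ℝ → ℝ} {α : ℝ} {f h : Vel d → ℝ}

/-! ### Extended integrals of a nonnegative function plus an integrable one. -/

section ExtIntegral

/-- The splitting of G + r into positive and negative parts, arranged without subtraction so that it
survives G = ∞ and can be integrated in [0, ∞]. -/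
theorem toENNReal_add_coe (G : ℝ≥0∞) (r : ℝ) :
    ((G : EReal) + (r : EReal)).toENNReal + ENNReal.ofReal (-r) =
      G + ENNReal.ofReal r + (-((G : EReal) + (r : EReal))).toENNReal := by
  induction G with
  | top => simp
  | coe x =>
    have e : ((x : ℝ≥0∞) : EReal) + (r : EReal) = (((x : ℝ) + r : ℝ) : EReal) := by
      push_cast; rfl
    have ex : (x : ℝ≥0∞) = ENNReal.ofReal (x : ℝ) := by simp
    rw [e, ← EReal.coe_neg, EReal.toENNReal_of_ne_top (EReal.coe_ne_top _),
      EReal.toENNReal_of_ne_top (EReal.coe_ne_top _), EReal.toReal_coe, EReal.toReal_coe, ex]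
    have hx : (0 : ℝ) ≤ x := x.2
    rcases le_total 0 r with hr | hr
    · rw [ENNReal.ofReal_of_nonpos (neg_nonpos.2 hr),
        ENNReal.ofReal_of_nonpos (p := -((x : ℝ) + r)) (by linarith), ENNReal.ofReal_add hx hr]
    · rw [ENNReal.ofReal_of_nonpos hr, add_zero]
      rcases le_total 0 ((x : ℝ) + r) with h | h
      · rw [ENNReal.ofReal_of_nonpos (p := -((x : ℝ) + r)) (by linarith), add_zero,
          ← ENNReal.ofReal_add h (by linarith)]
        congr 1; ring
      · rw [ENNReal.ofReal_of_nonpos h, zero_add, ← ENNReal.ofReal_add hx (by linarith)]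
        congr 1; ring

theorem posInt_ne_top_of_ae_eq {G : Vel d → ℝ≥0∞} {R : Vel d → ℝ} {p : Vel d → EReal}
    (hR : Integrable R) (hp : ∀ᵐ v, p v = -((G v : EReal) + (R v : EReal))) : posInt p ≠ ⊤ := by
  refine ne_top_of_le_ne_top hR.hasFiniteIntegral.ne (lintegral_mono_ae ?_)
  filter_upwards [hp] with v hv
  rw [hv]
  have h1 : -((G v : EReal) + (R v : EReal)) ≤ ((‖R v‖ : ℝ) : EReal) := by
    rw [EReal.neg_le]
    have h2 : (-(‖R v‖ : ℝ) : EReal) ≤ ((R v : ℝ) : EReal) := by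
      rw [← EReal.coe_neg]
      exact EReal.coe_le_coe_iff.2 (neg_abs_le _)
    calc (-(‖R v‖ : ℝ) : EReal) ≤ (R v : EReal) := h2
      _ = 0 + (R v : EReal) := (zero_add _).symm
      _ ≤ _ := by gcongr; exact EReal.coe_ennreal_nonneg _
  refine (EReal.toENNReal_le_toENNReal h1).trans ?_
  rw [EReal.toENNReal_of_ne_top (EReal.coe_ne_top _), EReal.toReal_coe, ofReal_norm]

/-- Integrate `toENNReal_add_coe`; the parts of R and the positive part of p have finite integrals
and can be cancelled, whether or not the integral of G is finite. -/
theorem neg_extIntegral_eq {G : Vel d → ℝ≥0∞} {R : Vel d → ℝ} {p : Vel d → EReal}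
    (hG : AEMeasurable G) (hR : Integrable R)
    (hp : ∀ᵐ v, p v = -((G v : EReal) + (R v : EReal))) :
    -extIntegral p = ((∫⁻ v, G v : ℝ≥0∞) : EReal) + ((∫ v, R v : ℝ) : EReal) := by
  have hpos := posInt_ne_top_of_ae_eq hR hp
  have hRm := hR.aemeasurable
  have hRn : AEMeasurable fun v => -R v := hRm.neg
  have hGR : AEMeasurable fun v => G v + ENNReal.ofReal (R v) := hG.add hRm.ennreal_ofReal
  have e1 : negInt p = ∫⁻ v, ((G v : EReal) + (R v : EReal)).toENNReal := by
    refine lintegral_congr_ae ?_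
    filter_upwards [hp] with v hv
    rw [hv, neg_neg]
  have e2 : posInt p = ∫⁻ v, (-((G v : EReal) + (R v : EReal))).toENNReal := by
    refine lintegral_congr_ae ?_
    filter_upwards [hp] with v hv
    rw [hv]
  have key : negInt p + ∫⁻ v, ENNReal.ofReal (-R v) =
      (∫⁻ v, G v) + (∫⁻ v, ENNReal.ofReal (R v)) + posInt p := by
    rw [e1, e2, ← lintegral_add_right' _ hRn.ennreal_ofReal,
      ← lintegral_add_right' _ hRm.ennreal_ofReal,
      ← lintegral_add_left' hGR]
    exact lintegral_congr fun v => toENNReal_add_coe _ _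
  have f1 : ∫⁻ v, ENNReal.ofReal (R v) ≠ ⊤ :=
    ne_top_of_le_ne_top hR.hasFiniteIntegral.ne
      (lintegral_mono fun v => Real.ofReal_le_enorm _)
  have f2 : ∫⁻ v, ENNReal.ofReal (-R v) ≠ ⊤ :=
    ne_top_of_le_ne_top hR.neg.hasFiniteIntegral.ne
      (lintegral_mono fun v => Real.ofReal_le_enorm _)
  have hRi := integral_eq_lintegral_pos_part_sub_lintegral_neg_part hR
  rw [extIntegral, hRi]
  generalize (∫⁻ v, G v) = g at key ⊢
  generalize (∫⁻ v, ENNReal.ofReal (R v)) = r₁ at key f1 ⊢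
  generalize (∫⁻ v, ENNReal.ofReal (-R v)) = r₂ at key f2 ⊢
  generalize negInt p = A at key ⊢
  generalize posInt p = B at key hpos ⊢
  lift r₁ to NNReal using f1
  lift r₂ to NNReal using f2
  lift B to NNReal using hpos
  induction g with
  | top =>
    have hA : A = ⊤ := by
      by_contra hA
      lift A to NNReal using hA
      rw [top_add, top_add, ← ENNReal.coe_add] at key
      exact ENNReal.coe_ne_top key
    rw [hA]
    have : ((B : ℝ≥0∞) : EReal) - ((⊤ : ℝ≥0∞) : EReal) = ⊥ := by
      rw [EReal.coe_ennreal_top, EReal.sub_top]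
    rw [this, EReal.coe_ennreal_top, EReal.top_add_coe, EReal.neg_bot]
  | coe g =>
    have hA : A ≠ ⊤ := by
      rintro rfl
      rw [top_add, ← ENNReal.coe_add, ← ENNReal.coe_add] at key
      exact ENNReal.coe_ne_top key.symm
    lift A to NNReal using hA
    have key' : (A : ℝ) + r₂ = g + r₁ + B := by exact_mod_cast key
    have c : ∀ x : NNReal, (((x : ℝ≥0∞) : EReal)) = ((x : ℝ) : EReal) := fun x => rfl
    rw [c, c, c, ENNReal.coe_toReal, ENNReal.coe_toReal, ← EReal.coe_sub, ← EReal.coe_neg,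
      ← EReal.coe_add]
    congr 1
    linarith

end ExtIntegral

theorem integrable_gauss_iff {F : Vel d → ℝ} :
    Integrable F (gauss d) ↔ Integrable fun v => maxwellian v * F v := by
  rw [gauss, integrable_withDensity_iff_integrable_smul' (by fun_prop)
    (ae_of_all _ fun _ => ENNReal.ofReal_lt_top)]
  refine integrable_congr (ae_of_all _ fun v => ?_)
  beta_reduce
  rw [ENNReal.toReal_ofReal (maxwellian_pos v).le, smul_eq_mul]

theorem integral_gauss (F : Vel d → ℝ) :
    ∫ v, F v ∂(gauss d) = ∫ v, maxwellian v * F v := by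
  rw [gauss, integral_withDensity_eq_integral_toReal_smul (by fun_prop)
    (ae_of_all _ fun _ => ENNReal.ofReal_lt_top)]
  refine integral_congr_ae (ae_of_all _ fun v => ?_)
  beta_reduce
  rw [ENNReal.toReal_ofReal (maxwellian_pos v).le, smul_eq_mul]

theorem integral_gauss_prod_sph (F : Vel d × Sph d → ℝ) :
    ∫ p, F p ∂((gauss d).prod (sphMeasure d)) =
      ∫ p, maxwellian p.1 * F p ∂((volume : Measure (Vel d)).prod (sphMeasure d)) := by
  rw [gauss, prod_withDensity_left (by fun_prop),
    integral_withDensity_eq_integral_toReal_smul (by fun_prop)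
    (ae_of_all _ fun _ => ENNReal.ofReal_lt_top)]
  refine integral_congr_ae (ae_of_all _ fun v => ?_)
  beta_reduce
  rw [ENNReal.toReal_ofReal (maxwellian_pos _).le, smul_eq_mul]

theorem mul_maxwellian_wPrime (f : Vel d → ℝ) (v w : Vel d) (σ : Sph d) :
    f (vPrime v w σ) * maxwellian (wPrime v w σ) =
      maxwellian v * maxwellian w * (f (vPrime v w σ) / maxwellian (vPrime v w σ)) := by
  rw [← maxwellian_vPrime_mul v w σ]
  have := (maxwellian_pos (vPrime v w σ)).ne'
  field_simp

/-- The gain operator in terms of the relative density. -/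
theorem gainOp_eq (hb : IsAngularKernel d b) (hh : ∀ v, h v = f v / maxwellian v) (v : Vel d) :
    gainOp b α f v =
      maxwellian v * ∫ p, ‖v - p.1‖ ^ α * h (vPrime v p.1 p.2) ∂(collKer d b v) := by
  rw [integral_collKer_prod hb, integral_gauss_prod_sph, ← integral_const_mul, gainOp]
  refine integral_congr_ae (ae_of_all _ fun p => ?_)
  beta_reduce
  rw [mul_assoc, mul_maxwellian_wPrime, hh, collKernel, smul_eq_mul]
  ring

theorem linBoltzmann_eq (hb : IsAngularKernel d b) (hh : ∀ v, h v = f v / maxwellian v)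
    (v : Vel d) :
    linBoltzmann b α f v = maxwellian v *
      ∫ p, ‖v - p.1‖ ^ α * (h (vPrime v p.1 p.2) - h v) ∂(collKer d b v) := by
  rw [integral_collKer_prod hb, integral_gauss_prod_sph, ← integral_const_mul, linBoltzmann,
    collisionOp]
  refine integral_congr_ae (ae_of_all _ fun p => ?_)
  have := (maxwellian_pos v).ne'
  beta_reduce
  rw [mul_maxwellian_wPrime, hh, hh, collKernel, smul_eq_mul]
  field_simp

/-- The Bregman divergence of `x log x`, with values in `[0, ∞]`. -/
def bregman (x y : ℝ) : ℝ≥0∞ :=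
  if y = 0 then (if x = 0 then 0 else ⊤)
  else ENNReal.ofReal (klFun x - klFun y - (x - y) * Real.log y)

@[fun_prop]
theorem measurable_bregman : Measurable (Function.uncurry bregman) := by
  have hk : Measurable fun q : ℝ × ℝ => klFun q.1 := measurable_klFun.comp measurable_fst
  have hk' : Measurable fun q : ℝ × ℝ => klFun q.2 := measurable_klFun.comp measurable_snd
  unfold bregman Function.uncurry
  refine Measurable.ite (measurableSet_eq_fun measurable_snd measurable_const) ?_ ?_
  · exact Measurable.ite (measurableSet_eq_fun measurable_fst measurable_const)
      measurable_const measurable_const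
  · fun_prop

/-- The nonnegative part of the entropy production at `v`. -/
def prodMain (b : ℝ → ℝ) (α : ℝ) (h : Vel d → ℝ) (v : Vel d) : ℝ≥0∞ :=
  ENNReal.ofReal (maxwellian v) *
    ∫⁻ p, ENNReal.ofReal (‖v - p.1‖ ^ α) * bregman (h (vPrime v p.1 p.2)) (h v) ∂(collKer d b v)

/-- The part of the entropy production at `v` with vanishing integral. -/
def prodRem (b : ℝ → ℝ) (α : ℝ) (h : Vel d → ℝ) (v : Vel d) : ℝ :=
  maxwellian v * ((∫ p, ‖v - p.1‖ ^ α * klFun (h v) ∂(collKer d b v)) -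
    ∫ p, ‖v - p.1‖ ^ α * klFun (h (vPrime v p.1 p.2)) ∂(collKer d b v))

/-- The symmetric form of the entropy production. -/
def prodTotal (b : ℝ → ℝ) (α : ℝ) (h : Vel d → ℝ) : ℝ≥0∞ :=
  ∫⁻ q, ENNReal.ofReal (‖q.1 - q.2.1‖ ^ α) * bregman (h (vPrime q.1 q.2.1 q.2.2)) (h q.1)
    ∂(collJoint d b)

theorem measurable_prodIntegrand (hm : Measurable h) :
    Measurable fun q : Vel d × Vel d × Sph d =>
      ENNReal.ofReal (‖q.1 - q.2.1‖ ^ α) * bregman (h (vPrime q.1 q.2.1 q.2.2)) (h q.1) := by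
  have h1 : Measurable fun q : Vel d × Vel d × Sph d =>
      bregman (h (vPrime q.1 q.2.1 q.2.2)) (h q.1) := by
    have := measurable_bregman.comp ((hm.comp measurable_vPrime).prodMk (hm.comp measurable_fst))
    exact this
  fun_prop

theorem measurable_prodMain (hm : Measurable h) : Measurable (prodMain b α h) := by
  have h1 := (measurable_prodIntegrand (α := α) hm).lintegral_kernel_prod_right'
    (κ := collKer d b)
  have h2 : Measurable fun v : Vel d => ENNReal.ofReal (maxwellian v) := by fun_prop
  exact h2.mul h1

theorem lintegral_prodMain (hm : Measurable h) :
    ∫⁻ v, prodMain b α h v = prodTotal b α h := by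
  have h1 := (measurable_prodIntegrand (α := α) hm).lintegral_kernel_prod_right'
    (κ := collKer d b)
  have h2 := lintegral_gauss h1
  rw [prodTotal, collJoint, Measure.lintegral_compProd (measurable_prodIntegrand hm)]
  exact h2.symm

theorem integrable_swap (hd : 1 ≤ d) (hb : IsAngularKernel d b) {k : Vel d → ℝ}
    (hk : Measurable k)
    (hi : Integrable (fun q => ‖q.1 - q.2.1‖ ^ α * k q.1) (collJoint d b)) :
    Integrable (fun q => ‖q.1 - q.2.1‖ ^ α * k (vPrime q.1 q.2.1 q.2.2)) (collJoint d b) := by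
  have hF : Measurable fun x : Vel d × Vel d × Vel d × Vel d × ℝ => ‖x.1 - x.2.1‖ ^ α * k x.1 := by
    fun_prop
  have h1 := integrable_map_measure (μ := collJoint d b)
    (f := fun q : Vel d × Vel d × Sph d => collData q.1 q.2.1 q.2.2) hF.aestronglyMeasurable
    measurable_collData.aemeasurable
  have h2 := integrable_map_measure (μ := collJoint d b)
    (f := fun q : Vel d × Vel d × Sph d => collDataInv q.1 q.2.1 q.2.2) hF.aestronglyMeasurable
    measurable_collDataInv.aemeasurable
  rw [map_collData_eq hd hb.measurable] at h1
  have h3 := h2.1 (h1.2 hi)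
  refine h3.congr (ae_of_all _ fun q => ?_)
  change ‖vPrime q.1 q.2.1 q.2.2 - wPrime q.1 q.2.1 q.2.2‖ ^ α * k (vPrime q.1 q.2.1 q.2.2) = _
  rw [norm_sub_wPrime]

theorem integral_swap (hd : 1 ≤ d) (hb : IsAngularKernel d b) {k : Vel d → ℝ}
    (hk : Measurable k) :
    ∫ q, ‖q.1 - q.2.1‖ ^ α * k (vPrime q.1 q.2.1 q.2.2) ∂(collJoint d b) =
      ∫ q, ‖q.1 - q.2.1‖ ^ α * k q.1 ∂(collJoint d b) := by
  have hF : Measurable fun x : Vel d × Vel d × Vel d × Vel d × ℝ => ‖x.1 - x.2.1‖ ^ α * k x.1 := by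
    fun_prop
  refine Eq.trans ?_ (integral_collJoint_swap hd hb.measurable hF).symm
  refine integral_congr_ae (ae_of_all _ fun q => ?_)
  change _ = ‖vPrime q.1 q.2.1 q.2.2 - wPrime q.1 q.2.1 q.2.2‖ ^ α * k (vPrime q.1 q.2.1 q.2.2)
  rw [norm_sub_wPrime]

theorem integrable_kernel_of_joint {F : Vel d × Vel d × Sph d → ℝ}
    (hi : Integrable F (collJoint d b)) :
    Integrable fun v => maxwellian v * ∫ p, F (v, p) ∂(collKer d b v) := by
  rw [← integrable_gauss_iff]
  rw [collJoint] at hi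
  exact hi.integral_compProd

theorem integral_kernel_of_joint {F : Vel d × Vel d × Sph d → ℝ}
    (hi : Integrable F (collJoint d b)) :
    ∫ v, maxwellian v * ∫ p, F (v, p) ∂(collKer d b v) = ∫ q, F q ∂(collJoint d b) := by
  rw [← integral_gauss]
  rw [collJoint] at hi ⊢
  exact (Measure.integral_compProd hi).symm

theorem ae_kernel_of_joint {F : Vel d × Vel d × Sph d → ℝ}
    (hi : Integrable F (collJoint d b)) :
    ∀ᵐ v, Integrable (fun p => F (v, p)) (collKer d b v) := by
  rw [collJoint] at hi
  exact ac_gauss.ae_le ((Measure.integrable_compProd_iff hi.1).1 hi).1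

theorem integrable_prodRem (hd : 1 ≤ d) (hb : IsAngularKernel d b) (hm : Measurable h)
    (hi : Integrable (fun q => ‖q.1 - q.2.1‖ ^ α * klFun (h q.1)) (collJoint d b)) :
    Integrable (prodRem b α h) := by
  have h2 := integrable_swap hd hb (measurable_klFun.comp hm) hi
  have := (integrable_kernel_of_joint hi).sub (integrable_kernel_of_joint h2)
  refine this.congr (ae_of_all _ fun v => ?_)
  simp only [Pi.sub_apply, prodRem, Function.comp_apply]
  ring

/-- The two terms have equal integrals by reversibility, as the relative speed is conserved.
Integrability of each is what makes the cancellation legitimate. -/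
theorem integral_prodRem (hd : 1 ≤ d) (hb : IsAngularKernel d b) (hm : Measurable h)
    (hi : Integrable (fun q => ‖q.1 - q.2.1‖ ^ α * klFun (h q.1)) (collJoint d b)) :
    ∫ v, prodRem b α h v = 0 := by
  have h2 := integrable_swap hd hb (measurable_klFun.comp hm) hi
  have h3 := integral_sub (integrable_kernel_of_joint hi) (integrable_kernel_of_joint h2)
  rw [integral_kernel_of_joint hi, integral_kernel_of_joint h2,
    integral_swap hd hb (measurable_klFun.comp hm)] at h3
  simp only [Function.comp_apply, sub_self] at h3
  rw [← h3]
  refine integral_congr_ae (ae_of_all _ fun v => ?_)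
  simp only [prodRem]
  ring

theorem elog_of_pos {x : ℝ} (hx : 0 < x) : elog x = (Real.log x : EReal) := by
  rw [elog, ENNReal.log_ofReal_of_pos hx]

theorem elog_zero : elog 0 = ⊥ := by simp [elog]

/-- The pointwise decomposition of the entropy production. -/
theorem productionIntegrand_eq (hb : IsAngularKernel d b) (hm : Measurable h)
    (h0 : ∀ v, 0 ≤ h v) (hh : ∀ v, h v = f v / maxwellian v) {v : Vel d}
    (i1 : Integrable (fun p : Vel d × Sph d => ‖v - p.1‖ ^ α * h v) (collKer d b v))
    (i2 : Integrable (fun p : Vel d × Sph d => ‖v - p.1‖ ^ α * h (vPrime v p.1 p.2))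
      (collKer d b v))
    (i3 : Integrable (fun p : Vel d × Sph d => ‖v - p.1‖ ^ α * klFun (h v)) (collKer d b v))
    (i4 : Integrable (fun p : Vel d × Sph d => ‖v - p.1‖ ^ α * klFun (h (vPrime v p.1 p.2)))
      (collKer d b v)) :
    productionIntegrand b α f v = -((prodMain b α h v : EReal) + (prodRem b α h v : EReal)) := by
  have hM := maxwellian_pos v
  rw [productionIntegrand, ← hh, linBoltzmann_eq hb hh, prodMain, prodRem]
  -- At a zero of h the logarithm is -∞ and L f reduces to the gain. Both sides are 0 if the gain
  -- vanishes and -∞ otherwise, which is why `bregman x 0` is infinite for x ≠ 0.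
  rcases (h0 v).eq_or_lt with hy | hy
  · rw [← hy, elog_zero]
    rw [← hy] at i3
    simp only [sub_zero, klFun_zero] at i3 ⊢
    have hnn : ∀ p : Vel d × Sph d, 0 ≤ ‖v - p.1‖ ^ α * h (vPrime v p.1 p.2) := fun p =>
      mul_nonneg (Real.rpow_nonneg (norm_nonneg _) _) (h0 _)
    have hbr : ∀ x, bregman x 0 = if x = 0 then 0 else ⊤ := fun x => by simp [bregman]
    have hInn : 0 ≤ ∫ p, ‖v - p.1‖ ^ α * h (vPrime v p.1 p.2) ∂(collKer d b v) :=
      integral_nonneg hnn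
    rcases hInn.eq_or_lt with hI | hI
    · have hz := (integral_eq_zero_iff_of_nonneg hnn i2).1 hI.symm
      have e1 : ∫⁻ p, ENNReal.ofReal (‖v - p.1‖ ^ α) * bregman (h (vPrime v p.1 p.2)) 0
          ∂(collKer d b v) = 0 := by
        rw [lintegral_congr_ae (g := fun _ => 0) ?_, lintegral_zero]
        filter_upwards [hz] with p hp
        rcases mul_eq_zero.1 hp with h | h
        · rw [h]; simp
        · rw [h, hbr]; simp
      -- With zero gain, h(v') vanishes wherever the weight does not, so both terms of the remainder
      -- carry the value 1 of `klFun` at 0.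
      have e2 : ∫ p, ‖v - p.1‖ ^ α * klFun (h (vPrime v p.1 p.2)) ∂(collKer d b v) =
          ∫ p, ‖v - p.1‖ ^ α * 1 ∂(collKer d b v) := by
        refine integral_congr_ae ?_
        filter_upwards [hz] with p hp
        rcases mul_eq_zero.1 hp with h | h
        · rw [h]; simp
        · rw [h, klFun_zero]
      rw [e1, e2, ← hI]
      simp
    · have e1 : ∫⁻ p, ENNReal.ofReal (‖v - p.1‖ ^ α) * bregman (h (vPrime v p.1 p.2)) 0
          ∂(collKer d b v) = ⊤ := by
        rw [eq_top_iff]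
        have h1 : ∫⁻ p, ENNReal.ofReal (‖v - p.1‖ ^ α * h (vPrime v p.1 p.2)) ∂(collKer d b v) ≠
            0 := by
          rw [← ofReal_integral_eq_lintegral_ofReal i2 (ae_of_all _ hnn)]
          exact (ENNReal.ofReal_pos.2 hI).ne'
        have hm2 : Measurable fun p : Vel d × Sph d =>
            ENNReal.ofReal (‖v - p.1‖ ^ α * h (vPrime v p.1 p.2)) := by
          unfold vPrime; fun_prop
        calc ⊤ = ⊤ * ∫⁻ p, ENNReal.ofReal (‖v - p.1‖ ^ α * h (vPrime v p.1 p.2))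
              ∂(collKer d b v) := (ENNReal.top_mul h1).symm
          _ = ∫⁻ p, ⊤ * ENNReal.ofReal (‖v - p.1‖ ^ α * h (vPrime v p.1 p.2))
              ∂(collKer d b v) := (lintegral_const_mul _ hm2).symm
          _ ≤ _ := by
            refine lintegral_mono fun p => ?_
            rw [hbr]
            split_ifs with h
            · rw [h]; simp
            · rw [ENNReal.ofReal_mul (Real.rpow_nonneg (norm_nonneg _) _)]
              rcases eq_or_ne (ENNReal.ofReal (‖v - p.1‖ ^ α)) 0 with h' | h'
              · rw [h']; simp
              · rw [ENNReal.mul_top h']; exact le_top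
      rw [e1, ENNReal.mul_top (ENNReal.ofReal_pos.2 hM).ne', EReal.coe_ennreal_top,
        EReal.top_add_coe, EReal.neg_top]
      exact EReal.coe_mul_bot_of_pos (mul_pos hM hI)
  · set y := h v with hyd
    have hq0 : ∀ x, 0 ≤ x → 0 ≤ klFun x - klFun y - (x - y) * Real.log y := by
      intro x hx
      have := klFun_sub_le hy hx
      nlinarith
    have i5 : Integrable (fun p : Vel d × Sph d =>
        ‖v - p.1‖ ^ α * (h (vPrime v p.1 p.2) - y)) (collKer d b v) :=
      (i2.sub i1).congr (ae_of_all _ fun p => by simp only [Pi.sub_apply]; ring)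
    have hqe : ∀ p : Vel d × Sph d, ‖v - p.1‖ ^ α * klFun (h (vPrime v p.1 p.2)) -
        ‖v - p.1‖ ^ α * klFun y - ‖v - p.1‖ ^ α * (h (vPrime v p.1 p.2) - y) * Real.log y =
        ‖v - p.1‖ ^ α * (klFun (h (vPrime v p.1 p.2)) - klFun y -
          (h (vPrime v p.1 p.2) - y) * Real.log y) := fun p => by ring
    have i6 := (i4.sub i3).sub (i5.mul_const (Real.log y))
    have e6 : ∫ p, ‖v - p.1‖ ^ α * (klFun (h (vPrime v p.1 p.2)) - klFun y -
          (h (vPrime v p.1 p.2) - y) * Real.log y) ∂(collKer d b v) =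
        (∫ p, ‖v - p.1‖ ^ α * klFun (h (vPrime v p.1 p.2)) ∂(collKer d b v)) -
        (∫ p, ‖v - p.1‖ ^ α * klFun y ∂(collKer d b v)) -
        (∫ p, ‖v - p.1‖ ^ α * (h (vPrime v p.1 p.2) - y) ∂(collKer d b v)) * Real.log y := by
      have a1 := integral_sub (i4.sub i3) (i5.mul_const (Real.log y))
      simp only [Pi.sub_apply] at a1
      rw [← integral_mul_const, ← integral_sub i4 i3, ← a1]
      exact integral_congr_ae (ae_of_all _ fun p => (hqe p).symm)
    have i7 : Integrable (fun p : Vel d × Sph d => ‖v - p.1‖ ^ α *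
        (klFun (h (vPrime v p.1 p.2)) - klFun y - (h (vPrime v p.1 p.2) - y) * Real.log y))
        (collKer d b v) := i6.congr (ae_of_all _ hqe)
    have e7 : ∫⁻ p, ENNReal.ofReal (‖v - p.1‖ ^ α) * bregman (h (vPrime v p.1 p.2)) y
        ∂(collKer d b v) = ENNReal.ofReal (∫ p, ‖v - p.1‖ ^ α * (klFun (h (vPrime v p.1 p.2)) -
          klFun y - (h (vPrime v p.1 p.2) - y) * Real.log y) ∂(collKer d b v)) := by
      rw [ofReal_integral_eq_lintegral_ofReal i7 (ae_of_all _ fun p =>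
        mul_nonneg (Real.rpow_nonneg (norm_nonneg _) _) (hq0 _ (h0 _)))]
      refine lintegral_congr fun p => ?_
      rw [bregman, if_neg hy.ne', ENNReal.ofReal_mul (Real.rpow_nonneg (norm_nonneg _) _)]
    have hn : 0 ≤ ∫ p, ‖v - p.1‖ ^ α * (klFun (h (vPrime v p.1 p.2)) -
          klFun y - (h (vPrime v p.1 p.2) - y) * Real.log y) ∂(collKer d b v) :=
      integral_nonneg fun p => mul_nonneg (Real.rpow_nonneg (norm_nonneg _) _) (hq0 _ (h0 _))
    rw [e7, ← ENNReal.ofReal_mul hM.le, EReal.coe_ennreal_ofReal, max_eq_left (mul_nonneg hM.le hn),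
      e6, elog_of_pos hy, ← EReal.coe_mul, ← EReal.coe_add, ← EReal.coe_neg]
    congr 1
    ring

theorem productionIntegrand_ae_eq (hd : 1 ≤ d) (hb : IsAngularKernel d b) (hm : Measurable h)
    (h0 : ∀ v, 0 ≤ h v) (hh : ∀ v, h v = f v / maxwellian v)
    (hA1 : Integrable (fun q => ‖q.1 - q.2.1‖ ^ α * h q.1) (collJoint d b))
    (hA2 : Integrable (fun q => ‖q.1 - q.2.1‖ ^ α * klFun (h q.1)) (collJoint d b)) :
    ∀ᵐ v, productionIntegrand b α f v =
      -((prodMain b α h v : EReal) + (prodRem b α h v : EReal)) := by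
  filter_upwards [ae_kernel_of_joint hA1, ae_kernel_of_joint (integrable_swap hd hb hm hA1),
    ae_kernel_of_joint hA2,
    ae_kernel_of_joint (integrable_swap hd hb (measurable_klFun.comp hm) hA2)] with v i1 i2 i3 i4
  exact productionIntegrand_eq hb hm h0 hh i1 i2 i3 i4

theorem hasExtIntegral_productionIntegrand (hd : 1 ≤ d) (hb : IsAngularKernel d b)
    (hm : Measurable h) (h0 : ∀ v, 0 ≤ h v) (hh : ∀ v, h v = f v / maxwellian v)
    (hA1 : Integrable (fun q => ‖q.1 - q.2.1‖ ^ α * h q.1) (collJoint d b))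
    (hA2 : Integrable (fun q => ‖q.1 - q.2.1‖ ^ α * klFun (h q.1)) (collJoint d b)) :
    HasExtIntegral (productionIntegrand b α f) :=
  Or.inl (posInt_ne_top_of_ae_eq (integrable_prodRem hd hb hm hA2)
    (productionIntegrand_ae_eq hd hb hm h0 hh hA1 hA2))

theorem entropyProduction_eq (hd : 1 ≤ d) (hb : IsAngularKernel d b)
    (hm : Measurable h) (h0 : ∀ v, 0 ≤ h v) (hh : ∀ v, h v = f v / maxwellian v)
    (hA1 : Integrable (fun q => ‖q.1 - q.2.1‖ ^ α * h q.1) (collJoint d b))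
    (hA2 : Integrable (fun q => ‖q.1 - q.2.1‖ ^ α * klFun (h q.1)) (collJoint d b)) :
    entropyProduction b α f = (prodTotal b α h : EReal) := by
  rw [entropyProduction, neg_extIntegral_eq (measurable_prodMain hm).aemeasurable
    (integrable_prodRem hd hb hm hA2) (productionIntegrand_ae_eq hd hb hm h0 hh hA1 hA2),
    integral_prodRem hd hb hm hA2, lintegral_prodMain hm]
  simp

end EntropyProduction

/-! ### Weighted moments and integrability of the collision integrals. -/

section Moments

open ProbabilityTheory Filter Topology InformationTheory

variable {d : ℕ} {b : ℝ → ℝ} {α s C : ℝ} {f h : Vel d → ℝ}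

theorem integrable_one_add_norm_rpow (hs : 0 ≤ s) :
    Integrable (fun w : Vel d => (1 + ‖w‖) ^ s) (gauss d) := by
  rcases hs.eq_or_lt with rfl | hs
  · simp
  have h0 : MemLp (fun w : Vel d => w) (ENNReal.ofReal s) (gauss d) :=
    IsGaussian.memLp_id (gauss d) _ ENNReal.ofReal_ne_top
  have h0' : MemLp (fun w : Vel d => ‖w‖) (ENNReal.ofReal s) (gauss d) := h0.norm
  have h1' : MemLp (fun _ : Vel d => (1 : ℝ)) (ENNReal.ofReal s) (gauss d) := memLp_const 1
  have h1 := h1'.add h0'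
  have h2 := h1.integrable_norm_rpow (ENNReal.ofReal_pos.2 hs).ne' ENNReal.ofReal_ne_top
  refine h2.congr (ae_of_all _ fun w => ?_)
  simp only [Pi.add_apply]
  have e : (0 : ℝ) ≤ 1 + ‖w‖ := by positivity
  rw [ENNReal.toReal_ofReal hs.le, Real.norm_of_nonneg e]

/-- Moments of the Gaussian measure. -/
def gaussMoment (d : ℕ) (s : ℝ) : ℝ := ∫ w : Vel d, (1 + ‖w‖) ^ s ∂(gauss d)

theorem one_le_gaussMoment (hs : 0 ≤ s) : 1 ≤ gaussMoment d s := by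
  have := integral_mono (integrable_const (1 : ℝ)) (integrable_one_add_norm_rpow (d := d) hs)
    fun w => Real.one_le_rpow (by linarith [norm_nonneg w]) hs
  simpa [gaussMoment] using this

theorem norm_sub_rpow_le (hs : 0 ≤ s) (v w : Vel d) :
    ‖v - w‖ ^ s ≤ (1 + ‖v‖) ^ s * (1 + ‖w‖) ^ s := by
  rw [← Real.mul_rpow (by positivity) (by positivity)]
  refine Real.rpow_le_rpow (norm_nonneg _) ?_ hs
  have := norm_sub_le v w
  nlinarith [norm_nonneg v, norm_nonneg w]

theorem lintegral_norm_sub_rpow_le (hs : 0 ≤ s) (v : Vel d) :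
    ∫⁻ w, ENNReal.ofReal (‖v - w‖ ^ s) ∂(gauss d) ≤
      ENNReal.ofReal (gaussMoment d s * (1 + ‖v‖) ^ s) := by
  rw [mul_comm, gaussMoment, ← integral_const_mul,
    ofReal_integral_eq_lintegral_ofReal ((integrable_one_add_norm_rpow hs).const_mul _)
      (ae_of_all _ fun w => by positivity)]
  exact lintegral_mono fun w => ENNReal.ofReal_le_ofReal (norm_sub_rpow_le hs v w)

/-- Near v the Maxwellian is bounded and the singularity is locally integrable since α > -d; away
from v the weight is at most 1. The exponent 0 matches the format of `lintegral_norm_sub_rpow_le`.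
-/
theorem exists_lintegral_norm_sub_rpow_le (hd : 1 ≤ d) (h1 : -(d : ℝ) < α) (h2 : α ≤ 0) :
    ∃ C : ℝ, 0 ≤ C ∧ ∀ v : Vel d, ∫⁻ w, ENNReal.ofReal (‖v - w‖ ^ α) ∂(gauss d) ≤
      ENNReal.ofReal (C * (1 + ‖v‖) ^ (0 : ℝ)) := by
  have hI : IntegrableOn (fun u : Vel d => ‖u‖ ^ α) (ball 0 1) := by
    refine integrableOn_ball_of_norm_le_rpow (C := 1) (α := -α) (by simpa using hd)
      (by simp; linarith) (ae_of_all _ fun u => ?_) (Measurable.aestronglyMeasurable (by fun_prop))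
    rw [neg_neg, one_mul, Real.norm_of_nonneg (by positivity)]
  set K : ℝ := 1 / (2 * Real.pi) ^ ((d : ℝ) / 2) with hK
  have hK0 : 0 ≤ K := by positivity
  have hMK : ∀ w : Vel d, maxwellian w ≤ K := by
    intro w
    unfold maxwellian
    refine mul_le_of_le_one_right hK0 (Real.exp_le_one_iff.2 ?_)
    have := sq_nonneg ‖w‖
    linarith
  set A := ∫⁻ u in ball (0 : Vel d) 1, ENNReal.ofReal (‖u‖ ^ α) with hA
  have hAt : A ≠ ⊤ :=
    ne_top_of_le_ne_top hI.hasFiniteIntegral.ne (lintegral_mono fun u => Real.ofReal_le_enorm _)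
  refine ⟨K * A.toReal + 1, by positivity, fun v => ?_⟩
  have hpt : ∀ w : Vel d, ENNReal.ofReal (‖v - w‖ ^ α) ≤
      (ball (0 : Vel d) 1).indicator (fun u => ENNReal.ofReal (‖u‖ ^ α)) (v - w) + 1 := by
    intro w
    rcases lt_or_ge ‖v - w‖ 1 with h | h
    · rw [Set.indicator_of_mem (by simpa using h)]
      exact le_self_add
    · refine le_add_left ?_
      rw [← ENNReal.ofReal_one]
      exact ENNReal.ofReal_le_ofReal (Real.rpow_le_one_of_one_le_of_nonpos h h2)
  have hm1 : Measurable ((ball (0 : Vel d) 1).indicator fun u => ENNReal.ofReal (‖u‖ ^ α)) :=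
    Measurable.indicator (by fun_prop) measurableSet_ball
  have hm2 : Measurable fun w : Vel d =>
      (ball (0 : Vel d) 1).indicator (fun u => ENNReal.ofReal (‖u‖ ^ α)) (v - w) :=
    hm1.comp (by fun_prop)
  calc _ ≤ ∫⁻ w, ((ball (0 : Vel d) 1).indicator (fun u => ENNReal.ofReal (‖u‖ ^ α)) (v - w) + 1)
        ∂(gauss d) := lintegral_mono hpt
    _ = (∫⁻ w, ENNReal.ofReal (maxwellian w) *
          (ball (0 : Vel d) 1).indicator (fun u => ENNReal.ofReal (‖u‖ ^ α)) (v - w)) + 1 := by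
        rw [lintegral_add_right _ measurable_const, lintegral_one, measure_univ,
          lintegral_gauss hm2]
    _ ≤ (∫⁻ w, ENNReal.ofReal K *
          (ball (0 : Vel d) 1).indicator (fun u => ENNReal.ofReal (‖u‖ ^ α)) (v - w)) + 1 := by
        gcongr with w
        exact hMK w
    _ = ENNReal.ofReal K * A + 1 := by
        rw [lintegral_const_mul _ hm2, lintegral_sub_left_eq_self (μ := volume)
          ((ball (0 : Vel d) 1).indicator fun u => ENNReal.ofReal (‖u‖ ^ α)) v,
          lintegral_indicator measurableSet_ball]
    _ = _ := by
        rw [Real.rpow_zero, mul_one, ENNReal.ofReal_add (by positivity) zero_le_one,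
          ENNReal.ofReal_mul hK0, ENNReal.ofReal_toReal hAt, ENNReal.ofReal_one]

theorem lintegral_collKer_fst (hd : 1 ≤ d) (hb : IsAngularKernel d b) (v : Vel d)
    {F : Vel d → ℝ≥0∞} (hF : Measurable F) :
    ∫⁻ p, F p.1 ∂(collKer d b v) = ∫⁻ w, F w ∂(gauss d) := by
  rw [lintegral_collKer hb.measurable v (F := fun p => F p.1) (by fun_prop)]
  refine lintegral_congr_ae ?_
  filter_upwards [ae_ne_gauss hd v] with w hw
  rw [lintegral_mul_const _ (measurable_angDensity_sph hb.measurable v w),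
    lintegral_angDensity hb hw, one_mul]

theorem map_pair_collJoint (hd : 1 ≤ d) (hb : IsAngularKernel d b) :
    (collJoint d b).map (fun q => (q.1, q.2.1)) = (gauss d).prod (gauss d) := by
  have hp : Measurable fun q : Vel d × Vel d × Sph d => (q.1, q.2.1) := by fun_prop
  refine Measure.ext_of_lintegral _ fun F hF => ?_
  have h1 := Measure.lintegral_compProd (μ := gauss d) (κ := collKer d b) (hF.comp hp)
  simp only [Function.comp_apply] at h1
  rw [lintegral_map hF hp, collJoint, h1, lintegral_prod _ hF.aemeasurable]
  exact lintegral_congr fun v => lintegral_collKer_fst hd hb v (F := fun w => F (v, w))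
    (hF.comp (by fun_prop))

theorem measurePreserving_pair_collJoint (hd : 1 ≤ d) (hb : IsAngularKernel d b) :
    MeasurePreserving (fun q : Vel d × Vel d × Sph d => (q.1, q.2.1)) (collJoint d b)
      ((gauss d).prod (gauss d)) :=
  ⟨by fun_prop, map_pair_collJoint hd hb⟩

/-- The integrand does not see σ, so the law reduces to two independent Gaussians, and integrating
out v⋆ leaves the weight (1 + |v|)^s. -/
theorem integrable_weight_mul (hd : 1 ≤ d) (hb : IsAngularKernel d b)
    (hC : ∀ v : Vel d, ∫⁻ w, ENNReal.ofReal (‖v - w‖ ^ α) ∂(gauss d) ≤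
      ENNReal.ofReal (C * (1 + ‖v‖) ^ s)) (hC0 : 0 ≤ C) {k : Vel d → ℝ} (hk : Measurable k)
    (hi : Integrable (fun v => (1 + ‖v‖) ^ s * k v) (gauss d)) :
    Integrable (fun q => ‖q.1 - q.2.1‖ ^ α * k q.1) (collJoint d b) := by
  have hF : Measurable fun x : Vel d × Vel d => ‖x.1 - x.2‖ ^ α * k x.1 := by fun_prop
  suffices h : Integrable (fun x : Vel d × Vel d => ‖x.1 - x.2‖ ^ α * k x.1)
      ((gauss d).prod (gauss d)) from
    (measurePreserving_pair_collJoint hd hb).integrable_comp_of_integrable h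
  refine ⟨hF.aestronglyMeasurable, ?_⟩
  rw [HasFiniteIntegral, lintegral_prod _ hF.enorm.aemeasurable]
  refine lt_of_le_of_lt ?_ (hi.const_mul C).2
  refine lintegral_mono fun v => ?_
  have e : ∀ w, ‖‖v - w‖ ^ α * k v‖ₑ = ENNReal.ofReal (‖v - w‖ ^ α) * ‖k v‖ₑ := fun w => by
    rw [enorm_mul, Real.enorm_of_nonneg (Real.rpow_nonneg (norm_nonneg _) _)]
  simp_rw [e]
  rw [lintegral_mul_const _ (by fun_prop)]
  refine (mul_le_mul_left (hC v) _).trans (le_of_eq ?_)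
  have e2 : 0 ≤ C * (1 + ‖v‖) ^ s := by positivity
  rw [← mul_assoc, enorm_mul (C * (1 + ‖v‖) ^ s), Real.enorm_of_nonneg e2]

theorem log_maxwellian (v : Vel d) :
    Real.log (maxwellian v) = -((d : ℝ) / 2 * Real.log (2 * Real.pi)) - ‖v‖ ^ 2 / 2 := by
  have h : (0 : ℝ) < 2 * Real.pi := by positivity
  rw [maxwellian, Real.log_mul (by positivity) (Real.exp_pos _).ne', Real.log_exp, one_div,
    Real.log_inv, Real.log_rpow h]
  ring

/-- The constant in the quadratic bound of `log M`. -/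
def logConst (d : ℕ) : ℝ := (d : ℝ) / 2 * Real.log (2 * Real.pi) + 1

theorem logConst_pos : 0 < logConst d := by
  have : 0 ≤ Real.log (2 * Real.pi) := Real.log_nonneg (by linarith [Real.pi_gt_three])
  unfold logConst; positivity

theorem log_maxwellian_nonpos (v : Vel d) : Real.log (maxwellian v) ≤ 0 := by
  have : 0 ≤ Real.log (2 * Real.pi) := Real.log_nonneg (by linarith [Real.pi_gt_three])
  have h2 : 0 ≤ (d : ℝ) / 2 * Real.log (2 * Real.pi) := by positivity
  rw [log_maxwellian]
  nlinarith [sq_nonneg ‖v‖]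

theorem abs_log_maxwellian_le (v : Vel d) :
    |Real.log (maxwellian v)| ≤ logConst d * (1 + ‖v‖ ^ 2) := by
  rw [abs_of_nonpos (log_maxwellian_nonpos v), log_maxwellian, logConst]
  have : 0 ≤ Real.log (2 * Real.pi) := Real.log_nonneg (by linarith [Real.pi_gt_three])
  have h2 : 0 ≤ (d : ℝ) / 2 * Real.log (2 * Real.pi) := by positivity
  nlinarith [sq_nonneg ‖v‖, mul_nonneg h2 (sq_nonneg ‖v‖)]

theorem one_add_norm_rpow_add_two (s : ℝ) (v : Vel d) :
    (1 + ‖v‖) ^ (s + 2) = (1 + ‖v‖) ^ s * (1 + ‖v‖) ^ 2 := by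
  rw [Real.rpow_add (by positivity)]
  norm_num

theorem norm_one_add_norm_rpow (s : ℝ) (v : Vel d) : ‖(1 + ‖v‖) ^ s‖ = (1 + ‖v‖) ^ s :=
  Real.norm_of_nonneg (by positivity)

theorem one_add_norm_le_bracket (v : Vel d) : 1 + ‖v‖ ≤ 2 * bracket v := by
  have h1 : 1 ≤ bracket v := Real.one_le_sqrt.2 (by nlinarith [sq_nonneg ‖v‖])
  have h2 : ‖v‖ ≤ bracket v := Real.le_sqrt_of_sq_le (by linarith)
  linarith

/-- The class of densities in the theorem, with integrability in Bochner form. -/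
structure HasMoments (s : ℝ) (f : Vel d → ℝ) : Prop where
  measurable : Measurable f
  nonneg : ∀ v, 0 ≤ f v
  mass : ∫ v, f v = 1
  moment : Integrable fun v => (1 + ‖v‖) ^ (s + 2) * f v
  entropy : Integrable fun v => (1 + ‖v‖) ^ s * (f v * Real.log (f v))

theorem integrable_of_bracket {k : Vel d → ℝ} (hk : Measurable k) (hs : 0 ≤ s)
    (h : ∫⁻ v, ENNReal.ofReal (bracket v ^ s * |k v|) < ⊤) :
    Integrable fun v => (1 + ‖v‖) ^ s * k v := by
  have hb0 : ∀ v : Vel d, 0 ≤ bracket v := fun v => Real.sqrt_nonneg _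
  have h1 : Integrable fun v => bracket v ^ s * |k v| := by
    refine ⟨Measurable.aestronglyMeasurable ?_, ?_⟩
    · unfold bracket; fun_prop
    · rw [hasFiniteIntegral_iff_ofReal (ae_of_all _ fun v => ?_)]
      · exact h
      · exact mul_nonneg (Real.rpow_nonneg (hb0 v) _) (abs_nonneg _)
  refine (h1.const_mul (2 ^ s)).mono' (Measurable.aestronglyMeasurable (by fun_prop))
    (ae_of_all _ fun v => ?_)
  rw [norm_mul, Real.norm_of_nonneg (by positivity), ← mul_assoc,
    ← Real.mul_rpow zero_le_two (hb0 v), Real.norm_eq_abs]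
  gcongr
  exact one_add_norm_le_bracket v

theorem hasMoments_of_mem (hs : 0 ≤ s) (hu : IsUnitMass f) (h1 : MemL1LogL s f)
    (h2 : MemL1 (s + 2) f) : HasMoments s f where
  measurable := h2.1
  nonneg := hu.1
  mass := hu.2
  moment := integrable_of_bracket h2.1 (by linarith) h2.2
  entropy := by
    have hm := h2.1
    refine integrable_of_bracket (by fun_prop) hs ?_
    refine lt_of_eq_of_lt ?_ h1.2
    refine lintegral_congr fun v => ?_
    rw [abs_mul, ← mul_assoc, Real.log_abs]

namespace HasMoments

theorem mono {s t : ℝ} (H : HasMoments t f) (hst : s ≤ t) : HasMoments s f where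
  measurable := H.measurable
  nonneg := H.nonneg
  mass := H.mass
  moment := by
    have hm := H.measurable
    refine H.moment.mono (Measurable.aestronglyMeasurable (by fun_prop)) (ae_of_all _ fun v => ?_)
    rw [norm_mul, norm_mul ((1 + ‖v‖) ^ _), norm_one_add_norm_rpow, norm_one_add_norm_rpow]
    gcongr
    linarith [norm_nonneg v]
  entropy := by
    have hm := H.measurable
    refine H.entropy.mono (Measurable.aestronglyMeasurable (by fun_prop)) (ae_of_all _ fun v => ?_)
    rw [norm_mul, norm_mul ((1 + ‖v‖) ^ _), norm_one_add_norm_rpow, norm_one_add_norm_rpow]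
    gcongr
    linarith [norm_nonneg v]

theorem integrable_pow (H : HasMoments s f) : Integrable fun v => (1 + ‖v‖) ^ s * f v := by
  have hm := H.measurable
  refine H.moment.mono (Measurable.aestronglyMeasurable (by fun_prop)) (ae_of_all _ fun v => ?_)
  rw [norm_mul, norm_mul, norm_one_add_norm_rpow, norm_one_add_norm_rpow]
  gcongr <;> linarith [norm_nonneg v]

theorem integrable (H : HasMoments s f) : Integrable f := by
  -- A non-integrable function has Bochner integral 0, contradicting unit mass.
  by_contra h
  have := H.mass
  rw [integral_undef h] at this
  exact zero_ne_one this

/-- Since log M grows quadratically, this consumes the two extra moments. -/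
theorem integrable_log_maxwellian (H : HasMoments s f) :
    Integrable fun v => (1 + ‖v‖) ^ s * (f v * Real.log (maxwellian v)) := by
  have hm := H.measurable
  refine (H.moment.const_mul (logConst d)).mono' (Measurable.aestronglyMeasurable (by fun_prop))
    (ae_of_all _ fun v => ?_)
  have h1 := abs_log_maxwellian_le v
  have h2 := H.nonneg v
  have h3 := logConst_pos (d := d)
  rw [norm_mul, norm_mul, Real.norm_of_nonneg (by positivity), Real.norm_of_nonneg h2,
    Real.norm_eq_abs, one_add_norm_rpow_add_two]
  have h4 : logConst d * (1 + ‖v‖ ^ 2) ≤ logConst d * (1 + ‖v‖) ^ 2 := by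
    gcongr
    nlinarith [norm_nonneg v]
  calc _ ≤ (1 + ‖v‖) ^ s * (f v * (logConst d * (1 + ‖v‖) ^ 2)) := by
        gcongr; exact h1.trans h4
    _ = _ := by ring

theorem measurable_div (H : HasMoments s f) : Measurable fun v => f v / maxwellian v := by
  have := H.measurable
  fun_prop

theorem div_nonneg (H : HasMoments s f) (v : Vel d) : 0 ≤ f v / maxwellian v :=
  _root_.div_nonneg (H.nonneg v) (maxwellian_pos v).le

theorem integrable_div (H : HasMoments s f) :
    Integrable (fun v => (1 + ‖v‖) ^ s * (f v / maxwellian v)) (gauss d) := by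
  rw [integrable_gauss_iff]
  refine H.integrable_pow.congr (ae_of_all _ fun v => ?_)
  have := (maxwellian_pos v).ne'
  field_simp

end HasMoments

theorem maxwellian_mul_klFun (f : Vel d → ℝ) (v : Vel d) :
    maxwellian v * klFun (f v / maxwellian v) =
      f v * Real.log (f v) - f v * Real.log (maxwellian v) + maxwellian v - f v := by
  have hM := (maxwellian_pos v).ne'
  rw [klFun_apply]
  rcases eq_or_ne (f v) 0 with h | h
  · rw [h]; simp
  · rw [Real.log_div h hM]
    field_simp

theorem HasMoments.integrable_klFun (H : HasMoments s f) (hs : 0 ≤ s) :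
    Integrable (fun v => (1 + ‖v‖) ^ s * klFun (f v / maxwellian v)) (gauss d) := by
  rw [integrable_gauss_iff]
  have h1 := integrable_gauss_iff.1 (integrable_one_add_norm_rpow (d := d) hs)
  have h2 := ((H.entropy.sub H.integrable_log_maxwellian).add h1).sub H.integrable_pow
  refine h2.congr (ae_of_all _ fun v => ?_)
  have := maxwellian_mul_klFun f v
  simp only [Pi.add_apply, Pi.sub_apply]
  linear_combination -((1 + ‖v‖) ^ s) * this

theorem HasMoments.integrable_joint (H : HasMoments s f) (hd : 1 ≤ d) (hb : IsAngularKernel d b)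
    (hC : ∀ v : Vel d, ∫⁻ w, ENNReal.ofReal (‖v - w‖ ^ α) ∂(gauss d) ≤
      ENNReal.ofReal (C * (1 + ‖v‖) ^ s)) (hC0 : 0 ≤ C) :
    Integrable (fun q => ‖q.1 - q.2.1‖ ^ α * (f q.1 / maxwellian q.1)) (collJoint d b) :=
  integrable_weight_mul hd hb hC hC0 H.measurable_div H.integrable_div

theorem HasMoments.integrable_joint_klFun (H : HasMoments s f) (hs : 0 ≤ s) (hd : 1 ≤ d)
    (hb : IsAngularKernel d b)
    (hC : ∀ v : Vel d, ∫⁻ w, ENNReal.ofReal (‖v - w‖ ^ α) ∂(gauss d) ≤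
      ENNReal.ofReal (C * (1 + ‖v‖) ^ s)) (hC0 : 0 ≤ C) :
    Integrable (fun q => ‖q.1 - q.2.1‖ ^ α * klFun (f q.1 / maxwellian q.1)) (collJoint d b) :=
  integrable_weight_mul hd hb hC hC0 (measurable_klFun.comp H.measurable_div)
    (H.integrable_klFun hs)

theorem HasMoments.entropyProduction_eq (H : HasMoments s f) (hs : 0 ≤ s) (hd : 1 ≤ d)
    (hb : IsAngularKernel d b)
    (hC : ∀ v : Vel d, ∫⁻ w, ENNReal.ofReal (‖v - w‖ ^ α) ∂(gauss d) ≤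
      ENNReal.ofReal (C * (1 + ‖v‖) ^ s)) (hC0 : 0 ≤ C) :
    HasExtIntegral (productionIntegrand b α f) ∧
      entropyProduction b α f = (prodTotal b α fun v => f v / maxwellian v : EReal) :=
  ⟨hasExtIntegral_productionIntegrand hd hb H.measurable_div H.div_nonneg (fun _ => rfl)
    (H.integrable_joint hd hb hC hC0) (H.integrable_joint_klFun hs hd hb hC hC0),
  LinBoltz.entropyProduction_eq hd hb H.measurable_div H.div_nonneg (fun _ => rfl)
    (H.integrable_joint hd hb hC hC0) (H.integrable_joint_klFun hs hd hb hC hC0)⟩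

theorem HasMoments.relEntropy_eq (H : HasMoments 0 f) :
    relEntropy f = ENNReal.ofReal (∫ v, klFun (f v / maxwellian v) ∂(gauss d)) := by
  have h1 : Integrable (fun v => klFun (f v / maxwellian v)) (gauss d) := by
    simpa using H.integrable_klFun le_rfl
  have h0 : ∀ v, 0 ≤ klFun (f v / maxwellian v) := fun v => klFun_nonneg (H.div_nonneg v)
  rw [integral_gauss, ofReal_integral_eq_lintegral_ofReal (integrable_gauss_iff.1 h1)
    (ae_of_all _ fun v => mul_nonneg (maxwellian_pos v).le (h0 v)), relEntropy]
  refine lintegral_congr fun v => ?_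
  rw [klFun_apply]
  ring_nf

end Moments

/-! ### Lower bound by relative entropy and interpolation between exponents. -/

section Bounds

open ProbabilityTheory Filter Topology InformationTheory

variable {d : ℕ} {b : ℝ → ℝ} {α s C : ℝ} {f h : Vel d → ℝ}

theorem bregman_of_pos {x y : ℝ} (hy : 0 < y) :
    bregman x y = ENNReal.ofReal (klFun x - klFun y - (x - y) * Real.log y) := by
  rw [bregman, if_neg hy.ne']

/-- Among all reference values, the mean minimises the averaged Bregman divergence. -/
theorem lintegral_klFun_le_bregman {Ω : Type*} [MeasurableSpace Ω] {κ : Measure Ω}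
    [IsProbabilityMeasure κ] {X : Ω → ℝ} (h0 : ∀ p, 0 ≤ X p) (hX : Integrable X κ)
    (hk : Integrable (fun p => klFun (X p)) κ) {y : ℝ} (hy : 0 ≤ y) :
    ∫⁻ p, ENNReal.ofReal (klFun (X p)) ∂κ ≤
      (∫⁻ p, bregman (X p) y ∂κ) + ENNReal.ofReal (klFun (∫ p, X p ∂κ)) := by
  have hkn : ∀ p, 0 ≤ klFun (X p) := fun p => klFun_nonneg (h0 p)
  have hmean : 0 ≤ ∫ p, X p ∂κ := integral_nonneg h0
  rcases hy.eq_or_lt with rfl | hy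
  · have hbr : ∀ x, bregman x 0 = if x = 0 then 0 else ⊤ := fun x => by simp [bregman]
    rcases hmean.eq_or_lt with hI | hI
    · have hz := (integral_eq_zero_iff_of_nonneg h0 hX).1 hI.symm
      rw [← hI]
      refine le_add_left ?_
      rw [lintegral_congr_ae (g := fun _ => ENNReal.ofReal (klFun 0)) ?_, lintegral_const,
        measure_univ, mul_one]
      filter_upwards [hz] with p hp
      rw [hp]; rfl
    · have h1 : ∫⁻ p, ENNReal.ofReal (X p) ∂κ ≠ 0 := by
        rw [← ofReal_integral_eq_lintegral_ofReal hX (ae_of_all _ h0)]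
        exact (ENNReal.ofReal_pos.2 hI).ne'
      have e1 : ∫⁻ p, bregman (X p) 0 ∂κ = ⊤ := by
        rw [eq_top_iff]
        calc ⊤ = ⊤ * ∫⁻ p, ENNReal.ofReal (X p) ∂κ := (ENNReal.top_mul h1).symm
          _ = ∫⁻ p, ⊤ * ENNReal.ofReal (X p) ∂κ :=
            (lintegral_const_mul'' _ hX.aemeasurable.ennreal_ofReal).symm
          _ ≤ _ := by
            refine lintegral_mono fun p => ?_
            rw [hbr]
            split_ifs with h
            · rw [h]; simp
            · exact le_top
      rw [e1, top_add]
      exact le_top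
  · have hq0 : ∀ p, 0 ≤ klFun (X p) - klFun y - (X p - y) * Real.log y := by
      intro p
      have := klFun_sub_le hy (h0 p)
      nlinarith
    have i1 := (hX.sub (integrable_const y)).mul_const (Real.log y)
    have i2 : Integrable (fun p => klFun (X p) - klFun y - (X p - y) * Real.log y) κ :=
      (hk.sub (integrable_const (klFun y))).sub i1
    -- The mean divergence from y is E klFun(X) minus klFun(E X), plus the divergence of E X from y.
    -- The latter is nonnegative by `klFun_sub_le`.
    have e2 : ∫ p, (klFun (X p) - klFun y - (X p - y) * Real.log y) ∂κ =
        (∫ p, klFun (X p) ∂κ) - klFun y - ((∫ p, X p ∂κ) - y) * Real.log y := by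
      have a1 := integral_sub (hk.sub (integrable_const (klFun y))) i1
      have a2 := integral_sub hk (integrable_const (klFun y))
      have a3 := integral_sub hX (integrable_const y)
      simp only [Pi.sub_apply, integral_mul_const] at a1 a2 a3
      rw [a1, a2, a3]
      simp
    have e1 : ∫⁻ p, bregman (X p) y ∂κ = ENNReal.ofReal ((∫ p, klFun (X p) ∂κ) - klFun y -
        ((∫ p, X p ∂κ) - y) * Real.log y) := by
      rw [← e2, ofReal_integral_eq_lintegral_ofReal i2 (ae_of_all _ hq0)]
      exact lintegral_congr fun p => bregman_of_pos hy
    have hn : 0 ≤ (∫ p, klFun (X p) ∂κ) - klFun y - ((∫ p, X p ∂κ) - y) * Real.log y := by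
      rw [← e2]; exact integral_nonneg hq0
    rw [e1, ← ofReal_integral_eq_lintegral_ofReal hk (ae_of_all _ hkn),
      ← ENNReal.ofReal_add hn (klFun_nonneg hmean)]
    refine ENNReal.ofReal_le_ofReal ?_
    have := klFun_sub_le hy hmean
    nlinarith

/-- The entropy production of the Maxwell molecule type operator controls the relative entropy. -/
theorem half_integral_klFun_le_prodTotal (hd : 1 ≤ d) (hb : IsAngularKernel d b)
    (hm : Measurable h) (h0 : ∀ v, 0 ≤ h v) (hi : Integrable h (gauss d))
    (h1 : ∫ v, h v ∂(gauss d) = 1) (hk : Integrable (fun v => klFun (h v)) (gauss d)) :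
    ENNReal.ofReal (1 / 2 * ∫ v, klFun (h v) ∂(gauss d)) ≤ prodTotal b 0 h := by
  have := isMarkovKernel_collKer hd hb
  have hkm : Measurable fun v => klFun (h v) := measurable_klFun.comp hm
  have hI0 : 0 ≤ ∫ v, klFun (h v) ∂(gauss d) := integral_nonneg fun v => klFun_nonneg (h0 v)
  have hkm' : Measurable fun v => ENNReal.ofReal (klFun (h v)) := by fun_prop
  -- As v' has the Gaussian law, the entropy of h may be evaluated at v' and conditioned on v.
  have e1 : ENNReal.ofReal (∫ v, klFun (h v) ∂(gauss d)) = ∫⁻ v, ∫⁻ p,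
      ENNReal.ofReal (klFun (h (vPrime v p.1 p.2))) ∂(collKer d b v) ∂(gauss d) := by
    rw [ofReal_integral_eq_lintegral_ofReal hk (ae_of_all _ fun v => klFun_nonneg (h0 v)),
      ← (measurePreserving_vPrime hd hb).lintegral_comp hkm']
    exact Measure.lintegral_compProd (hkm'.comp measurable_vPrime)
  have hpm := measurable_prodIntegrand (α := 0) hm
  have e2 : prodTotal b 0 h = ∫⁻ v, ∫⁻ p, bregman (h (vPrime v p.1 p.2)) (h v) ∂(collKer d b v)
      ∂(gauss d) := by
    rw [prodTotal, collJoint, Measure.lintegral_compProd hpm]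
    simp
  have hKm : Measurable fun v => ENNReal.ofReal (klFun (gainK b h v)) :=
    ENNReal.measurable_ofReal.comp (measurable_klFun.comp (measurable_gainK hm))
  have key : ENNReal.ofReal (∫ v, klFun (h v) ∂(gauss d)) ≤
      prodTotal b 0 h + ENNReal.ofReal (1 / 2 * ∫ v, klFun (h v) ∂(gauss d)) := by
    refine le_trans ?_ (add_le_add_right
      (lintegral_klFun_gainK_le hd hb hm h0 hi h1 hk) (prodTotal b 0 h))
    rw [e1, e2, ← lintegral_add_right _ hKm]
    refine lintegral_mono_ae ?_
    filter_upwards [ae_integrable_collKer hd hb hi, ae_integrable_collKer hd hb hk] with v i1 i2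
    exact lintegral_klFun_le_bregman (fun p => h0 _) i1 i2 (h0 v)
  have e3 : ∫ v, klFun (h v) ∂(gauss d) = 1 / 2 * (∫ v, klFun (h v) ∂(gauss d)) +
      1 / 2 * (∫ v, klFun (h v) ∂(gauss d)) := by ring
  rw [e3, ENNReal.ofReal_add (by positivity) (by positivity), ← e3] at key
  -- H ≤ D_0 + H/2 with H finite, so half of H can be cancelled.
  exact (ENNReal.add_le_add_iff_right ENNReal.ofReal_ne_top).1 key

/-- Hölder with weight θ = μ/(μ - γ): θγ + (1 - θ)μ = 0, so the powers of the relative speed combine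
to 1 off the diagonal. -/
theorem prodTotal_zero_le {γ μ : ℝ} (hd : 1 ≤ d) (hb : IsAngularKernel d b) (hm : Measurable h)
    (hγ : γ < 0) (hμ : 0 < μ) :
    prodTotal b 0 h ≤ prodTotal b γ h ^ (μ / (μ - γ)) * prodTotal b μ h ^ (-γ / (μ - γ)) := by
  have hp : 0 < μ - γ := by linarith
  have hθ : 0 ≤ μ / (μ - γ) := by positivity
  have hθ' : 0 ≤ -γ / (μ - γ) := div_nonneg (by linarith) hp.le
  have hsum : μ / (μ - γ) + -γ / (μ - γ) = 1 := by field_simp; ring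
  refine le_trans (le_of_eq ?_) (ENNReal.lintegral_mul_norm_pow_le
    (measurable_prodIntegrand hm).aemeasurable (measurable_prodIntegrand hm).aemeasurable
    hθ hθ' hsum)
  refine lintegral_congr_ae ?_
  filter_upwards [ae_ne_collJoint hd hb] with q hq
  have hr : 0 < ‖q.1 - q.2.1‖ := norm_pos_iff.2 (sub_ne_zero.2 hq)
  rw [ENNReal.mul_rpow_of_nonneg _ _ hθ, ENNReal.mul_rpow_of_nonneg _ _ hθ', mul_mul_mul_comm,
    ← ENNReal.rpow_add_of_nonneg _ _ hθ hθ', hsum, ENNReal.rpow_one,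
    ENNReal.ofReal_rpow_of_nonneg (by positivity) hθ,
    ENNReal.ofReal_rpow_of_nonneg (by positivity) hθ', ← ENNReal.ofReal_mul (by positivity),
    ← Real.rpow_mul hr.le, ← Real.rpow_mul hr.le, ← Real.rpow_add hr]
  congr 3
  field_simp
  ring

/-- Solves the interpolation inequality for y. If z = ∞ its negative power is 0; if z = 0 the
hypothesis forces x = 0, and 0 · ∞ = 0. -/
theorem rpow_mul_rpow_neg_le {x y z : ℝ≥0∞} {γ μ : ℝ} (hγ : γ < 0) (hμ : 0 < μ)
    (h : x ≤ y ^ (μ / (μ - γ)) * z ^ (-γ / (μ - γ))) :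
    x ^ ((μ - γ) / μ) * z ^ (γ / μ) ≤ y := by
  have hp : 0 < μ - γ := by linarith
  have hq : 0 < (μ - γ) / μ := by positivity
  have hneg : γ / μ < 0 := div_neg_of_neg_of_pos hγ hμ
  rcases eq_or_ne z ⊤ with rfl | hz
  · rw [ENNReal.top_rpow_of_neg hneg, mul_zero]; exact zero_le
  rcases eq_or_ne z 0 with rfl | hz0
  · rw [ENNReal.zero_rpow_of_pos (div_pos (by linarith) hp), mul_zero] at h
    rw [nonpos_iff_eq_zero.1 h, ENNReal.zero_rpow_of_pos hq, zero_mul]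
    exact zero_le
  have h2 := ENNReal.rpow_le_rpow h hq.le
  rw [ENNReal.mul_rpow_of_nonneg _ _ hq.le, ← ENNReal.rpow_mul, ← ENNReal.rpow_mul] at h2
  have e1 : μ / (μ - γ) * ((μ - γ) / μ) = 1 := by field_simp
  have e2 : -γ / (μ - γ) * ((μ - γ) / μ) = -γ / μ := by field_simp
  rw [e1, e2, ENNReal.rpow_one] at h2
  calc _ ≤ y * z ^ (-γ / μ) * z ^ (γ / μ) := by gcongr
    _ = y := by
      rw [mul_assoc, ← ENNReal.rpow_add _ _ hz0 hz]
      have : -γ / μ + γ / μ = 0 := by ring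
      rw [this, ENNReal.rpow_zero, mul_one]

/-! ### Upper bound for the entropy production. -/

section UpperBound

variable {μ : ℝ}

/-- The real-valued difference between `K_μ f log f` and `L_μ f log (f / M)`. -/
def gainRem (b : ℝ → ℝ) (μ : ℝ) (f : Vel d → ℝ) (v : Vel d) : ℝ :=
  gainOp b μ f v * Real.log (maxwellian v) +
    (f v * Real.log (f v) - f v * Real.log (maxwellian v)) *
      ∫ p, ‖v - p.1‖ ^ μ ∂(collKer d b v)

theorem linBoltzmann_eq_gainOp_sub (hb : IsAngularKernel d b) {v : Vel d}
    (i1 : Integrable (fun p : Vel d × Sph d => ‖v - p.1‖ ^ μ * (f v / maxwellian v))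
      (collKer d b v))
    (i2 : Integrable (fun p : Vel d × Sph d => ‖v - p.1‖ ^ μ *
      (f (vPrime v p.1 p.2) / maxwellian (vPrime v p.1 p.2))) (collKer d b v)) :
    linBoltzmann b μ f v = gainOp b μ f v - f v * ∫ p, ‖v - p.1‖ ^ μ ∂(collKer d b v) := by
  rw [linBoltzmann_eq hb (h := fun v => f v / maxwellian v) (fun _ => rfl),
    gainOp_eq hb (h := fun v => f v / maxwellian v) (fun _ => rfl)]
  simp_rw [mul_sub]
  rw [integral_sub i2 i1, integral_mul_const, mul_sub]
  have := (maxwellian_pos v).ne'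
  field_simp

/-- Passing from log(f/M) to log f and restoring the loss term alters the integrand by a real number
only, so the possibly infinite part G is shared with the entropy production. -/
theorem gainLogIntegrand_eq (hb : IsAngularKernel d b) (h0 : ∀ v, 0 ≤ f v) {v : Vel d}
    (i1 : Integrable (fun p : Vel d × Sph d => ‖v - p.1‖ ^ μ * (f v / maxwellian v))
      (collKer d b v))
    (i2 : Integrable (fun p : Vel d × Sph d => ‖v - p.1‖ ^ μ *
      (f (vPrime v p.1 p.2) / maxwellian (vPrime v p.1 p.2))) (collKer d b v))
    {G : ℝ≥0∞} {r : ℝ} (hG : productionIntegrand b μ f v = -((G : EReal) + (r : EReal))) :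
    gainLogIntegrand b μ f v = -((G : EReal) + ((r - gainRem b μ f v : ℝ) : EReal)) := by
  have hL := linBoltzmann_eq_gainOp_sub hb i1 i2
  have hM := maxwellian_pos v
  suffices h : gainLogIntegrand b μ f v =
      productionIntegrand b μ f v + (gainRem b μ f v : EReal) by
    rw [h, hG]
    induction G with
    | top => rw [EReal.coe_ennreal_top, EReal.top_add_coe, EReal.top_add_coe, EReal.neg_top,
        EReal.bot_add]
    | coe g =>
      have c : (((g : ℝ≥0∞) : EReal)) = ((g : ℝ) : EReal) := rfl
      rw [c, ← EReal.coe_add, ← EReal.coe_add, ← EReal.coe_neg, ← EReal.coe_neg, ← EReal.coe_add]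
      congr 1
      ring
  rw [gainLogIntegrand, productionIntegrand, hL, gainRem]
  rcases (h0 v).eq_or_lt with hf | hf
  · rw [← hf]
    simp only [zero_div, zero_mul, sub_zero, add_zero, elog_zero]
    have hK : 0 ≤ gainOp b μ f v := by
      rw [gainOp_eq hb (h := fun v => f v / maxwellian v) (fun _ => rfl)]
      refine mul_nonneg hM.le (integral_nonneg fun p => ?_)
      exact mul_nonneg (Real.rpow_nonneg (norm_nonneg _) _)
        (div_nonneg (h0 _) (maxwellian_pos _).le)
    rcases hK.eq_or_lt with hK | hK
    · rw [← hK]; simp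
    · rw [EReal.coe_mul_bot_of_pos hK, EReal.bot_add]
  · rw [elog_of_pos hf, elog_of_pos (div_pos hf hM), ← EReal.coe_mul, ← EReal.coe_mul,
      ← EReal.coe_add, Real.log_div hf.ne' hM.ne']
    congr 1
    ring

theorem integral_collKer_rpow_le (hd : 1 ≤ d) (hb : IsAngularKernel d b) (hμ : 0 ≤ μ)
    (v : Vel d) :
    ∫ p, ‖v - p.1‖ ^ μ ∂(collKer d b v) ≤ gaussMoment d μ * (1 + ‖v‖) ^ μ := by
  have hg := one_le_gaussMoment (d := d) hμ
  rw [integral_eq_lintegral_of_nonneg_ae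
    (ae_of_all _ fun p => Real.rpow_nonneg (norm_nonneg _) _)
    (Measurable.aestronglyMeasurable (by fun_prop))]
  refine ENNReal.toReal_le_of_le_ofReal (by positivity) ?_
  rw [lintegral_collKer_fst hd hb v (F := fun w => ENNReal.ofReal (‖v - w‖ ^ μ)) (by fun_prop)]
  exact lintegral_norm_sub_rpow_le hμ v

/-- By reversibility one may instead weight f(v) by log M(v'). Energy conservation bounds this
logarithm by a constant times (1 + |v|)²(1 + |v⋆|)², which the moment of order μ + 2 and Gaussian
moments absorb. -/
theorem HasMoments.integrable_gain_log (H : HasMoments μ f) (hμ : 0 ≤ μ) (hd : 1 ≤ d)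
    (hb : IsAngularKernel d b) :
    Integrable (fun q => ‖q.1 - q.2.1‖ ^ μ *
      (f (vPrime q.1 q.2.1 q.2.2) / maxwellian (vPrime q.1 q.2.1 q.2.2)) *
        Real.log (maxwellian q.1)) (collJoint d b) := by
  have hm := H.measurable
  have hF : Measurable fun x : Vel d × Vel d × Vel d × Vel d × ℝ =>
      ‖x.1 - x.2.1‖ ^ μ * (f x.1 / maxwellian x.1) * Real.log (maxwellian x.2.2.1) := by fun_prop
  have h1 := integrable_map_measure (μ := collJoint d b)
    (f := fun q : Vel d × Vel d × Sph d => collData q.1 q.2.1 q.2.2) hF.aestronglyMeasurable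
    measurable_collData.aemeasurable
  have h2 := integrable_map_measure (μ := collJoint d b)
    (f := fun q : Vel d × Vel d × Sph d => collDataInv q.1 q.2.1 q.2.2) hF.aestronglyMeasurable
    measurable_collDataInv.aemeasurable
  rw [map_collData_eq hd hb.measurable] at h1
  have h3 : Integrable ((fun x : Vel d × Vel d × Vel d × Vel d × ℝ =>
      ‖x.1 - x.2.1‖ ^ μ * (f x.1 / maxwellian x.1) * Real.log (maxwellian x.2.2.1)) ∘
      fun q : Vel d × Vel d × Sph d => collData q.1 q.2.1 q.2.2) (collJoint d b) := by
    have i1 : Integrable (fun v => (1 + ‖v‖) ^ (μ + 2) * (f v / maxwellian v)) (gauss d) := by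
      rw [integrable_gauss_iff]
      refine H.moment.congr (ae_of_all _ fun v => ?_)
      have := (maxwellian_pos v).ne'
      field_simp
    have i2 := i1.mul_prod (integrable_one_add_norm_rpow (d := d) (s := μ + 2) (by linarith))
    have i3 := (measurePreserving_pair_collJoint hd hb).integrable_comp_of_integrable i2
    refine (i3.const_mul (logConst d)).mono' (hF.comp measurable_collData).aestronglyMeasurable
      (ae_of_all _ fun q => ?_)
    have a1 := norm_sub_rpow_le hμ q.1 q.2.1
    have a2 := abs_log_maxwellian_le (vPrime q.1 q.2.1 q.2.2)
    have a3 := norm_sq_vPrime_add q.1 q.2.1 q.2.2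
    have a4 : 1 + ‖vPrime q.1 q.2.1 q.2.2‖ ^ 2 ≤ (1 + ‖q.1‖) ^ 2 * (1 + ‖q.2.1‖) ^ 2 := by
      have b1 := norm_nonneg q.1
      have b2 := norm_nonneg q.2.1
      have b3 : 1 + ‖q.1‖ ^ 2 + ‖q.2.1‖ ^ 2 ≤ (1 + ‖q.1‖ ^ 2) * (1 + ‖q.2.1‖ ^ 2) := by
        nlinarith [mul_nonneg (sq_nonneg ‖q.1‖) (sq_nonneg ‖q.2.1‖)]
      have b4 : 1 + ‖q.1‖ ^ 2 ≤ (1 + ‖q.1‖) ^ 2 := by nlinarith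
      have b5 : 1 + ‖q.2.1‖ ^ 2 ≤ (1 + ‖q.2.1‖) ^ 2 := by nlinarith
      have b6 := mul_le_mul b4 b5 (by positivity) (by positivity)
      nlinarith [sq_nonneg ‖wPrime q.1 q.2.1 q.2.2‖]
    have a5 := H.div_nonneg q.1
    have a6 := logConst_pos (d := d)
    change ‖‖q.1 - q.2.1‖ ^ μ * (f q.1 / maxwellian q.1) *
      Real.log (maxwellian (vPrime q.1 q.2.1 q.2.2))‖ ≤ logConst d *
        ((1 + ‖q.1‖) ^ (μ + 2) * (f q.1 / maxwellian q.1) * (1 + ‖q.2.1‖) ^ (μ + 2))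
    rw [norm_mul, Real.norm_of_nonneg (mul_nonneg (Real.rpow_nonneg (norm_nonneg _) _) a5),
      one_add_norm_rpow_add_two, one_add_norm_rpow_add_two, Real.norm_eq_abs]
    calc _ ≤ (1 + ‖q.1‖) ^ μ * (1 + ‖q.2.1‖) ^ μ * (f q.1 / maxwellian q.1) *
          (logConst d * ((1 + ‖q.1‖) ^ 2 * (1 + ‖q.2.1‖) ^ 2)) := by
          gcongr
          exact a2.trans (by gcongr)
      _ = _ := by ring
  have h4 := h2.1 (h1.2 h3)
  refine h4.congr (ae_of_all _ fun q => ?_)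
  change ‖vPrime q.1 q.2.1 q.2.2 - wPrime q.1 q.2.1 q.2.2‖ ^ μ *
    (f (vPrime q.1 q.2.1 q.2.2) / maxwellian (vPrime q.1 q.2.1 q.2.2)) *
      Real.log (maxwellian q.1) = _
  rw [norm_sub_wPrime]

theorem HasMoments.integrable_gainRem (H : HasMoments μ f) (hμ : 0 ≤ μ) (hd : 1 ≤ d)
    (hb : IsAngularKernel d b) : Integrable (gainRem b μ f) := by
  have hm := H.measurable
  have hg := one_le_gaussMoment (d := d) hμ
  have i1 := integrable_kernel_of_joint (H.integrable_gain_log hμ hd hb)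
  have hk : Integrable (fun v => (1 + ‖v‖) ^ μ *
      ((f v * Real.log (f v) - f v * Real.log (maxwellian v)) / maxwellian v)) (gauss d) := by
    rw [integrable_gauss_iff]
    refine (H.entropy.sub H.integrable_log_maxwellian).congr (ae_of_all _ fun v => ?_)
    have := (maxwellian_pos v).ne'
    simp only [Pi.sub_apply]
    field_simp
  have i2 := integrable_kernel_of_joint (integrable_weight_mul hd hb
    (lintegral_norm_sub_rpow_le hμ) (by linarith) (by fun_prop) hk)
  refine (i1.add i2).congr (ae_of_all _ fun v => ?_)
  have := (maxwellian_pos v).ne'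
  simp only [Pi.add_apply, gainRem]
  rw [integral_mul_const, integral_mul_const,
    gainOp_eq hb (h := fun v => f v / maxwellian v) (fun _ => rfl)]
  field_simp

theorem HasMoments.gainRem_le (H : HasMoments μ f) (hμ : 0 ≤ μ) (hd : 1 ≤ d)
    (hb : IsAngularKernel d b) (v : Vel d) :
    gainRem b μ f v ≤ gaussMoment d μ * ((1 + ‖v‖) ^ μ * (f v * Real.log (f v))) +
      2 * logConst d * gaussMoment d μ * ((1 + ‖v‖) ^ (μ + 2) * f v) +
      gaussMoment d μ * (maxwellian v * (1 + ‖v‖) ^ μ) := by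
  have hM := maxwellian_pos v
  have hf := H.nonneg v
  have hg := one_le_gaussMoment (d := d) hμ
  have hlog := log_maxwellian_nonpos v
  have hK : 0 ≤ gainOp b μ f v := by
    rw [gainOp_eq hb (h := fun v => f v / maxwellian v) (fun _ => rfl)]
    refine mul_nonneg hM.le (integral_nonneg fun p => ?_)
    exact mul_nonneg (Real.rpow_nonneg (norm_nonneg _) _) (H.div_nonneg _)
  -- The term K_μ f log M is simply discarded.
  have hK2 : gainOp b μ f v * Real.log (maxwellian v) ≤ 0 := mul_nonpos_of_nonneg_of_nonpos hK hlog
  have hΛ := integral_collKer_rpow_le hd hb hμ v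
  have hΛ0 : 0 ≤ ∫ p, ‖v - p.1‖ ^ μ ∂(collKer d b v) :=
    integral_nonneg fun p => Real.rpow_nonneg (norm_nonneg _) _
  have hkl : 0 ≤ maxwellian v * klFun (f v / maxwellian v) :=
    mul_nonneg hM.le (klFun_nonneg (H.div_nonneg v))
  rw [maxwellian_mul_klFun] at hkl
  have hlm : f v * -Real.log (maxwellian v) ≤ f v * (logConst d * (1 + ‖v‖) ^ 2) := by
    have h1 := abs_log_maxwellian_le v
    rw [abs_of_nonpos hlog] at h1
    have h2 := logConst_pos (d := d)
    have h3 : logConst d * (1 + ‖v‖ ^ 2) ≤ logConst d * (1 + ‖v‖) ^ 2 := by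
      gcongr
      nlinarith [norm_nonneg v]
    gcongr
    exact h1.trans h3
  have hl0 : 0 ≤ f v * -Real.log (maxwellian v) := mul_nonneg hf (by linarith)
  have hw : 0 ≤ (1 + ‖v‖) ^ μ := by positivity
  rw [gainRem, one_add_norm_rpow_add_two]
  set Λ := ∫ p, ‖v - p.1‖ ^ μ ∂(collKer d b v)
  set l := f v * Real.log (f v)
  set m := f v * -Real.log (maxwellian v) with hmdef
  have em : f v * Real.log (maxwellian v) = -m := by rw [hmdef]; ring
  rw [em] at hkl ⊢
  set W := gaussMoment d μ * (1 + ‖v‖) ^ μ with hW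
  have hW0 : 0 ≤ W := by positivity
  have h1 : l * Λ ≤ W * (l + m + maxwellian v) := by
    -- The collision frequency Λ is only bounded above by W, so the sign of f log f matters. Where
    -- it is negative, l Λ ≤ 0 and the right side is nonnegative because M klFun(f/M) ≥ 0 gives l +
    -- m + M ≥ f.
    rcases le_total 0 l with hl | hl
    · calc l * Λ ≤ l * W := by gcongr
        _ ≤ _ := by nlinarith [mul_nonneg hW0 hl0, mul_nonneg hW0 hM.le]
    · calc l * Λ ≤ 0 := mul_nonpos_of_nonpos_of_nonneg hl hΛ0
        _ ≤ _ := mul_nonneg hW0 (by linarith)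
  have h2 : m * Λ ≤ m * W := by gcongr
  have h3 : W * m ≤ W * (f v * (logConst d * (1 + ‖v‖) ^ 2)) := by gcongr
  have e : gaussMoment d μ * ((1 + ‖v‖) ^ μ * l) +
      2 * logConst d * gaussMoment d μ * ((1 + ‖v‖) ^ μ * (1 + ‖v‖) ^ 2 * f v) +
      gaussMoment d μ * (maxwellian v * (1 + ‖v‖) ^ μ) =
      W * l + 2 * (W * (f v * (logConst d * (1 + ‖v‖) ^ 2))) + W * maxwellian v := by
    rw [hW]; ring
  rw [e]
  nlinarith

theorem HasMoments.one_le_moment (H : HasMoments μ f) (hμ : 0 ≤ μ) :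
    1 ≤ ∫ v, (1 + ‖v‖) ^ (μ + 2) * f v := by
  refine H.mass.symm.trans_le (integral_mono H.integrable H.moment fun v => ?_)
  refine le_mul_of_one_le_left (H.nonneg v) (Real.one_le_rpow ?_ (by linarith))
  linarith [norm_nonneg v]

theorem HasMoments.integral_gainRem_le (H : HasMoments μ f) (hμ : 0 ≤ μ) (hd : 1 ≤ d)
    (hb : IsAngularKernel d b) :
    ∫ v, gainRem b μ f v ≤
      gaussMoment d μ * (∫ v, (1 + ‖v‖) ^ μ * (f v * Real.log (f v))) +
      (2 * logConst d * gaussMoment d μ + gaussMoment d μ ^ 2) *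
        (∫ v, (1 + ‖v‖) ^ (μ + 2) * f v) := by
  have hg := one_le_gaussMoment (d := d) hμ
  have i3 := integrable_gauss_iff.1 (integrable_one_add_norm_rpow (d := d) hμ)
  have i1 := H.entropy.const_mul (gaussMoment d μ)
  have i2 := H.moment.const_mul (2 * logConst d * gaussMoment d μ)
  have i4 := i3.const_mul (gaussMoment d μ)
  have h1 := integral_mono (H.integrable_gainRem hμ hd hb) ((i1.add i2).add i4)
    (H.gainRem_le hμ hd hb)
  have a1 := integral_add (i1.add i2) i4
  have a2 := integral_add i1 i2
  simp only [Pi.add_apply] at a1 a2 h1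
  rw [a1, a2, integral_const_mul, integral_const_mul, integral_const_mul, ← integral_gauss] at h1
  -- The constant term left by the Maxwellian is the square of `gaussMoment`; it is absorbed because
  -- the moment of order μ + 2 is at least the unit mass.
  have h2 := H.one_le_moment hμ
  have h3 : gaussMoment d μ ^ 2 * 1 ≤ gaussMoment d μ ^ 2 * ∫ v, (1 + ‖v‖) ^ (μ + 2) * f v := by
    gcongr
  have e : gaussMoment d μ * ∫ w : Vel d, (1 + ‖w‖) ^ μ ∂(gauss d) = gaussMoment d μ ^ 2 := by
    rw [gaussMoment]; ring
  rw [e] at h1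
  linarith

theorem HasMoments.entropyProduction_le (H : HasMoments μ f) (hμ : 0 ≤ μ) (hd : 1 ≤ d)
    (hb : IsAngularKernel d b) :
    HasExtIntegral (gainLogIntegrand b μ f) ∧ entropyProduction b μ f =
      ((∫ v, gainRem b μ f v : ℝ) : EReal) - extIntegral (gainLogIntegrand b μ f) := by
  have hg := one_le_gaussMoment (d := d) hμ
  have hC := lintegral_norm_sub_rpow_le (d := d) hμ
  have hg0 : 0 ≤ gaussMoment d μ := by linarith
  set h : Vel d → ℝ := fun v => f v / maxwellian v with hh
  have hA1 := H.integrable_joint hd hb hC hg0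
  have hA2 := H.integrable_joint_klFun hμ hd hb hC hg0
  have hR := integrable_prodRem hd hb H.measurable_div hA2
  have hR' := H.integrable_gainRem hμ hd hb
  have hp := productionIntegrand_ae_eq hd hb H.measurable_div H.div_nonneg (fun _ => rfl) hA1 hA2
  have hae : ∀ᵐ v, gainLogIntegrand b μ f v =
      -((prodMain b μ h v : EReal) + ((prodRem b μ h v - gainRem b μ f v : ℝ) : EReal)) := by
    filter_upwards [hp, ae_kernel_of_joint hA1,
      ae_kernel_of_joint (integrable_swap hd hb H.measurable_div hA1)] with v h1 i1 i2
    exact gainLogIntegrand_eq hb H.nonneg i1 i2 h1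
  have hRR : Integrable fun v => prodRem b μ h v - gainRem b μ f v := hR.sub hR'
  refine ⟨Or.inl (posInt_ne_top_of_ae_eq hRR hae), ?_⟩
  have e1 := neg_extIntegral_eq (measurable_prodMain H.measurable_div).aemeasurable hRR hae
  rw [integral_sub hR hR', integral_prodRem hd hb H.measurable_div hA2, zero_sub,
    lintegral_prodMain H.measurable_div] at e1
  rw [(H.entropyProduction_eq hμ hd hb hC hg0).2, sub_eq_add_neg, e1]
  -- S may be infinite, in which case both sides are +∞; otherwise the integral of `gainRem`
  -- cancels.
  generalize prodTotal b μ _ = S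
  induction S with
  | top => simp
  | coe S =>
    have c : (((S : ℝ≥0∞) : EReal)) = ((S : ℝ) : EReal) := rfl
    rw [c, ← EReal.coe_add, ← EReal.coe_add]
    congr 1
    ring

end UpperBound

end Bounds

/-! ### The linear entropy inequality with constant 1/2. -/

section RelativeEntropy

open ProbabilityTheory InformationTheory

variable {d : ℕ} {b : ℝ → ℝ} {f : Vel d → ℝ}

theorem HasMoments.half_relEntropy_le (H : HasMoments 0 f) (hd : 1 ≤ d)
    (hb : IsAngularKernel d b) :
    HasExtIntegral (productionIntegrand b 0 f) ∧
      ((ENNReal.ofReal (1 / 2) * relEntropy f : ℝ≥0∞) : EReal) ≤ entropyProduction b 0 f := by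
  have hd0 : -(d : ℝ) < 0 := by
    have : (1 : ℝ) ≤ d := by exact_mod_cast hd
    linarith
  obtain ⟨C, hC0, hC⟩ := exists_lintegral_norm_sub_rpow_le (α := 0) hd hd0 le_rfl
  have E0 := H.entropyProduction_eq le_rfl hd hb hC hC0
  refine ⟨E0.1, ?_⟩
  have hk : Integrable (fun v => klFun (f v / maxwellian v)) (gauss d) := by
    simpa using H.integrable_klFun le_rfl
  have hi : Integrable (fun v => f v / maxwellian v) (gauss d) := by
    simpa using H.integrable_div
  have h1 : ∫ v, f v / maxwellian v ∂(gauss d) = 1 := by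
    rw [integral_gauss, ← H.mass]
    refine integral_congr_ae (ae_of_all _ fun v => ?_)
    have := (maxwellian_pos v).ne'
    field_simp
  rw [E0.2, EReal.coe_ennreal_le_coe_ennreal_iff, H.relEntropy_eq,
    ← ENNReal.ofReal_mul (by norm_num)]
  exact half_integral_klFun_le_prodTotal hd hb H.measurable_div H.div_nonneg hi h1 hk

end RelativeEntropy

end LinBoltz

end

theorem theorem2p2 (d : ℕ) (hd : 1 ≤ d) :
    -- the interpolation inequalities; `lam` depends only on `d` and `b`
    (∀ b : ℝ → ℝ, LinBoltz.IsAngularKernel d b → ∃ lam : ℝ, 0 < lam ∧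
      (∀ f : LinBoltz.Vel d → ℝ, LinBoltz.IsUnitMass f →
        LinBoltz.MemL1LogL 0 f → LinBoltz.MemL1 2 f →
        LinBoltz.HasExtIntegral (LinBoltz.productionIntegrand b 0 f) ∧
        ((ENNReal.ofReal lam * LinBoltz.relEntropy f : ENNReal) : EReal) ≤
          LinBoltz.entropyProduction b 0 f) ∧
      (∀ γ μ : ℝ, -(d : ℝ) < γ → γ < 0 → 0 < μ →
        ∀ f : LinBoltz.Vel d → ℝ, LinBoltz.IsUnitMass f →
        LinBoltz.MemL1LogL μ f → LinBoltz.MemL1 (μ + 2) f →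
        (∀ α ∈ ({γ, 0, μ} : Set ℝ),
          LinBoltz.HasExtIntegral (LinBoltz.productionIntegrand b α f) ∧
          0 ≤ LinBoltz.entropyProduction b α f) ∧
        LinBoltz.relEntropy f < ⊤ ∧
        (LinBoltz.entropyProduction b 0 f).toENNReal ^ ((μ - γ) / μ) *
            (LinBoltz.entropyProduction b μ f).toENNReal ^ (γ / μ) ≤
          (LinBoltz.entropyProduction b γ f).toENNReal ∧
        ENNReal.ofReal lam ^ (1 - γ / μ) *
            (LinBoltz.entropyProduction b μ f).toENNReal ^ (γ / μ) *
            LinBoltz.relEntropy f ^ (1 - γ / μ) ≤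
          (LinBoltz.entropyProduction b 0 f).toENNReal ^ ((μ - γ) / μ) *
            (LinBoltz.entropyProduction b μ f).toENNReal ^ (γ / μ))) ∧
    -- the upper bound; the constants depend only on `d` and `μ`
    (∀ μ : ℝ, 0 < μ → ∃ C₁ C₂ : ℝ, 0 < C₁ ∧ 0 < C₂ ∧
      ∀ b : ℝ → ℝ, LinBoltz.IsAngularKernel d b →
      ∀ f : LinBoltz.Vel d → ℝ, LinBoltz.IsUnitMass f →
        LinBoltz.MemL1LogL μ f → LinBoltz.MemL1 (μ + 2) f →
        MeasureTheory.Integrable (fun v => (1 + ‖v‖) ^ μ * (f v * Real.log (f v))) ∧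
        MeasureTheory.Integrable (fun v => (1 + ‖v‖) ^ (μ + 2) * f v) ∧
        LinBoltz.HasExtIntegral (LinBoltz.gainLogIntegrand b μ f) ∧
        LinBoltz.entropyProduction b μ f ≤
          ((C₁ * (∫ v, (1 + ‖v‖) ^ μ * (f v * Real.log (f v))) +
            C₂ * (∫ v, (1 + ‖v‖) ^ (μ + 2) * f v) : ℝ) : EReal)
          - LinBoltz.extIntegral (LinBoltz.gainLogIntegrand b μ f)) := by
  open LinBoltz in
  refine ⟨fun b hb => ⟨1 / 2, by norm_num, ?_, ?_⟩, ?_⟩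
  · intro f hu h1 h2
    have H : HasMoments 0 f := hasMoments_of_mem le_rfl hu h1 (by simpa using h2)
    exact H.half_relEntropy_le hd hb
  · intro γ μ hγd hγ hμ f hu h1 h2
    have H : HasMoments μ f := hasMoments_of_mem hμ.le hu h1 h2
    have H0 : HasMoments 0 f := H.mono hμ.le
    have hd0 : -(d : ℝ) < 0 := by linarith
    obtain ⟨C, hC0, hC⟩ := exists_lintegral_norm_sub_rpow_le hd hγd hγ.le
    obtain ⟨C', hC0', hC'⟩ := exists_lintegral_norm_sub_rpow_le (α := 0) hd hd0 le_rfl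
    -- For γ < 0 the averaged weight is bounded in v, so the moments of order 0 suffice.
    have Eγ := H0.entropyProduction_eq le_rfl hd hb hC hC0
    have E0 := H0.entropyProduction_eq le_rfl hd hb hC' hC0'
    have Eμ := H.entropyProduction_eq hμ.le hd hb (lintegral_norm_sub_rpow_le hμ.le)
      (zero_le_one.trans (one_le_gaussMoment hμ.le))
    have hhalf := (H0.half_relEntropy_le hd hb).2
    rw [E0.2, EReal.coe_ennreal_le_coe_ennreal_iff] at hhalf
    refine ⟨?_, ?_, ?_, ?_⟩
    · rintro α (rfl | rfl | rfl)
      · exact ⟨Eγ.1, Eγ.2 ▸ EReal.coe_ennreal_nonneg _⟩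
      · exact ⟨E0.1, E0.2 ▸ EReal.coe_ennreal_nonneg _⟩
      · exact ⟨Eμ.1, Eμ.2 ▸ EReal.coe_ennreal_nonneg _⟩
    · rw [H0.relEntropy_eq]
      exact ENNReal.ofReal_lt_top
    · rw [Eγ.2, E0.2, Eμ.2, EReal.toENNReal_coe, EReal.toENNReal_coe, EReal.toENNReal_coe]
      exact rpow_mul_rpow_neg_le hγ hμ (prodTotal_zero_le hd hb H.measurable_div hγ hμ)
    · rw [E0.2, Eμ.2, EReal.toENNReal_coe, EReal.toENNReal_coe]
      have e : (μ - γ) / μ = 1 - γ / μ := by field_simp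
      have hp : 0 ≤ 1 - γ / μ := by
        have := div_neg_of_neg_of_pos hγ hμ
        linarith
      -- The exponents agree, so the last inequality is `hhalf` raised to the nonnegative power 1 -
      -- γ/μ and multiplied by the common factor.
      rw [e, mul_right_comm, ← ENNReal.mul_rpow_of_nonneg _ _ hp]
      gcongr
  · intro μ hμ
    have hg := one_le_gaussMoment (d := d) hμ.le
    have hl := logConst_pos (d := d)
    refine ⟨gaussMoment d μ, 2 * logConst d * gaussMoment d μ + gaussMoment d μ ^ 2,
      by positivity, by positivity, ?_⟩
    intro b hb f hu h1 h2
    have H : HasMoments μ f := hasMoments_of_mem hμ.le hu h1 h2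
    obtain ⟨hE, hD⟩ := H.entropyProduction_le hμ.le hd hb
    refine ⟨H.entropy, H.moment, hE, ?_⟩
    rw [hD]
    exact EReal.sub_le_sub (EReal.coe_le_coe_iff.2 (H.integral_gainRem_le hμ.le hd hb)) le_rfl
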